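/- Chains of loops. Let $g\ge 1$. A chain of $g$ loops $\Gamma$ is the metric graph with vertices $w_0,\dots,w_g,v_1,\dots,v_{g+1}$, a bridge $\beta_k$ of length $n_k>0$ from $w_k$ to $v_{k+1}$ for $0\le k\le g$, and, for $1\le k\le g$, two edges (the $k$-th loop) of lengths $\ell_k>0$ and $m_k>0$ from $v_k$ to $w_k$. A divisor on $\Gamma$ is a finite formal integer combination of points. $\mathrm{PL}(\Gamma)$ is the set of continuous piecewise linear functions with integer slopes, and $\operatorname{div}\psi$ is the divisor whose coefficient at each point is the sum of the incoming slopes of $\psi$. Two divisors are equivalent if they differ by some $\operatorname{div}\psi$ with $\psi\in \mathrm{PL}(\Gamma)$. The rank of a divisor is its Baker–Norine rank. The class of a divisor $D$ of rank $r$ is vertex avoiding if for each $0\le i\le r$ there is a unique effective divisor $D_i\sim D$ with $D_i\ge i\,w_0+(r-i)\,v_{g+1}$, and this $D_i$ has degree exactly $i$ at $w_0$, degree exactly $r-i$ at $v_{g+1}$, and no chip at $v_1,w_1,\dots,v_g,w_g$. In this case choose $\psi_i\in\mathrm{PL}(\Gamma)$ with $D+\operatorname{div}\psi_i=D_i$ (unique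 up to an additive constant), and put $\psi_I=\sum_{i\in I}\psi_i$ for each multiset $I$ in $\{0,\dots,r\}$. A finite family of functions $\{f_j\}$ on $\Gamma$ is tropically independent if there are no real numbers $b_j$ such that the minimum of the values $f_j(x)+b_j$ occurs at least twice at every point $x\in\Gamma$. The conjecture. For integers $r,s,m\ge 1$ and $\rho\ge 0$ put $g=(r+1)s+\rho$ and $d=g+r-s$. The edge lengths of a chain of $g$ loops are called generic with constant $C$ if 1. $4g\,m_k<\ell_k$ for $1\le k\le g$, and there is no nontrivial relation $c_1m_1+\dots+c_gm_g=0$ with integers $|c_k|\le g+1$; 2. $C\,\ell_k<\min\{n_{k-1},n_k\}$ for $1\le k\le g$, and $$C\Big(\sum_{i=\alpha s+1}^{(\alpha+1)s}\ell_i+\sum_{i=\alpha s+1}^{(\alpha+1)s-1}n_i\Big)<\min\{n_{\alpha s},n_{(\alpha+1)s}\}\qquad\text{for } 0\le\alpha\le r.$$ The tropical maximal rank conjecture for $(r,s,\rho,m)$ is the assertion that for all positive loop lengths $(\ell_k,m_k)_{1\le k\le g}$ that satisfy (1), and for every real $C$, there are bridge lengths $(n_k)_{0\le k\le g}$ that satisfy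 (2), a divisor $D$ of degree $d$ and rank $r$ whose class is vertex avoiding on the corresponding chain of $g$ loops, and a set of exactly $\min\{\binom{r+m}{m},\,md-g+1\}$ multisets $I$ of size $m$ in $\{0,\dots,r\}$ for which the functions $\psi_I$ are tropically independent. We say that $(r,s,\rho,m)$ is in the surjective range if $\binom{r+m}{m}\ge md-g+1$. Theorem 1.2. Let $s\ge1$, $m\ge 1$, $\rho\ge 0$ and $r\ge s$ be integers such that $(r,s,\rho,m)$ is in the surjective range. If the tropical maximal rank conjecture holds for $(r,s,\rho,m)$, then it holds for $(r+1,s,\rho,m)$. -/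

import Mathlib

noncomputable section

open scoped Topology

/-- A metric graph: vertices `V`, (oriented) edges `E`, each edge an interval of positive length
glued to the vertices at its two ends. The orientation only serves to parametrize the edges. -/
structure MetricGraph (V E : Type) where
  src : E → V
  tgt : E → V
  len : E → ℝ
  len_pos : ∀ e, 0 < len e

namespace MetricGraph

variable {V E : Type}

/-- The points of a metric graph: the vertices, and the points in the interior of the edges
(the point of `e` at distance `t` from its source). -/
inductive Point (Γ : MetricGraph V E) : Type
  | vertex (v : V) : Point Γ
  | inner (e : E) (t : ℝ) (ht : 0 < t ∧ t < Γ.len e) : Point Γ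

open Classical in
/-- The parametrization of the closed edge `e` by `[0, len e]`
(continued by the end points outside this interval). -/
def pt (Γ : MetricGraph V E) (e : E) (t : ℝ) : Γ.Point :=
  if h : 0 < t ∧ t < Γ.len e then Point.inner e t h
  else if t ≤ 0 then Point.vertex (Γ.src e) else Point.vertex (Γ.tgt e)

/-- `PL(Γ)`: the continuous piecewise linear functions with integer slopes. On every closed edge,
the function is, near each point and on each side of it, affine of integer slope with the value of
the function at this point as its limit. -/
def IsPL (Γ : MetricGraph V E) (f : Γ.Point → ℝ) : Prop :=
  ∀ e : E,
    (∀ t : ℝ, 0 ≤ t → t < Γ.len e →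
      ∃ n : ℤ, ∀ᶠ u in 𝓝[>] t, f (Γ.pt e u) = f (Γ.pt e t) + n * (u - t)) ∧
    (∀ t : ℝ, 0 < t → t ≤ Γ.len e →
      ∃ n : ℤ, ∀ᶠ u in 𝓝[<] t, f (Γ.pt e u) = f (Γ.pt e t) + n * (u - t))

open Classical in
/-- The coefficient of `div f` at a point: the sum of the incoming slopes of `f`
(minus the sum of the outgoing slopes). -/
def ord [Fintype E] (Γ : MetricGraph V E) (f : Γ.Point → ℝ) : Γ.Point → ℝ
  | Point.vertex v =>
      (∑ e : E with Γ.tgt e = v,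
        derivWithin (fun t => f (Γ.pt e t)) (Set.Iio (Γ.len e)) (Γ.len e)) -
      ∑ e : E with Γ.src e = v, derivWithin (fun t => f (Γ.pt e t)) (Set.Ioi 0) 0
  | Point.inner e t _ =>
      derivWithin (fun u => f (Γ.pt e u)) (Set.Iio t) t -
      derivWithin (fun u => f (Γ.pt e u)) (Set.Ioi t) t

/-- Divisors are finite formal integer combinations of points; `D` is effective if `0 ≤ D`. -/
abbrev Divisor (Γ : MetricGraph V E) : Type := Γ.Point →₀ ℤ

/-- The degree of a divisor. -/
def deg {Γ : MetricGraph V E} (D : Γ.Divisor) : ℤ := D.sum fun _ a => a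

variable [Fintype E]

/-- `f ∈ PL(Γ)` and `D + div f = D'`. -/
def Carries (Γ : MetricGraph V E) (f : Γ.Point → ℝ) (D D' : Γ.Divisor) : Prop :=
  Γ.IsPL f ∧ ∀ p, (D' p : ℝ) = D p + Γ.ord f p

/-- Linear equivalence of divisors. -/
def LinEquiv (Γ : MetricGraph V E) (D D' : Γ.Divisor) : Prop :=
  ∃ f : Γ.Point → ℝ, Γ.Carries f D D'

/-- The (Baker–Norine) rank of `D` is at least `r`: for every effective divisor `F` of degree `r`,
the divisor `D - F` is equivalent to an effective divisor. -/
def RankGE (Γ : MetricGraph V E) (D : Γ.Divisor) (r : ℕ) : Prop :=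
  ∀ F : Γ.Divisor, 0 ≤ F → deg F = r → ∃ D' : Γ.Divisor, 0 ≤ D' ∧ Γ.LinEquiv (D - F) D'

/-- The divisor `D` has rank exactly `r`. -/
def HasRank (Γ : MetricGraph V E) (D : Γ.Divisor) (r : ℕ) : Prop :=
  Γ.RankGE D r ∧ ¬ Γ.RankGE D (r + 1)

end MetricGraph

/-- A finite family of functions `f i`, `i ∈ S`, is tropically dependent if there are real
constants `b i` such that at every point the minimum of the `f i + b i` occurs at least twice. -/
def TropicallyDependent {ι X : Type} (S : Finset ι) (f : ι → X → ℝ) : Prop :=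
  ∃ b : ι → ℝ, ∀ x : X, ∃ i ∈ S, ∃ j ∈ S, i ≠ j ∧
    f i x + b i = f j x + b j ∧ ∀ k ∈ S, f i x + b i ≤ f k x + b k

/-- Tropical independence. -/
def TropicallyIndependent {ι X : Type} (S : Finset ι) (f : ι → X → ℝ) : Prop :=
  ¬ TropicallyDependent S f

/-- The vertices of the chain of `g` loops: `w k` is `w_k` for `0 ≤ k ≤ g`, and
`v k` is `v_{k+1}` for `0 ≤ k ≤ g`. -/
inductive ChainVertex (g : ℕ) : Type
  | w (k : Fin (g + 1)) : ChainVertex g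
  | v (k : Fin (g + 1)) : ChainVertex g

/-- The edges of the chain of `g` loops: `bridge k` is the bridge `β_k` for `0 ≤ k ≤ g`;
`top k` and `bottom k` are the top and bottom edges of the loop number `k + 1`. -/
inductive ChainEdge (g : ℕ) : Type
  | bridge (k : Fin (g + 1)) : ChainEdge g
  | top (k : Fin g) : ChainEdge g
  | bottom (k : Fin g) : ChainEdge g
  deriving Fintype

/-- The chain of `g` loops with bridges. The bridge `β_k` joins `w_k` to `v_{k+1}` and has length
`n k` for `0 ≤ k ≤ g`; the top and bottom edges of the `k`-th loop join `v_k` to `w_k` and have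
lengths `ℓ k` and `m k` for `1 ≤ k ≤ g`. The other values of the sequences are not used. -/
def chainOfLoops (g : ℕ) (ℓ m n : ℕ → ℝ) (hℓ : ∀ k, 0 < ℓ k) (hm : ∀ k, 0 < m k)
    (hn : ∀ k, 0 < n k) : MetricGraph (ChainVertex g) (ChainEdge g) where
  src
    | .bridge k => .w k
    | .top k => .v k.castSucc
    | .bottom k => .v k.castSucc
  tgt
    | .bridge k => .v k
    | .top k => .w k.succ
    | .bottom k => .w k.succ
  len
    | .bridge k => n k
    | .top k => ℓ (k + 1)
    | .bottom k => m (k + 1)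
  len_pos
    | .bridge _ => hn _
    | .top _ => hℓ _
    | .bottom _ => hm _

/-- The conditions of admissibility on the lengths of the edges of the loops:
`4 g m_k < ℓ_k` for all `k`, and no nontrivial integer linear relation with coefficients of
absolute value at most `g + 1` between the `m_k`. -/
def AdmissibleLoops (g : ℕ) (ℓ m : ℕ → ℝ) : Prop :=
  (∀ k ∈ Finset.Icc 1 g, 4 * (g : ℝ) * m k < ℓ k) ∧
  ∀ c : ℕ → ℤ, (∀ k ∈ Finset.Icc 1 g, |c k| ≤ (g : ℤ) + 1) →
    ∑ k ∈ Finset.Icc 1 g, (c k : ℝ) * m k = 0 → ∀ k ∈ Finset.Icc 1 g, c k = 0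

/-- The conditions of admissibility on the lengths of the bridges, where `a ≪ b` is read as
`C * a < b`: each loop is much shorter than the two bridges next to it, and each of the `r + 1`
blocks of `s` consecutive loops is much shorter than the two bridges next to it. -/
def AdmissibleBridges (g r s : ℕ) (ℓ n : ℕ → ℝ) (C : ℝ) : Prop :=
  (∀ k ∈ Finset.Icc 1 g, C * ℓ k < min (n (k - 1)) (n k)) ∧
  ∀ α ≤ r, C * ((∑ i ∈ Finset.Icc (α * s + 1) ((α + 1) * s), ℓ i) +
      ∑ i ∈ Finset.Ico (α * s + 1) ((α + 1) * s), n i) < min (n (α * s)) (n ((α + 1) * s))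

section Chain

variable {g : ℕ} (Γ : MetricGraph (ChainVertex g) (ChainEdge g))

/-- The left end point `w_0` of the chain. -/
def leftEnd : Γ.Point := .vertex (.w 0)

/-- The right end point `v_{g+1}` of the chain. -/
def rightEnd : Γ.Point := .vertex (.v (Fin.last g))

/-- The class of `D` (of rank `r`) is vertex avoiding: for each `0 ≤ i ≤ r` there is a unique
effective divisor `D_i` equivalent to `D` with `D_i ≥ i w_0 + (r - i) v_{g+1}`; it has degree
exactly `i` at `w_0` and exactly `r - i` at `v_{g+1}`, and it has no chip at any of the other
vertices `v_1, w_1, …, v_g, w_g`. -/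
def VertexAvoiding (D : Γ.Divisor) (r : ℕ) : Prop :=
  ∀ i ≤ r, ∃ D' : Γ.Divisor,
    (Γ.LinEquiv D D' ∧ 0 ≤ D' ∧
      D' (leftEnd Γ) = (i : ℤ) ∧ D' (rightEnd Γ) = (r : ℤ) - i ∧
      ∀ k : Fin g, D' (.vertex (.v k.castSucc)) = 0 ∧ D' (.vertex (.w k.succ)) = 0) ∧
    ∀ F : Γ.Divisor, Γ.LinEquiv D F → 0 ≤ F →
      (i : ℤ) ≤ F (leftEnd Γ) → (r : ℤ) - i ≤ F (rightEnd Γ) → F = D'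

/-- `ψ_0, …, ψ_r` are distinguished functions of `D`: each `D + div ψ_i` is an effective divisor
`D_i` of degree `i` at `w_0` and of degree `r - i` at `v_{g+1}`. -/
def IsDistinguished (D : Γ.Divisor) (r : ℕ) (ψ : Fin (r + 1) → Γ.Point → ℝ) : Prop :=
  ∀ i : Fin (r + 1), ∃ D' : Γ.Divisor, 0 ≤ D' ∧
    D' (leftEnd Γ) = (i : ℤ) ∧ D' (rightEnd Γ) = (r : ℤ) - i ∧ Γ.Carries (ψ i) D D'

end Chain

/-- The function `ψ_I = ∑_{i ∈ I} ψ_i` of a multiset `I` of size `m`. -/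
def multisetSum {r m : ℕ} {X : Type} (ψ : Fin (r + 1) → X → ℝ) (I : Sym (Fin (r + 1)) m) (x : X) :
    ℝ :=
  ((I : Multiset (Fin (r + 1))).map fun i => ψ i x).sum

/-- The genus `g = (r + 1) s + ρ`. -/
def mrcGenus (r s ρ : ℕ) : ℕ := (r + 1) * s + ρ

/-- The degree `d = g + r - s`. -/
def mrcDegree (r s ρ : ℕ) : ℤ := (mrcGenus r s ρ : ℤ) + r - s

/-- `(r, s, ρ, m)` is in the surjective range: `m d - g + 1 ≤ (r + m choose m)`. -/
def SurjectiveRange (r s ρ m : ℕ) : Prop :=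
  (m : ℤ) * mrcDegree r s ρ - mrcGenus r s ρ + 1 ≤ ((r + m).choose m : ℤ)

/-- The conclusion of the tropical maximal rank conjecture on a given chain of `g` loops: there are
a divisor `D` of degree `d` and rank `r` whose class is vertex avoiding, and a tropically
independent set of `min {(r + m choose m), m d - g + 1}` functions `ψ_I`, `|I| = m`. -/
def MaximalRankOn {g : ℕ} (Γ : MetricGraph (ChainVertex g) (ChainEdge g)) (d : ℤ) (r m : ℕ) :
    Prop :=
  ∃ D : Γ.Divisor, MetricGraph.deg D = d ∧ Γ.HasRank D r ∧ VertexAvoiding Γ D r ∧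
    ∃ ψ : Fin (r + 1) → Γ.Point → ℝ, IsDistinguished Γ D r ψ ∧
      ∃ A : Finset (Sym (Fin (r + 1)) m),
        (A.card : ℤ) = min ((r + m).choose m : ℤ) ((m : ℤ) * d - g + 1) ∧
        TropicallyIndependent A (multisetSum ψ)

/-- The tropical maximal rank conjecture for `(r, s, ρ, m)`: for every chain of `g` loops with
generic edge lengths, in the sense that the loops are arbitrary admissible ones and the bridges are
suitably long (for every constant `C`, they can be taken admissible for `a ≪ b` read as
`C * a < b`), there are a divisor and a tropically independent set as predicted. -/
def TropicalMRC (r s ρ m : ℕ) : Prop :=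
  ∀ (ℓ μ : ℕ → ℝ) (hℓ : ∀ k, 0 < ℓ k) (hμ : ∀ k, 0 < μ k),
    AdmissibleLoops (mrcGenus r s ρ) ℓ μ →
    ∀ C : ℝ, ∃ (n : ℕ → ℝ) (hn : ∀ k, 0 < n k),
      AdmissibleBridges (mrcGenus r s ρ) r s ℓ n C ∧
      MaximalRankOn (chainOfLoops (mrcGenus r s ρ) ℓ μ n hℓ hμ hn) (mrcDegree r s ρ) r m

end

noncomputable section

open scoped Topology

open MetricGraph

/-! Put `s` new loops in front of a chain of `g` loops that has the maximal rank property for `r`,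
and join them to it by a very long bridge.

Divisors become combinatorial through an Abel–Jacobi theorem (`chain_linEquiv_iff`): two divisors
are equivalent iff they have the same degree and, for each loop, the same moment modulo the length
of the loop. By `stdDiv_unique` and `exists_eq_stdDiv_of_unique`, the vertex avoiding
representatives `D_i` are exactly the divisors with `i` chips at the left end, `r - i` at the right
end and at most one chip inside each loop. Conversely, a class with such representatives has rank
`r` and is vertex avoiding (`rankGE_of_stdDiv`, `hasRank_of_stdDiv`).

On the long chain the new `D_j`, for `j ≥ 1`, has `j` chips at the left end, one chip on each new
loop, and the chips of the old `D_{j-1}` on the old loops. The new `D_0` has no chip on the new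
loops and one on every old loop: compared with `D_1`, which has `s + 1` chips to the left of the
long bridge, these `s + 1` chips have moved through the old chain, where `s` of them fill the loops
that lack a chip and one reaches the right end. The moved chips could land on vertices. To prevent
this, the old chips are first shifted by a small `ε` on the loops where every `D_i` has a chip;
elsewhere the positions are small multiples of `m_k` and the inequality `4 g m_k < ℓ_k` suffices.
Tropical independence survives a small perturbation by compactness
(`TropicallyIndependent.exists_pos`).

On the long bridge `ψ_0` has slope `s + 1` and `ψ_j` has slope `1 - j` for `j ≥ 1`. The old
independent set, with indices raised by one, has slopes `≤ 0` there. Since `s ≤ r`, there are `(m -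
1)(s + 1) + 1` multisets containing `0` with distinct positive slopes, and this number is exactly
the growth of `m d - g + 1`. If one of these new functions attained the minimum anywhere on the old
chain, going back along the bridge would leave only new functions in competition, and distinct
slopes prevent ties except at finitely many points. So only old functions attain the minimum on the
old chain, where they are independent (`tropicallyIndependent_of_path`). -/

/-- `F` is affine of slope `a` immediately to the right of `t`. -/
def HasRightSlope (F : ℝ → ℝ) (t a : ℝ) : Prop := ∀ᶠ u in 𝓝[>] t, F u = F t + a * (u - t)

/-- `F` is affine of slope `a` immediately to the left of `t`. -/
def HasLeftSlope (F : ℝ → ℝ) (t a : ℝ) : Prop := ∀ᶠ u in 𝓝[<] t, F u = F t + a * (u - t)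

/-! ### One-sided slopes of functions on an interval -/

section Slopes

variable {F G : ℝ → ℝ} {t a b : ℝ}

lemma HasRightSlope.derivWithin (h : HasRightSlope F t a) : derivWithin F (Set.Ioi t) t = a := by
  refine HasDerivWithinAt.derivWithin ?_ (uniqueDiffWithinAt_Ioi t)
  have h1 : HasDerivWithinAt (fun u => F t + a * (u - t)) a (Set.Ioi t) t := by
    have := (((hasDerivWithinAt_id t (Set.Ioi t)).sub_const t).const_mul a).const_add (F t)
    simpa using this
  exact h1.congr_of_eventuallyEq h (by simp)

lemma HasLeftSlope.derivWithin (h : HasLeftSlope F t a) : derivWithin F (Set.Iio t) t = a := by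
  refine HasDerivWithinAt.derivWithin ?_ (uniqueDiffWithinAt_Iio t)
  have h1 : HasDerivWithinAt (fun u => F t + a * (u - t)) a (Set.Iio t) t := by
    have := (((hasDerivWithinAt_id t (Set.Iio t)).sub_const t).const_mul a).const_add (F t)
    simpa using this
  exact h1.congr_of_eventuallyEq h (by simp)

lemma HasRightSlope.unique (h : HasRightSlope F t a) (h' : HasRightSlope F t b) : a = b := by
  rw [← h.derivWithin, h'.derivWithin]

lemma HasRightSlope.add (h : HasRightSlope F t a) (h' : HasRightSlope G t b) :
    HasRightSlope (fun u => F u + G u) t (a + b) := by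
  filter_upwards [h, h'] with u hu hu'
  rw [hu, hu']; ring

lemma HasLeftSlope.add (h : HasLeftSlope F t a) (h' : HasLeftSlope G t b) :
    HasLeftSlope (fun u => F u + G u) t (a + b) := by
  filter_upwards [h, h'] with u hu hu'
  rw [hu, hu']; ring

lemma HasRightSlope.const_mul (c : ℝ) (h : HasRightSlope F t a) :
    HasRightSlope (fun u => c * F u) t (c * a) := by
  filter_upwards [h] with u hu
  rw [hu]; ring

lemma HasLeftSlope.const_mul (c : ℝ) (h : HasLeftSlope F t a) :
    HasLeftSlope (fun u => c * F u) t (c * a) := by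
  filter_upwards [h] with u hu
  rw [hu]; ring

lemma hasRightSlope_affine (c a t : ℝ) : HasRightSlope (fun u => c + a * u) t a :=
  Filter.Eventually.of_forall fun u => by ring

lemma hasLeftSlope_affine (c a t : ℝ) : HasLeftSlope (fun u => c + a * u) t a :=
  Filter.Eventually.of_forall fun u => by ring

lemma HasRightSlope.congr (h : HasRightSlope F t a) (he : ∀ᶠ u in 𝓝[>] t, G u = F u)
    (ht : G t = F t) : HasRightSlope G t a := by
  filter_upwards [h, he] with u hu hu'
  rw [hu', hu, ht]

lemma HasLeftSlope.congr (h : HasLeftSlope F t a) (he : ∀ᶠ u in 𝓝[<] t, G u = F u)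
    (ht : G t = F t) : HasLeftSlope G t a := by
  filter_upwards [h, he] with u hu hu'
  rw [hu', hu, ht]

lemma hasRightSlope_hinge (c t : ℝ) :
    HasRightSlope (fun u => max (u - c) 0) t (if c ≤ t then 1 else 0) := by
  split_ifs with h
  · filter_upwards [self_mem_nhdsWithin] with u hu
    have hu : t < u := hu
    rw [max_eq_left (by linarith), max_eq_left (by linarith)]; ring
  · have h1 : ∀ᶠ u in 𝓝[>] t, u < c := nhdsWithin_le_nhds (Iio_mem_nhds (not_le.1 h))
    filter_upwards [h1] with u hu
    rw [max_eq_right (by linarith), max_eq_right (by linarith)]; ring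

lemma hasLeftSlope_hinge (c t : ℝ) :
    HasLeftSlope (fun u => max (u - c) 0) t (if c < t then 1 else 0) := by
  split_ifs with h
  · have h1 : ∀ᶠ u in 𝓝[<] t, c < u := nhdsWithin_le_nhds (Ioi_mem_nhds h)
    filter_upwards [h1] with u hu
    rw [max_eq_left (by linarith), max_eq_left (by linarith)]; ring
  · filter_upwards [self_mem_nhdsWithin] with u hu
    have hu : u < t := hu
    rw [max_eq_right (by linarith), max_eq_right (by linarith)]; ring

lemma HasRightSlope.hasDerivWithinAt (h : HasRightSlope F t a) :
    HasDerivWithinAt F a (Set.Ici t) t := by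
  rw [← hasDerivWithinAt_Ioi_iff_Ici]
  have h1 : HasDerivWithinAt (fun u => F t + a * (u - t)) a (Set.Ioi t) t := by
    have := (((hasDerivWithinAt_id t (Set.Ioi t)).sub_const t).const_mul a).const_add (F t)
    simpa using this
  exact h1.congr_of_eventuallyEq h (by simp)

lemma HasLeftSlope.hasDerivWithinAt (h : HasLeftSlope F t a) :
    HasDerivWithinAt F a (Set.Iic t) t := by
  rw [← hasDerivWithinAt_Iio_iff_Iic]
  have h1 : HasDerivWithinAt (fun u => F t + a * (u - t)) a (Set.Iio t) t := by
    have := (((hasDerivWithinAt_id t (Set.Iio t)).sub_const t).const_mul a).const_add (F t)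
    simpa using this
  exact h1.congr_of_eventuallyEq h (by simp)

/-- A piecewise linear function on `[0, L]` without kinks in the interior is affine. -/
lemma affine_of_no_kinks {L : ℝ} (hL : 0 < L) {ρ : ℝ → ℝ}
    (hr : ∀ t, 0 ≤ t → t < L → HasRightSlope F t (ρ t))
    (hl : ∀ t, 0 < t → t < L → HasLeftSlope F t (ρ t))
    (hend : ∃ a, HasLeftSlope F L a) :
    ∀ t, 0 ≤ t → t ≤ L → F t = F 0 + ρ 0 * t := by
  -- The slope is locally constant on each side of every point, so `ρ` is continuous with zero right
  -- derivative, hence constant on `[0, L)`. The same criterion is then applied to `F t - ρ 0 * t`;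
  -- the slope at `L` serves only for continuity there.
  have hρr : ∀ t, 0 ≤ t → t < L → ∀ᶠ u in 𝓝[>] t, ρ u = ρ t := by
    intro t h0 h1
    have ht := hr t h0 h1
    obtain ⟨δ, hδ, hsub⟩ := (mem_nhdsGT_iff_exists_Ioo_subset).1 ht
    have hm : ∀ᶠ u in 𝓝[>] t, u ∈ Set.Ioo t (min δ L) :=
      Ioo_mem_nhdsGT (lt_min hδ h1)
    filter_upwards [hm] with u hu
    have hu1 : u < δ := hu.2.trans_le (min_le_left _ _)
    have hu2 : u < L := hu.2.trans_le (min_le_right _ _)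
    refine (hr u (h0.trans hu.1.le) hu2).unique ?_
    have hFu : F u = F t + ρ t * (u - t) := hsub ⟨hu.1, hu1⟩
    filter_upwards [Ioo_mem_nhdsGT hu1] with w hw
    have hFw : F w = F t + ρ t * (w - t) := hsub ⟨hu.1.trans hw.1, hw.2⟩
    rw [hFw, hFu]; ring
  have hρl : ∀ t, 0 < t → t < L → ∀ᶠ u in 𝓝[<] t, ρ u = ρ t := by
    intro t h0 h1
    have ht := hl t h0 h1
    obtain ⟨δ, hδ, hsub⟩ := (mem_nhdsLT_iff_exists_Ioo_subset).1 ht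
    have hm : ∀ᶠ u in 𝓝[<] t, u ∈ Set.Ioo (max δ 0) t :=
      Ioo_mem_nhdsLT (max_lt hδ h0)
    filter_upwards [hm] with u hu
    have hu1 : δ < u := (le_max_left _ _).trans_lt hu.1
    have hu2 : 0 < u := (le_max_right _ _).trans_lt hu.1
    refine (hr u hu2.le (hu.2.trans h1)).unique ?_
    have hFu : F u = F t + ρ t * (u - t) := hsub ⟨hu1, hu.2⟩
    filter_upwards [Ioo_mem_nhdsGT hu.2] with w hw
    have hFw : F w = F t + ρ t * (w - t) := hsub ⟨hu1.trans hw.1, hw.2⟩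
    rw [hFw, hFu]; ring
  have hρ : ∀ t, 0 ≤ t → t < L → ρ t = ρ 0 := by
    intro t h0 h1
    refine constant_of_has_deriv_right_zero (a := 0) (b := t) (f := ρ) ?_ ?_ t ⟨h0, le_rfl⟩
    · intro u hu
      have hR : HasDerivWithinAt ρ 0 (Set.Ici u) u :=
        HasRightSlope.hasDerivWithinAt (by
          filter_upwards [hρr u hu.1 (hu.2.trans_lt h1)] with w hw
          rw [hw]; ring)
      rcases hu.1.eq_or_lt with h | h
      · refine hR.continuousWithinAt.mono fun w hw => ?_
        rw [← h]; exact hw.1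
      · have hL' : HasDerivWithinAt ρ 0 (Set.Iic u) u :=
          HasLeftSlope.hasDerivWithinAt (by
            filter_upwards [hρl u h (hu.2.trans_lt h1)] with w hw
            rw [hw]; ring)
        have := hL'.continuousWithinAt.union hR.continuousWithinAt
        exact this.mono fun w _ => le_total w u
    · intro u hu
      exact HasRightSlope.hasDerivWithinAt (by
          filter_upwards [hρr u hu.1 (hu.2.trans h1)] with w hw
          rw [hw]; ring)
  have key : ∀ t ∈ Set.Icc 0 L, F t - ρ 0 * t = F 0 - ρ 0 * 0 := by
    refine constant_of_has_deriv_right_zero ?_ ?_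
    · refine ContinuousOn.sub ?_ (by fun_prop)
      intro u hu
      have hLft : 0 < u → ContinuousWithinAt F (Set.Iic u) u := by
        intro h
        rcases hu.2.eq_or_lt with h' | h'
        · obtain ⟨a, ha⟩ := hend
          rw [h']; exact ha.hasDerivWithinAt.continuousWithinAt
        · exact (hl u h h').hasDerivWithinAt.continuousWithinAt
      have hRgt : u < L → ContinuousWithinAt F (Set.Ici u) u := fun h' =>
        (hr u hu.1 h').hasDerivWithinAt.continuousWithinAt
      rcases hu.1.eq_or_lt with h | h
      · refine (hRgt (h ▸ hL)).mono fun w hw => ?_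
        rw [← h]; exact hw.1
      · rcases hu.2.eq_or_lt with h' | h'
        · refine (hLft h).mono fun w hw => ?_
          rw [h']; exact hw.2
        · exact ((hLft h).union (hRgt h')).mono fun w _ => le_total w u
    · intro u hu
      have h1 := (hr u hu.1 hu.2).hasDerivWithinAt
      rw [hρ u hu.1 hu.2] at h1
      have h2 : HasDerivWithinAt (fun t => F t - ρ 0 * t) (ρ 0 - ρ 0 * 1) (Set.Ici u) u :=
        h1.sub ((hasDerivWithinAt_id u (Set.Ici u)).const_mul (ρ 0))
      simpa using h2
  intro t h0 h1
  have := key t ⟨h0, h1⟩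
  linarith

end Slopes

/-! ### Piecewise linear functions and their divisors on a metric graph -/

namespace MetricGraph

variable {V E : Type} {Γ : MetricGraph V E}

lemma pt_inner {e : E} {t : ℝ} (h : 0 < t ∧ t < Γ.len e) : Γ.pt e t = .inner e t h := by
  simp [pt, h]

lemma pt_zero (e : E) : Γ.pt e 0 = .vertex (Γ.src e) := by
  simp [pt]

lemma pt_len (e : E) : Γ.pt e (Γ.len e) = .vertex (Γ.tgt e) := by
  simp [pt, Γ.len_pos e]

/-- The pairing of a divisor with a function on the points. -/
def pair {R : Type} [Ring R] (φ : Γ.Point → R) : Γ.Divisor →+ R :=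
  Finsupp.liftAddHom fun p => (AddMonoidHom.mulRight (φ p)).comp (Int.castAddHom R)

section Pair

variable {R : Type} [Ring R]

@[simp] lemma pair_single (φ : Γ.Point → R) (p : Γ.Point) (c : ℤ) :
    pair φ (Finsupp.single p c) = c * φ p := by
  simp [pair]

lemma pair_apply (φ : Γ.Point → R) (Z : Γ.Divisor) : pair φ Z = ∑ p ∈ Z.support, (Z p : R) * φ p := by
  simp [pair, Finsupp.sum]

lemma pair_add_fun (φ χ : Γ.Point → R) (Z : Γ.Divisor) :
    pair (fun p => φ p + χ p) Z = pair φ Z + pair χ Z := by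
  simp [pair_apply, mul_add, Finset.sum_add_distrib]

lemma pair_mul_fun {R : Type} [CommRing R] (a : R) (φ : Γ.Point → R) (Z : Γ.Divisor) :
    pair (fun p => a * φ p) Z = a * pair φ Z := by
  simp [pair_apply, Finset.mul_sum, mul_left_comm]

lemma pair_congr {φ χ : Γ.Point → R} {Z : Γ.Divisor} (h : ∀ p, Z p ≠ 0 → φ p = χ p) :
    pair φ Z = pair χ Z := by
  rw [pair_apply, pair_apply]
  exact Finset.sum_congr rfl fun p hp => by rw [h p (by simpa using hp)]

lemma cast_pair (φ : Γ.Point → ℤ) (Z : Γ.Divisor) :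
    ((pair φ Z : ℤ) : ℝ) = pair (fun p => (φ p : ℝ)) Z := by
  simp [pair_apply]

open Classical in
lemma pair_indicator (q : Γ.Point) (Z : Γ.Divisor) :
    pair (fun p => if p = q then (1 : R) else 0) Z = Z q := by
  rw [pair_apply]
  simp only [mul_ite, mul_one, mul_zero, Finset.sum_ite_eq']
  split_ifs with h
  · rfl
  · simp at h; simp [h]

lemma deg_eq_pair (Z : Γ.Divisor) : deg Z = pair (fun _ => (1 : ℤ)) Z := by
  simp [deg, pair_apply, Finsupp.sum]

lemma pair_nonneg {φ : Γ.Point → ℤ} {Z : Γ.Divisor} (hφ : ∀ p, 0 ≤ φ p) (hZ : 0 ≤ Z) :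
    0 ≤ pair φ Z := by
  rw [pair_apply]
  exact Finset.sum_nonneg fun p _ => mul_nonneg (by simpa using hZ p) (hφ p)

end Pair

open Classical in
/-- The hinge function of a point in the interior of the edge `e`, evaluated at the point of `e` of
coordinate `t`. -/
def hinge (e : E) (t : ℝ) : Γ.Point → ℝ
  | .vertex _ => 0
  | .inner e' t' _ => if e' = e then max (t - t') 0 else 0

open Classical in
/-- The indicator of the points of the edge `e` with coordinate in `(0, t]`. -/
def indLE (e : E) (t : ℝ) : Γ.Point → ℤ
  | .vertex _ => 0
  | .inner e' t' _ => if e' = e ∧ t' ≤ t then 1 else 0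

open Classical in
/-- The indicator of the points of the edge `e` with coordinate in `(0, t)`. -/
def indLT (e : E) (t : ℝ) : Γ.Point → ℤ
  | .vertex _ => 0
  | .inner e' t' _ => if e' = e ∧ t' < t then 1 else 0

open Classical in
/-- The indicator of the interior of the edge `e`. -/
def indEdge (e : E) : Γ.Point → ℤ
  | .vertex _ => 0
  | .inner e' _ _ => if e' = e then 1 else 0

lemma hinge_zero (e : E) (p : Γ.Point) : hinge e 0 p = 0 := by
  rcases p with v | ⟨e', t', h⟩
  · rfl
  · simp [hinge, h.1.le]

lemma pair_hinge_zero (e : E) (Z : Γ.Divisor) : pair (hinge e 0) Z = 0 := by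
  rw [pair_apply]
  exact Finset.sum_eq_zero fun p _ => by rw [hinge_zero, mul_zero]

lemma pair_indLE_zero (e : E) (Z : Γ.Divisor) : pair (indLE e 0) Z = 0 := by
  rw [pair_apply]
  refine Finset.sum_eq_zero fun p _ => ?_
  rcases p with v | ⟨e', t', h⟩
  · simp [indLE]
  · simp [indLE, h.1]

lemma pair_indLT_len (e : E) (Z : Γ.Divisor) : pair (indLT e (Γ.len e)) Z = pair (indEdge e) Z := by
  refine pair_congr fun p _ => ?_
  rcases p with v | ⟨e', t', h⟩
  · rfl
  · simp only [indLT, indEdge]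
    by_cases he : e' = e
    · subst he; simp [h.2]
    · simp [he]

lemma pair_indLE_sub_indLT {e : E} {t : ℝ} (h : 0 < t ∧ t < Γ.len e) (Z : Γ.Divisor) :
    pair (indLE e t) Z = pair (indLT e t) Z + Z (.inner e t h) := by
  classical
  have := pair_indicator (R := ℤ) (.inner e t h) Z
  rw [Int.cast_id] at this
  rw [← this, ← pair_add_fun]
  refine pair_congr fun p _ => ?_
  rcases p with v | ⟨e', t', h'⟩
  · simp [indLE, indLT]
  · simp only [indLE, indLT, Point.inner.injEq]
    by_cases he : e' = e
    · subst he
      rcases lt_trichotomy t' t with h1 | h1 | h1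
      · simp [h1, h1.le, h1.ne]
      · simp [h1]
      · simp [h1.not_ge, h1.not_gt, h1.ne']
    · simp [he]

lemma hasRightSlope_hinge' (e : E) (p : Γ.Point) (t : ℝ) :
    HasRightSlope (fun u => hinge e u p) t (indLE e t p) := by
  rcases p with v | ⟨e', t', h'⟩
  · exact Filter.Eventually.of_forall fun u => by simp [hinge, indLE]
  · by_cases he : e' = e
    · have := hasRightSlope_hinge t' t
      simp only [hinge, indLE, he, true_and, if_true]
      push_cast
      exact this
    · exact Filter.Eventually.of_forall fun u => by simp [hinge, indLE, he]

lemma hasLeftSlope_hinge' (e : E) (p : Γ.Point) (t : ℝ) :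
    HasLeftSlope (fun u => hinge e u p) t (indLT e t p) := by
  rcases p with v | ⟨e', t', h'⟩
  · exact Filter.Eventually.of_forall fun u => by simp [hinge, indLT]
  · by_cases he : e' = e
    · have := hasLeftSlope_hinge t' t
      simp only [hinge, indLT, he, true_and, if_true]
      push_cast
      exact this
    · exact Filter.Eventually.of_forall fun u => by simp [hinge, indLT, he]

lemma hasRightSlope_pair (e : E) (Z : Γ.Divisor) (t : ℝ) :
    HasRightSlope (fun u => pair (hinge e u) Z) t (pair (indLE e t) Z : ℤ) := by
  induction Z using Finsupp.induction_linear with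
  | zero => exact Filter.Eventually.of_forall fun u => by simp
  | add f g hf hg =>
    simp only [map_add]; push_cast
    exact hf.add hg
  | single p c =>
    simp only [pair_single]; push_cast
    exact (hasRightSlope_hinge' e p t).const_mul c

lemma hasLeftSlope_pair (e : E) (Z : Γ.Divisor) (t : ℝ) :
    HasLeftSlope (fun u => pair (hinge e u) Z) t (pair (indLT e t) Z : ℤ) := by
  induction Z using Finsupp.induction_linear with
  | zero => exact Filter.Eventually.of_forall fun u => by simp
  | add f g hf hg =>
    simp only [map_add]; push_cast
    exact hf.add hg
  | single p c =>
    simp only [pair_single]; push_cast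
    exact (hasLeftSlope_hinge' e p t).const_mul c

lemma continuous_pair_hinge (e : E) (Z : Γ.Divisor) : Continuous fun u => pair (hinge e u) Z := by
  induction Z using Finsupp.induction_linear with
  | zero => simp [continuous_const]
  | add f g hf hg => simp only [map_add]; exact hf.add hg
  | single p c =>
    simp only [pair_single]
    refine continuous_const.mul ?_
    rcases p with v | ⟨e', t', h'⟩
    · exact continuous_const
    · simp only [hinge]
      split_ifs <;> fun_prop

/-- The slopes of a function given on an edge by the standard formula. -/
lemma hasRightSlope_of_formula {f : Γ.Point → ℝ} {e : E} {Z : Γ.Divisor} {a : ℝ} {σ : ℤ}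
    (h : ∀ t, 0 ≤ t → t ≤ Γ.len e → f (Γ.pt e t) = a + σ * t - pair (hinge e t) Z)
    {t : ℝ} (h0 : 0 ≤ t) (h1 : t < Γ.len e) :
    HasRightSlope (fun u => f (Γ.pt e u)) t ((σ - pair (indLE e t) Z : ℤ) : ℝ) := by
  have h2 := (hasRightSlope_affine a σ t).add ((hasRightSlope_pair e Z t).const_mul (-1))
  have h3 : HasRightSlope (fun u => a + σ * u + -1 * pair (hinge e u) Z) t
      ((σ - pair (indLE e t) Z : ℤ) : ℝ) := by
    convert h2 using 1; push_cast; ring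
  refine h3.congr ?_ (by rw [h t h0 h1.le]; ring)
  filter_upwards [Ioo_mem_nhdsGT h1] with u hu
  rw [h u (h0.trans hu.1.le) hu.2.le]; ring

lemma hasLeftSlope_of_formula {f : Γ.Point → ℝ} {e : E} {Z : Γ.Divisor} {a : ℝ} {σ : ℤ}
    (h : ∀ t, 0 ≤ t → t ≤ Γ.len e → f (Γ.pt e t) = a + σ * t - pair (hinge e t) Z)
    {t : ℝ} (h0 : 0 < t) (h1 : t ≤ Γ.len e) :
    HasLeftSlope (fun u => f (Γ.pt e u)) t ((σ - pair (indLT e t) Z : ℤ) : ℝ) := by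
  have h2 := (hasLeftSlope_affine a σ t).add ((hasLeftSlope_pair e Z t).const_mul (-1))
  have h3 : HasLeftSlope (fun u => a + σ * u + -1 * pair (hinge e u) Z) t
      ((σ - pair (indLT e t) Z : ℤ) : ℝ) := by
    convert h2 using 1; push_cast; ring
  refine h3.congr ?_ (by rw [h t h0.le h1]; ring)
  filter_upwards [Ioo_mem_nhdsLT h0] with u hu
  rw [h u hu.1.le (hu.2.le.trans h1)]; ring

/-- A piecewise linear function is given on each edge by its initial slope and its divisor. -/
lemma IsPL.exists_formula [Fintype E] {f : Γ.Point → ℝ} (hf : Γ.IsPL f) {Z : Γ.Divisor}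
    (hZ : ∀ p, (Z p : ℝ) = Γ.ord f p) (e : E) :
    ∃ σ : ℤ, ∀ t, 0 ≤ t → t ≤ Γ.len e →
      f (Γ.pt e t) = f (.vertex (Γ.src e)) + σ * t - pair (hinge e t) Z := by
  classical
  obtain ⟨hR, hL⟩ := hf e
  have hR' : ∀ t, 0 ≤ t → t < Γ.len e → ∃ n : ℤ, HasRightSlope (fun u => f (Γ.pt e u)) t n := hR
  have hL' : ∀ t, 0 < t → t ≤ Γ.len e → ∃ n : ℤ, HasLeftSlope (fun u => f (Γ.pt e u)) t n := hL
  choose! ρ hρ using hR'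
  -- At a point with coefficient `c` in the divisor the slope of `f` drops by `c`, while that of the
  -- sum of hinges rises by `c`; the sum of the two has no kinks.
  have key := affine_of_no_kinks (F := fun u => f (Γ.pt e u) + pair (hinge e u) Z)
    (ρ := fun t => (ρ t : ℝ) + (pair (indLE e t) Z : ℤ)) (Γ.len_pos e)
    (fun t h0 h1 => (hρ t h0 h1).add (hasRightSlope_pair e Z t))
    (fun t h0 h1 => by
      obtain ⟨n, hn⟩ := hL' t h0 h1.le
      have h2 := hZ (.inner e t ⟨h0, h1⟩)
      simp only [ord] at h2
      rw [hn.derivWithin, (hρ t h0.le h1).derivWithin] at h2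
      have h3 := hn.add (hasLeftSlope_pair e Z t)
      convert h3 using 1
      rw [pair_indLE_sub_indLT ⟨h0, h1⟩]
      push_cast
      linarith)
    (by
      obtain ⟨n, hn⟩ := hL' _ (Γ.len_pos e) le_rfl
      exact ⟨_, hn.add (hasLeftSlope_pair e Z _)⟩)
  refine ⟨ρ 0, fun t h0 h1 => ?_⟩
  have := key t h0 h1
  simp only [pair_hinge_zero, pair_indLE_zero, pt_zero] at this
  push_cast at this
  linarith

lemma isPL_of_formula {f : Γ.Point → ℝ} {Z : Γ.Divisor} {σ : E → ℤ}
    (h : ∀ e t, 0 ≤ t → t ≤ Γ.len e →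
      f (Γ.pt e t) = f (.vertex (Γ.src e)) + σ e * t - pair (hinge e t) Z) : Γ.IsPL f :=
  fun e => ⟨fun _ h0 h1 => ⟨_, hasRightSlope_of_formula (h e) h0 h1⟩,
    fun _ h0 h1 => ⟨_, hasLeftSlope_of_formula (h e) h0 h1⟩⟩

lemma ord_inner_of_formula [Fintype E] {f : Γ.Point → ℝ} {Z : Γ.Divisor} {σ : E → ℤ}
    (h : ∀ e t, 0 ≤ t → t ≤ Γ.len e →
      f (Γ.pt e t) = f (.vertex (Γ.src e)) + σ e * t - pair (hinge e t) Z)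
    (e : E) (t : ℝ) (ht : 0 < t ∧ t < Γ.len e) : Γ.ord f (.inner e t ht) = Z (.inner e t ht) := by
  simp only [ord]
  rw [(hasRightSlope_of_formula (h e) ht.1.le ht.2).derivWithin,
    (hasLeftSlope_of_formula (h e) ht.1 ht.2.le).derivWithin, pair_indLE_sub_indLT ht]
  push_cast
  ring

open Classical in
lemma ord_vertex_of_formula [Fintype E] {f : Γ.Point → ℝ} {Z : Γ.Divisor} {σ : E → ℤ}
    (h : ∀ e t, 0 ≤ t → t ≤ Γ.len e →
      f (Γ.pt e t) = f (.vertex (Γ.src e)) + σ e * t - pair (hinge e t) Z) (v : V) :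
    Γ.ord f (.vertex v) = ((∑ e : E with Γ.tgt e = v, (σ e - pair (indEdge e) Z) -
      ∑ e : E with Γ.src e = v, σ e : ℤ) : ℝ) := by
  simp only [ord]
  push_cast
  congr 1
  · refine Finset.sum_congr rfl fun e _ => ?_
    rw [(hasLeftSlope_of_formula (h e) (Γ.len_pos e) le_rfl).derivWithin, pair_indLT_len]
    push_cast; rfl
  · refine Finset.sum_congr rfl fun e _ => ?_
    rw [(hasRightSlope_of_formula (h e) le_rfl (Γ.len_pos e)).derivWithin, pair_indLE_zero]
    simp

open Classical in
/-- The functions that carry `D` to `D'` are those given by the standard formula on the edges, with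
initial slopes that satisfy Kirchhoff's law at the vertices. -/
lemma carries_iff_formula [Fintype E] {f : Γ.Point → ℝ} {D D' : Γ.Divisor} :
    Γ.Carries f D D' ↔ ∃ σ : E → ℤ,
      (∀ e t, 0 ≤ t → t ≤ Γ.len e →
        f (Γ.pt e t) = f (.vertex (Γ.src e)) + σ e * t - pair (hinge e t) (D' - D)) ∧
      ∀ v, (D' - D) (.vertex v) =
        ∑ e : E with Γ.tgt e = v, (σ e - pair (indEdge e) (D' - D)) -
          ∑ e : E with Γ.src e = v, σ e := by
  constructor
  · rintro ⟨hf, hD⟩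
    have hZ : ∀ p, ((D' - D) p : ℝ) = Γ.ord f p := fun p => by
      rw [Finsupp.sub_apply]; push_cast; linarith [hD p]
    choose σ hσ using hf.exists_formula hZ
    refine ⟨σ, hσ, fun v => ?_⟩
    have := hZ (.vertex v)
    rw [ord_vertex_of_formula hσ] at this
    exact_mod_cast this
  · rintro ⟨σ, hσ, hv⟩
    refine ⟨isPL_of_formula hσ, fun p => ?_⟩
    have : ((D' - D) p : ℝ) = Γ.ord f p := by
      rcases p with v | ⟨e, t, ht⟩
      · rw [ord_vertex_of_formula hσ, hv v]
      · rw [ord_inner_of_formula hσ]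
    rw [← this, Finsupp.sub_apply]; push_cast; ring

/-- A function with prescribed values at the vertices and prescribed initial slopes. -/
lemma exists_formula (Z : Γ.Divisor) (val : V → ℝ) (σ : E → ℤ)
    (h : ∀ e, val (Γ.tgt e) = val (Γ.src e) + σ e * Γ.len e - pair (hinge e (Γ.len e)) Z) :
    ∃ f : Γ.Point → ℝ, (∀ v, f (.vertex v) = val v) ∧ ∀ e t, 0 ≤ t → t ≤ Γ.len e →
      f (Γ.pt e t) = f (.vertex (Γ.src e)) + σ e * t - pair (hinge e t) Z := by
  refine ⟨fun p => match p with
    | .vertex v => val v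
    | .inner e t _ => val (Γ.src e) + σ e * t - pair (hinge e t) Z, fun v => rfl, ?_⟩
  intro e t h0 h1
  rcases h0.eq_or_lt with h0 | h0
  · subst h0
    rw [pt_zero, pair_hinge_zero]; simp
  rcases h1.eq_or_lt with h1 | h1
  · subst h1
    rw [pt_len]
    exact h e
  · rw [pt_inner ⟨h0, h1⟩]

lemma Carries.add [Fintype E] {f f' : Γ.Point → ℝ} {D₁ D₁' D₂ D₂' : Γ.Divisor}
    (h : Γ.Carries f D₁ D₁') (h' : Γ.Carries f' D₂ D₂') {D D' : Γ.Divisor}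
    (hD : D' - D = (D₁' - D₁) + (D₂' - D₂)) : Γ.Carries (fun p => f p + f' p) D D' := by
  rw [carries_iff_formula] at *
  obtain ⟨σ, h1, h2⟩ := h
  obtain ⟨σ', h1', h2'⟩ := h'
  refine ⟨fun e => σ e + σ' e, fun e t h0 ht => ?_, fun v => ?_⟩
  · rw [h1 e t h0 ht, h1' e t h0 ht, hD, map_add]; push_cast; ring
  · rw [hD, Finsupp.add_apply, h2 v, h2' v]
    simp only [map_add, Finset.sum_sub_distrib, Finset.sum_add_distrib]
    ring

lemma Carries.neg [Fintype E] {f : Γ.Point → ℝ} {D D' : Γ.Divisor}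
    (h : Γ.Carries f D D') : Γ.Carries (fun p => - f p) D' D := by
  rw [carries_iff_formula] at *
  obtain ⟨σ, h1, h2⟩ := h
  have e1 : D - D' = -(D' - D) := by abel
  refine ⟨fun e => - σ e, fun e t h0 ht => ?_, fun v => ?_⟩
  · rw [h1 e t h0 ht, e1, map_neg]; push_cast; ring
  · rw [e1, Finsupp.neg_apply, h2 v]
    simp only [map_neg, Finset.sum_sub_distrib, Finset.sum_neg_distrib]
    ring

lemma LinEquiv.symm [Fintype E] {D D' : Γ.Divisor} (h : Γ.LinEquiv D D') : Γ.LinEquiv D' D :=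
  let ⟨_, hf⟩ := h; ⟨_, hf.neg⟩

lemma LinEquiv.trans [Fintype E] {D D' D'' : Γ.Divisor} (h : Γ.LinEquiv D D')
    (h' : Γ.LinEquiv D' D'') : Γ.LinEquiv D D'' :=
  let ⟨_, hf⟩ := h; let ⟨_, hf'⟩ := h'; ⟨_, hf.add hf' (by abel)⟩

end MetricGraph

/-! ### Left degrees and moments on a chain of loops -/

section ChainDegrees

variable {g : ℕ} {Γ : MetricGraph (ChainVertex g) (ChainEdge g)}

/-- The place of a point in the chain: `4k` for `w k`, `4k + 1` for the interior of the bridge `k`,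
`4k + 2` for `v k` and `4k + 3` for the interior of the two edges of the loop `k`. -/
def place : Γ.Point → ℕ
  | .vertex (.w k) => 4 * k
  | .vertex (.v k) => 4 * k + 2
  | .inner (.bridge k) _ _ => 4 * k + 1
  | .inner (.top k) _ _ => 4 * k + 3
  | .inner (.bottom k) _ _ => 4 * k + 3

lemma place_lt (p : Γ.Point) : place p < 4 * g + 3 := by
  rcases p with (k | k) | ⟨k | k | k, t, h⟩ <;> have := k.2 <;> simp only [place] <;> omega

/-- The degree of a divisor to the left of the place `j`. -/
def degLT (j : ℕ) : Γ.Divisor →+ ℤ := pair fun p => if place p < j then 1 else 0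

/-- The degree of a divisor at the place `j`. -/
def degAt (j : ℕ) : Γ.Divisor →+ ℤ := pair fun p => if place p = j then 1 else 0

lemma degLT_zero (Z : Γ.Divisor) : degLT 0 Z = 0 := by
  simp [degLT, pair_apply]

lemma degLT_succ (j : ℕ) (Z : Γ.Divisor) : degLT (j + 1) Z = degLT j Z + degAt j Z := by
  rw [degLT, degLT, degAt, ← pair_add_fun]
  refine pair_congr fun p _ => ?_
  rcases lt_trichotomy (place p) j with h | h | h
  · simp [h, h.ne, h.trans]
  · simp [h]
  · simp [h.not_gt, h.ne', h.not_ge]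

lemma degLT_last (Z : Γ.Divisor) : degLT (4 * g + 3) Z = deg Z := by
  rw [deg_eq_pair, degLT]
  exact pair_congr fun p _ => by simp [place_lt p]

lemma degAt_nonneg {Z : Γ.Divisor} (hZ : 0 ≤ Z) (j : ℕ) : 0 ≤ degAt j Z :=
  pair_nonneg (fun p => by positivity) hZ

lemma degLT_mono {Z : Γ.Divisor} (hZ : 0 ≤ Z) {i j : ℕ} (h : i ≤ j) : degLT i Z ≤ degLT j Z := by
  induction j, h using Nat.le_induction with
  | base => rfl
  | succ j _ ih => rw [degLT_succ]; linarith [degAt_nonneg hZ j]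

lemma degAt_w (k : Fin (g + 1)) (Z : Γ.Divisor) : degAt (4 * k) Z = Z (.vertex (.w k)) := by
  classical
  have := pair_indicator (R := ℤ) (.vertex (.w k)) Z
  rw [Int.cast_id] at this
  rw [← this, degAt]
  refine pair_congr fun p _ => ?_
  rcases p with (j | j) | ⟨j | j | j, t, h⟩ <;> simp [place, Fin.ext_iff] <;> omega

lemma degAt_v (k : Fin (g + 1)) (Z : Γ.Divisor) : degAt (4 * k + 2) Z = Z (.vertex (.v k)) := by
  classical
  have := pair_indicator (R := ℤ) (.vertex (.v k)) Z
  rw [Int.cast_id] at this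
  rw [← this, degAt]
  refine pair_congr fun p _ => ?_
  rcases p with (j | j) | ⟨j | j | j, t, h⟩ <;> simp [place, Fin.ext_iff] <;> omega

lemma degAt_bridge (k : Fin (g + 1)) (Z : Γ.Divisor) :
    degAt (4 * k + 1) Z = pair (indEdge (.bridge k)) Z := by
  refine pair_congr fun p _ => ?_
  rcases p with (j | j) | ⟨j | j | j, t, h⟩ <;> simp [place, indEdge, Fin.ext_iff] <;> omega

lemma degAt_loop (k : Fin g) (Z : Γ.Divisor) :
    degAt (4 * k + 3) Z = pair (indEdge (.top k)) Z + pair (indEdge (.bottom k)) Z := by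
  rw [degAt, ← pair_add_fun]
  refine pair_congr fun p _ => ?_
  rcases p with (j | j) | ⟨j | j | j, t, h⟩ <;> simp [place, indEdge, Fin.ext_iff] <;> omega

/-- The coordinate on the edge `e`. -/
def edgeCoord (e : ChainEdge g) : Γ.Point → ℝ
  | .vertex _ => 0
  | .inner e' t _ => by classical exact if e' = e then t else 0

/-- At the far end of an edge every hinge of the edge is active, so the pairing is affine in the
positions of the chips. This is what turns the closing condition of a loop into a condition on the
moment. -/
lemma pair_hinge_len (e : ChainEdge g) (Z : Γ.Divisor) :
    pair (hinge e (Γ.len e)) Z = Γ.len e * (pair (indEdge e) Z : ℤ) - pair (edgeCoord e) Z := by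
  have : pair (hinge e (Γ.len e)) Z + pair (edgeCoord e) Z = Γ.len e * (pair (indEdge e) Z : ℤ) := by
    rw [← pair_add_fun, cast_pair, ← pair_mul_fun]
    refine pair_congr fun p _ => ?_
    rcases p with v | ⟨e', t, h⟩
    · simp [hinge, edgeCoord, indEdge]
    · by_cases he : e' = e
      · subst he
        simp [hinge, edgeCoord, indEdge, h.2.le]
      · simp [hinge, edgeCoord, indEdge, he]
  linarith

/-- The coordinate of the points on the loop `k`: `t` on the bottom edge, `-t` on the top edge. -/
def loopCoord (k : Fin g) (p : Γ.Point) : ℝ := edgeCoord (.bottom k) p + -1 * edgeCoord (.top k) p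

/-- The component of the Abel–Jacobi map at the loop `k`, as a real number. -/
def moment (k : Fin g) (Z : Γ.Divisor) : ℝ :=
  pair (loopCoord k) Z - Γ.len (.bottom k) * (degLT (4 * k + 4) Z : ℤ)

/-- The total length of the loop `k`. -/
def loopLen (Γ : MetricGraph (ChainVertex g) (ChainEdge g)) (k : Fin g) : ℝ :=
  Γ.len (.top k) + Γ.len (.bottom k)

lemma pair_loopCoord (k : Fin g) (Z : Γ.Divisor) :
    pair (loopCoord k) Z = pair (edgeCoord (.bottom k)) Z - pair (edgeCoord (.top k)) Z := by
  have : loopCoord (Γ := Γ) k = fun p => edgeCoord (.bottom k) p + -1 * edgeCoord (.top k) p := rfl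
  rw [this, pair_add_fun, pair_mul_fun]; ring

lemma moment_add (k : Fin g) (Z Z' : Γ.Divisor) : moment k (Z + Z') = moment k Z + moment k Z' := by
  simp only [moment, map_add]; push_cast; ring

lemma moment_sub (k : Fin g) (Z Z' : Γ.Divisor) : moment k (Z - Z') = moment k Z - moment k Z' := by
  simp only [moment, map_sub]; push_cast; ring

/-- The values of a function at the end of the two edges of a loop agree iff the moment is the
indicated multiple of the length of the loop. -/
lemma loop_closes_iff (k : Fin g) (Z : Γ.Divisor) (a b : ℤ) (hab : a + b = - degLT (4 * k + 3) Z) :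
    a * Γ.len (.top k) - pair (hinge (.top k) (Γ.len (.top k))) Z =
      b * Γ.len (.bottom k) - pair (hinge (.bottom k) (Γ.len (.bottom k))) Z ↔
    moment k Z = ((-(b + degLT (4 * k + 3) Z + pair (indEdge (.top k)) Z) : ℤ) : ℝ) *
      loopLen Γ k := by
  have ha : (a : ℝ) = - b - (degLT (4 * k + 3) Z : ℤ) := by
    have : a = - b - degLT (4 * k + 3) Z := by linarith
    rw [this]; push_cast; ring
  have hd : degLT (4 * k + 4) Z = degLT (4 * k + 3) Z +
      (pair (indEdge (.top k)) Z + pair (indEdge (.bottom k)) Z) := by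
    rw [degLT_succ, degAt_loop]
  rw [moment, pair_loopCoord, pair_hinge_len, pair_hinge_len, ha, hd, loopLen]
  push_cast
  constructor <;> intro h <;> linarith

end ChainDegrees

/-! ### Kirchhoff's law and the Abel–Jacobi theorem on a chain -/

section ChainSums

open Classical in
lemma ChainEdge.sum_tgt {g : ℕ} {ℓ m n : ℕ → ℝ} {hℓ : ∀ k, 0 < ℓ k} {hm : ∀ k, 0 < m k}
    {hn : ∀ k, 0 < n k} (φ : ChainEdge g → ℤ) :
    (∑ e with (chainOfLoops g ℓ m n hℓ hm hn).tgt e = .w 0, φ e = 0) ∧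
    (∀ k : Fin g, ∑ e with (chainOfLoops g ℓ m n hℓ hm hn).tgt e = .w k.succ, φ e =
      φ (.top k) + φ (.bottom k)) ∧
    (∀ k, ∑ e with (chainOfLoops g ℓ m n hℓ hm hn).tgt e = .v k, φ e = φ (.bridge k)) := by
  refine ⟨?_, fun k => ?_, fun k => ?_⟩
  · refine Finset.sum_eq_zero fun e he => ?_
    have he := (Finset.mem_filter.1 he).2
    rcases e with j | j | j <;> simp [chainOfLoops, Fin.ext_iff] at he
  · rw [← Finset.sum_pair (by simp : (ChainEdge.top k) ≠ .bottom k)]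
    congr 1
    ext e
    rw [Finset.mem_filter]
    rcases e with j | j | j <;> simp [chainOfLoops]
  · rw [← Finset.sum_singleton φ (.bridge k)]
    congr 1
    ext e
    rw [Finset.mem_filter]
    rcases e with j | j | j <;> simp [chainOfLoops]

open Classical in
lemma ChainEdge.sum_src {g : ℕ} {ℓ m n : ℕ → ℝ} {hℓ : ∀ k, 0 < ℓ k} {hm : ∀ k, 0 < m k}
    {hn : ∀ k, 0 < n k} (φ : ChainEdge g → ℤ) :
    (∑ e with (chainOfLoops g ℓ m n hℓ hm hn).src e = .v (Fin.last g), φ e = 0) ∧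
    (∀ k : Fin g, ∑ e with (chainOfLoops g ℓ m n hℓ hm hn).src e = .v k.castSucc, φ e =
      φ (.top k) + φ (.bottom k)) ∧
    (∀ k, ∑ e with (chainOfLoops g ℓ m n hℓ hm hn).src e = .w k, φ e = φ (.bridge k)) := by
  refine ⟨?_, fun k => ?_, fun k => ?_⟩
  · refine Finset.sum_eq_zero fun e he => ?_
    have he := (Finset.mem_filter.1 he).2
    rcases e with j | j | j <;> simp [chainOfLoops, Fin.ext_iff] at he
    all_goals exact absurd he j.2.ne
  · rw [← Finset.sum_pair (by simp : (ChainEdge.top k) ≠ .bottom k)]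
    congr 1
    ext e
    rw [Finset.mem_filter]
    rcases e with j | j | j <;> simp [chainOfLoops]
  · rw [← Finset.sum_singleton φ (.bridge k)]
    congr 1
    ext e
    rw [Finset.mem_filter]
    rcases e with j | j | j <;> simp [chainOfLoops]

end ChainSums

section ChainCarries

variable {g : ℕ} {ℓ m n : ℕ → ℝ} {hℓ : ∀ k, 0 < ℓ k} {hm : ∀ k, 0 < m k} {hn : ∀ k, 0 < n k}

local notation "𝒞" => chainOfLoops g ℓ m n hℓ hm hn

-- Cutting a bridge, or both edges of a loop, separates the chain, and the total slope across the
-- cut is minus the degree on its left. Hence only the distribution of the slope between the two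
-- edges of each loop remains free.
open Classical in
lemma kirchhoff_iff (Z : MetricGraph.Divisor 𝒞) (σ : ChainEdge g → ℤ) :
    (∀ v, Z (.vertex v) = ∑ e with MetricGraph.tgt 𝒞 e = v, (σ e - pair (indEdge e) Z) -
      ∑ e with MetricGraph.src 𝒞 e = v, σ e) ↔
    (∀ k : Fin (g + 1), σ (.bridge k) = - degLT (4 * k + 1) Z) ∧
    (∀ k : Fin g, σ (.top k) + σ (.bottom k) = - degLT (4 * k + 3) Z) ∧ deg Z = 0 := by
  obtain ⟨t1, t2, t3⟩ := ChainEdge.sum_tgt (hℓ := hℓ) (hm := hm) (hn := hn) (g := g)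
    fun e => σ e - pair (indEdge e) Z
  obtain ⟨s1, s2, s3⟩ := ChainEdge.sum_src (hℓ := hℓ) (hm := hm) (hn := hn) (g := g) σ
  have hw : ∀ k : Fin (g + 1), degLT (4 * k + 1) Z = degLT (4 * k) Z + Z (.vertex (.w k)) :=
    fun k => by rw [degLT_succ, degAt_w]
  have hv : ∀ k : Fin (g + 1), degLT (4 * k + 3) Z =
      degLT (4 * k + 1) Z + pair (indEdge (.bridge k)) Z + Z (.vertex (.v k)) :=
    fun k => by rw [degLT_succ, degAt_v, degLT_succ, degAt_bridge]
  have hl : ∀ k : Fin g, degLT (4 * k + 4) Z = degLT (4 * k + 3) Z +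
      (pair (indEdge (.top k)) Z + pair (indEdge (.bottom k)) Z) :=
    fun k => by rw [degLT_succ, degAt_loop]
  have hw0 := hw 0
  simp only [Fin.val_zero, mul_zero, degLT_zero, zero_add] at hw0
  have hws : ∀ k : Fin g, degLT (4 * (k.succ : ℕ) + 1) Z = degLT (4 * k + 4) Z +
      Z (.vertex (.w k.succ)) := fun k => by
    rw [hw k.succ, Fin.val_succ]; ring_nf
  have hlast := hv (Fin.last g)
  rw [Fin.val_last, degLT_last] at hlast
  constructor
  · intro h
    have hb : ∀ k : Fin (g + 1), σ (.bridge k) = - degLT (4 * k + 1) Z := by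
      intro k
      induction k using Fin.induction with
      | zero =>
        have := h (.w 0)
        rw [t1, s3] at this
        simp only [Fin.val_zero, mul_zero, zero_add]
        linarith
      | succ k ih =>
        have h1 := h (.v k.castSucc)
        have h2 := h (.w k.succ)
        rw [t3, s2] at h1
        rw [t2, s3] at h2
        have h3 := hv k.castSucc
        have h4 := hl k
        have h5 := hws k
        simp only [Fin.val_castSucc] at *
        linarith
    refine ⟨hb, fun k => ?_, ?_⟩
    · have h1 := h (.v k.castSucc)
      rw [t3, s2, hb] at h1
      have h3 := hv k.castSucc
      simp only [Fin.val_castSucc] at *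
      linarith
    · have h1 := h (.v (Fin.last g))
      rw [t3, s1, hb] at h1
      simp only [Fin.val_last] at *
      linarith
  · rintro ⟨hb, hl', hd⟩ (k | k)
    · rw [s3, hb]
      induction k using Fin.cases with
      | zero => rw [t1]; simp only [Fin.val_zero, mul_zero, zero_add]; linarith
      | succ k => rw [t2, hws k]; linarith [hl k, hl' k]
    · rw [t3, hb]
      induction k using Fin.lastCases with
      | last => rw [s1]; simp only [Fin.val_last] at *; linarith
      | cast k =>
        rw [s2, hl']
        have h3 := hv k.castSucc
        simp only [Fin.val_castSucc] at *
        linarith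

lemma chain_carries_iff {f : MetricGraph.Point 𝒞 → ℝ} {D D' : MetricGraph.Divisor 𝒞} :
    MetricGraph.Carries 𝒞 f D D' ↔ ∃ σ : ChainEdge g → ℤ,
      (∀ e t, 0 ≤ t → t ≤ MetricGraph.len 𝒞 e → f (MetricGraph.pt 𝒞 e t) =
        f (.vertex (MetricGraph.src 𝒞 e)) + σ e * t - pair (hinge e t) (D' - D)) ∧
      (∀ k : Fin (g + 1), σ (.bridge k) = - degLT (4 * k + 1) (D' - D)) ∧
      (∀ k : Fin g, σ (.top k) + σ (.bottom k) = - degLT (4 * k + 3) (D' - D)) ∧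
      deg (D' - D) = 0 := by
  rw [carries_iff_formula]
  simp only [← kirchhoff_iff]

/-- Partial sums indexed by `Fin (g + 1)`. -/
lemma exists_partial_sums (c : Fin g → ℝ) :
    ∃ W : Fin (g + 1) → ℝ, W 0 = 0 ∧ ∀ k : Fin g, W k.succ = W k.castSucc + c k :=
  ⟨fun k => Fin.induction (motive := fun _ => ℝ) 0 (fun k a => a + c k) k, rfl, fun _ => rfl⟩

/-- The function with given slopes, if the loops close up. -/
lemma exists_carries {D D' : MetricGraph.Divisor 𝒞} (σ : ChainEdge g → ℤ)
    (hb : ∀ k : Fin (g + 1), σ (.bridge k) = - degLT (4 * k + 1) (D' - D))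
    (hl : ∀ k : Fin g, σ (.top k) + σ (.bottom k) = - degLT (4 * k + 3) (D' - D))
    (hd : deg (D' - D) = 0)
    (hc : ∀ k : Fin g, σ (.top k) * ℓ (k + 1) - pair (hinge (.top k) (ℓ (k + 1))) (D' - D) =
      σ (.bottom k) * m (k + 1) - pair (hinge (.bottom k) (m (k + 1))) (D' - D)) :
    ∃ f : MetricGraph.Point 𝒞 → ℝ, MetricGraph.Carries 𝒞 f D D' ∧ f (.vertex (.w 0)) = 0 ∧
      ∀ e t, 0 ≤ t → t ≤ MetricGraph.len 𝒞 e → f (MetricGraph.pt 𝒞 e t) =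
        f (.vertex (MetricGraph.src 𝒞 e)) + σ e * t - pair (hinge e t) (D' - D) := by
  set Z := D' - D with hZ
  let inc : ChainEdge g → ℝ := fun e =>
    σ e * MetricGraph.len 𝒞 e - pair (hinge e (MetricGraph.len 𝒞 e)) Z
  obtain ⟨W, hW0, hW⟩ := exists_partial_sums fun k : Fin g =>
    inc (.bridge k.castSucc) + inc (.bottom k)
  obtain ⟨f, hv, hf⟩ := exists_formula (Γ := 𝒞) Z
    (fun | .w k => W k | .v k => W k + inc (.bridge k)) σ (by
      rintro (k | k | k)
      · simp only [chainOfLoops, inc]; ring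
      · have := hc k
        have h2 := hW k
        simp only [chainOfLoops, inc] at this h2 ⊢
        linarith
      · have h2 := hW k
        simp only [chainOfLoops, inc] at h2 ⊢
        linarith)
  exact ⟨f, chain_carries_iff.2 ⟨σ, hf, hb, hl, hd⟩, (hv _).trans hW0, hf⟩

/-- The theorem of Abel and Jacobi for chains of loops. -/
theorem chain_linEquiv_iff {D D' : MetricGraph.Divisor 𝒞} :
    MetricGraph.LinEquiv 𝒞 D D' ↔ deg D' = deg D ∧
      ∀ k : Fin g, ∃ z : ℤ, moment k D' - moment k D = z * loopLen 𝒞 k := by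
  have hdeg : deg (D' - D) = deg D' - deg D := by simp only [deg_eq_pair, map_sub]
  constructor
  · rintro ⟨f, hf⟩
    obtain ⟨σ, h1, h2, h3, h4⟩ := chain_carries_iff.1 hf
    refine ⟨by linarith, fun k => ?_⟩
    have ht := h1 (.top k) _ (MetricGraph.len_pos 𝒞 _).le le_rfl
    have hb := h1 (.bottom k) _ (MetricGraph.len_pos 𝒞 _).le le_rfl
    rw [pt_len] at ht hb
    have he : f (.vertex (MetricGraph.tgt 𝒞 (.top k))) = f (.vertex (MetricGraph.tgt 𝒞 (.bottom k)))
      := rfl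
    have he' : f (.vertex (MetricGraph.src 𝒞 (.top k))) =
      f (.vertex (MetricGraph.src 𝒞 (.bottom k))) := rfl
    have := (loop_closes_iff k (D' - D) _ _ (h3 k)).1 (by linarith)
    rw [moment_sub] at this
    exact ⟨_, this⟩
  · rintro ⟨hd, hm'⟩
    choose z hz using hm'
    -- The slope on the bottom edge is the one unknown left at each loop; this value solves the
    -- equation of `loop_closes_iff` for the given multiple `z k`.
    let b : Fin g → ℤ := fun k => - z k - degLT (4 * k + 3) (D' - D) -
      pair (indEdge (.top k)) (D' - D)
    obtain ⟨f, hf, -⟩ := exists_carries (D := D) (D' := D') (hℓ := hℓ) (hm := hm) (hn := hn)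
      (fun | .bridge k => - degLT (4 * k + 1) (D' - D)
           | .top k => - degLT (4 * k + 3) (D' - D) - b k
           | .bottom k => b k)
      (fun k => rfl) (fun k => by simp) (by rw [hdeg, hd, sub_self]) (fun k =>
        (loop_closes_iff k (D' - D) _ _ (by simp)).2 (by
          rw [moment_sub, hz]
          congr 2
          simp only [b]; ring))
    exact ⟨f, hf⟩

end ChainCarries

/-! ### Standard divisors: chips at the two ends and at most one inside each loop -/

section ChipData

variable {g : ℕ}

/-- The point of coordinate `u` on the loop `k`: on the bottom edge at distance `u` from the left
vertex if `u` is positive, on the top edge at distance `-u` otherwise. -/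
def loopPt (Γ : MetricGraph (ChainVertex g) (ChainEdge g)) (k : Fin g) (u : ℝ) : Γ.Point :=
  if 0 < u then Γ.pt (.bottom k) u else Γ.pt (.top k) (-u)

/-- The divisor with `a` chips at the left end, `b` chips at the right end, and one chip at
the position `x k` on the loop `k` whenever `x k` is not `none`. -/
def stdDiv (Γ : MetricGraph (ChainVertex g) (ChainEdge g)) (a : ℤ) (x : ℕ → Option ℝ) (b : ℤ) :
    Γ.Divisor :=
  Finsupp.single (leftEnd Γ) a +
    ∑ k : Fin g, (x k).elim 0 (fun u => Finsupp.single (loopPt Γ k u) 1) +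
    Finsupp.single (rightEnd Γ) b

/-- The positions are interior points of the edges of the loops. -/
def ValidChips (g : ℕ) (ℓ m : ℕ → ℝ) (x : ℕ → Option ℝ) : Prop :=
  ∀ k < g, ∀ u ∈ x k, -ℓ (k + 1) < u ∧ u < m (k + 1) ∧ u ≠ 0

/-- The number of chips to the left of the loop `k`. -/
def chipsLT (a : ℤ) (x : ℕ → Option ℝ) (k : ℕ) : ℤ :=
  a + ∑ j ∈ Finset.range k, if (x j).isSome then 1 else 0

lemma chipsLT_zero (a : ℤ) (x : ℕ → Option ℝ) : chipsLT a x 0 = a := by simp [chipsLT]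

lemma chipsLT_succ (a : ℤ) (x : ℕ → Option ℝ) (k : ℕ) :
    chipsLT a x (k + 1) = chipsLT a x k + if (x k).isSome then 1 else 0 := by
  rw [chipsLT, chipsLT, Finset.sum_range_succ, add_assoc]

lemma pair_stdDiv {R : Type} [Ring R] {Γ : MetricGraph (ChainVertex g) (ChainEdge g)}
    (φ : Γ.Point → R) (a : ℤ) (x : ℕ → Option ℝ) (b : ℤ) :
    pair φ (stdDiv Γ a x b) = a * φ (leftEnd Γ) +
      ∑ k : Fin g, (x k).elim 0 (fun u => φ (loopPt Γ k u)) + b * φ (rightEnd Γ) := by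
  rw [stdDiv, map_add, map_add, pair_single, pair_single, map_sum]
  congr 2
  refine Finset.sum_congr rfl fun k _ => ?_
  cases x k <;> simp

end ChipData

section ChipDataOnChain

variable {g : ℕ} {ℓ m n : ℕ → ℝ} {hℓ : ∀ k, 0 < ℓ k} {hm : ∀ k, 0 < m k} {hn : ∀ k, 0 < n k}

local notation "𝒞" => chainOfLoops g ℓ m n hℓ hm hn

lemma loopPt_cases (k : Fin g) {u : ℝ} (h : -ℓ (k + 1) < u ∧ u < m (k + 1) ∧ u ≠ 0) :
    (0 < u ∧ ∃ h', loopPt 𝒞 k u = .inner (.bottom k) u h') ∨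
    (u < 0 ∧ ∃ h', loopPt 𝒞 k u = .inner (.top k) (-u) h') := by
  obtain ⟨h1, h2, h3⟩ := h
  rcases h3.lt_or_gt with h | h
  · right
    have : 0 < -u ∧ -u < MetricGraph.len 𝒞 (.top k) :=
      ⟨by linarith, by simp only [chainOfLoops]; linarith⟩
    exact ⟨h, this, by rw [loopPt, if_neg h.not_gt, pt_inner this]⟩
  · left
    have : 0 < u ∧ u < MetricGraph.len 𝒞 (.bottom k) :=
      ⟨by linarith, by simp only [chainOfLoops]; linarith⟩
    exact ⟨h, this, by rw [loopPt, if_pos h, pt_inner this]⟩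

lemma loopPt_zero (k : Fin g) : loopPt 𝒞 k 0 = .vertex (.v k.castSucc) := by
  rw [loopPt, if_neg (lt_irrefl _), neg_zero, pt_zero]; rfl

lemma loopPt_right (k : Fin g) : loopPt 𝒞 k (m (k + 1)) = .vertex (.w k.succ) := by
  rw [loopPt, if_pos (hm _)]
  exact pt_len (Γ := 𝒞) (.bottom k)

lemma place_loopPt (k : Fin g) {u : ℝ} (h : -ℓ (k + 1) < u ∧ u < m (k + 1) ∧ u ≠ 0) :
    place (loopPt 𝒞 k u) = 4 * k + 3 := by
  rcases loopPt_cases (hℓ := hℓ) (hm := hm) (hn := hn) k h with ⟨_, h', e⟩ | ⟨_, h', e⟩ <;>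
    rw [e] <;> rfl

lemma loopCoord_loopPt (j k : Fin g) {u : ℝ} (h : -ℓ (k + 1) < u ∧ u < m (k + 1) ∧ u ≠ 0) :
    loopCoord j (loopPt 𝒞 k u) = if k = j then u else 0 := by
  rcases loopPt_cases (hℓ := hℓ) (hm := hm) (hn := hn) k h with ⟨_, h', e⟩ | ⟨_, h', e⟩ <;>
    rw [e] <;> simp [loopCoord, edgeCoord]

variable {x : ℕ → Option ℝ} {a b : ℤ}

/-- No chip lies on a bridge or at an inner vertex, so the left degree stays constant from the right
vertex of one loop up to the interior of the next. The bounds on `j` ensure that the left end is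
counted and the right end is not. -/
lemma degLT_stdDiv (hx : ValidChips g ℓ m x) {j k : ℕ} (hk : k ≤ g) (h1 : 4 * k ≤ j)
    (h2 : j ≤ 4 * k + 3) (h3 : 1 ≤ j) (h4 : j ≤ 4 * g + 2) :
    degLT j (stdDiv 𝒞 a x b) = chipsLT a x k := by
  rw [degLT, pair_stdDiv]
  have e1 : place (leftEnd 𝒞) < j := by simp only [leftEnd, place, Fin.val_zero]; omega
  have e2 : ¬ place (rightEnd 𝒞) < j := by simp only [rightEnd, place, Fin.val_last]; omega
  rw [if_pos e1, if_neg e2, chipsLT]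
  simp only [Int.cast_id, mul_one, mul_zero, add_zero]
  congr 1
  have e3 : Finset.range k = (Finset.range g).filter (· < k) := by
    ext i; simp only [Finset.mem_range, Finset.mem_filter]; omega
  rw [e3, Finset.sum_filter, Finset.sum_range]
  refine Finset.sum_congr rfl fun i _ => ?_
  have hv := hx i i.2
  rcases hxi : x i with _ | u
  · simp
  · simp only [Option.elim_some, Option.isSome_some, if_true]
    rw [place_loopPt i (hv u hxi)]
    congr 1
    simp only [eq_iff_iff]; omega

lemma deg_stdDiv : deg (stdDiv 𝒞 a x b) = chipsLT a x g + b := by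
  rw [deg_eq_pair, pair_stdDiv, chipsLT, Finset.sum_range]
  simp only [Int.cast_id, mul_one]
  congr 2
  refine Finset.sum_congr rfl fun i _ => ?_
  cases x i <;> simp

lemma pair_loopCoord_stdDiv (hx : ValidChips g ℓ m x) (k : Fin g) :
    pair (loopCoord k) (stdDiv 𝒞 a x b) = (x k).getD 0 := by
  rw [pair_stdDiv, Finset.sum_eq_single k]
  · have e1 : loopCoord k (leftEnd 𝒞) = 0 := by simp [loopCoord, edgeCoord, leftEnd]
    have e2 : loopCoord k (rightEnd 𝒞) = 0 := by simp [loopCoord, edgeCoord, rightEnd]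
    rw [e1, e2]
    rcases hxk : x k with _ | u
    · simp
    · simp [loopCoord_loopPt k k (hx k k.2 u hxk)]
  · intro i _ hi
    rcases hxi : x i with _ | u
    · simp
    · simp [loopCoord_loopPt k i (hx i i.2 u hxi), hi]
  · simp

lemma moment_stdDiv (hx : ValidChips g ℓ m x) (k : Fin g) :
    moment k (stdDiv 𝒞 a x b) = (x k).getD 0 - m (k + 1) * (chipsLT a x (k + 1) : ℤ) := by
  have := k.2
  rw [moment, pair_loopCoord_stdDiv hx,
    degLT_stdDiv (k := (k : ℕ) + 1) hx (by omega) (by omega) (by omega) (by omega) (by omega)]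
  rfl

/-- The contribution of a chip to a function on the bottom edge of its loop. -/
def bottomHinge (o : Option ℝ) (t : ℝ) : ℝ := o.elim 0 fun u => if 0 < u then max (t - u) 0 else 0

/-- The contribution of a chip to a function on the top edge of its loop. -/
def topHinge (o : Option ℝ) (t : ℝ) : ℝ := o.elim 0 fun u => if 0 < u then 0 else max (t + u) 0

lemma pair_hinge_bridge (hx : ValidChips g ℓ m x) (k : Fin (g + 1)) (t : ℝ) :
    pair (hinge (.bridge k) t) (stdDiv 𝒞 a x b) = 0 := by
  rw [pair_stdDiv, Finset.sum_eq_zero]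
  · simp [hinge, leftEnd, rightEnd]
  · intro i _
    rcases hxi : x i with _ | u
    · simp
    · rcases loopPt_cases (hℓ := hℓ) (hm := hm) (hn := hn) i (hx i i.2 u hxi) with
        ⟨_, h', e⟩ | ⟨_, h', e⟩ <;> simp [e, hinge]

lemma pair_hinge_bottom (hx : ValidChips g ℓ m x) (k : Fin g) (t : ℝ) :
    pair (hinge (.bottom k) t) (stdDiv 𝒞 a x b) = bottomHinge (x k) t := by
  rw [pair_stdDiv, Finset.sum_eq_single k]
  · simp only [hinge, leftEnd, rightEnd]
    rcases hxi : x k with _ | u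
    · simp [bottomHinge]
    · rcases loopPt_cases (hℓ := hℓ) (hm := hm) (hn := hn) k (hx k k.2 u hxi) with
        ⟨h, h', e⟩ | ⟨h, h', e⟩ <;> simp [e, bottomHinge, h, h.not_gt]
  · intro i _ hi
    rcases hxi : x i with _ | u
    · simp
    · rcases loopPt_cases (hℓ := hℓ) (hm := hm) (hn := hn) i (hx i i.2 u hxi) with
        ⟨_, h', e⟩ | ⟨_, h', e⟩ <;> simp [e, hinge, hi]
  · simp

lemma pair_hinge_top (hx : ValidChips g ℓ m x) (k : Fin g) (t : ℝ) :
    pair (hinge (.top k) t) (stdDiv 𝒞 a x b) = topHinge (x k) t := by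
  rw [pair_stdDiv, Finset.sum_eq_single k]
  · simp only [hinge, leftEnd, rightEnd]
    rcases hxi : x k with _ | u
    · simp [topHinge]
    · rcases loopPt_cases (hℓ := hℓ) (hm := hm) (hn := hn) k (hx k k.2 u hxi) with
        ⟨h, h', e⟩ | ⟨h, h', e⟩ <;> simp [e, topHinge, h, h.not_gt]
  · intro i _ hi
    rcases hxi : x i with _ | u
    · simp
    · rcases loopPt_cases (hℓ := hℓ) (hm := hm) (hn := hn) i (hx i i.2 u hxi) with
        ⟨_, h', e⟩ | ⟨_, h', e⟩ <;> simp [e, hinge, hi]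
  · simp

open Classical in
lemma stdDiv_apply (p : MetricGraph.Point 𝒞) :
    stdDiv 𝒞 a x b p = a * (if leftEnd 𝒞 = p then 1 else 0) +
      ∑ k : Fin g, (x k).elim 0 (fun u => if loopPt 𝒞 k u = p then 1 else 0) +
      b * (if rightEnd 𝒞 = p then 1 else 0) := by
  have := pair_stdDiv (R := ℤ) (fun q => if q = p then 1 else 0) a x b (Γ := 𝒞)
  rw [pair_indicator] at this
  simpa using this

lemma stdDiv_vertex (hx : ValidChips g ℓ m x) (w : ChainVertex g) :
    stdDiv 𝒞 a x b (.vertex w) = a * (by classical exact if .w 0 = w then 1 else 0) +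
      b * (by classical exact if .v (Fin.last g) = w then 1 else 0) := by
  classical
  rw [stdDiv_apply, Finset.sum_eq_zero]
  · rw [leftEnd, rightEnd, add_zero]
    congr 2 <;> refine if_congr ?_ rfl rfl <;> exact ⟨Point.vertex.inj, congrArg _⟩
  · intro i _
    rcases hxi : x i with _ | u
    · simp
    · rcases loopPt_cases (hℓ := hℓ) (hm := hm) (hn := hn) i (hx i i.2 u hxi) with
        ⟨_, h', e⟩ | ⟨_, h', e⟩ <;> simp [e]

lemma stdDiv_leftEnd (hx : ValidChips g ℓ m x) : stdDiv 𝒞 a x b (leftEnd 𝒞) = a := by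
  rw [leftEnd, stdDiv_vertex hx]; simp

lemma stdDiv_rightEnd (hx : ValidChips g ℓ m x) : stdDiv 𝒞 a x b (rightEnd 𝒞) = b := by
  rw [rightEnd, stdDiv_vertex hx]; simp

lemma stdDiv_v (hx : ValidChips g ℓ m x) (k : Fin g) :
    stdDiv 𝒞 a x b (.vertex (.v k.castSucc)) = 0 := by
  have := k.2
  rw [stdDiv_vertex hx]; simp [Fin.ext_iff]; omega

lemma stdDiv_w (hx : ValidChips g ℓ m x) (k : Fin g) :
    stdDiv 𝒞 a x b (.vertex (.w k.succ)) = 0 := by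
  rw [stdDiv_vertex hx]; simp [Fin.ext_iff]

lemma stdDiv_nonneg (ha : 0 ≤ a) (hb : 0 ≤ b) : 0 ≤ stdDiv 𝒞 a x b := by
  intro p
  rw [stdDiv_apply]
  refine add_nonneg (add_nonneg (by positivity) (Finset.sum_nonneg fun i _ => ?_)) (by positivity)
  cases x i
  · simp
  · simp only [Option.elim_some]; positivity

end ChipDataOnChain

/-! ### Uniqueness of standard divisors, and its converse -/

section Effective

variable {g : ℕ} {Γ : MetricGraph (ChainVertex g) (ChainEdge g)}

lemma pair_le_pair {φ χ : Γ.Point → ℤ} {Z : Γ.Divisor} (h : ∀ p, φ p ≤ χ p) (hZ : 0 ≤ Z) :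
    pair φ Z ≤ pair χ Z := by
  rw [pair_apply, pair_apply]
  exact Finset.sum_le_sum fun p _ => mul_le_mul_of_nonneg_left (h p) (by simpa using hZ p)

lemma apply_le_degAt {F : Γ.Divisor} (hF : 0 ≤ F) (p : Γ.Point) : F p ≤ degAt (place p) F := by
  classical
  have := pair_indicator (R := ℤ) p F
  rw [Int.cast_id] at this
  rw [← this]
  refine pair_le_pair (fun q => ?_) hF
  by_cases h : q = p <;> simp [h]
  positivity

lemma exists_pos_of_degAt_pos {F : Γ.Divisor} {j : ℕ} (h : 0 < degAt j F) :
    ∃ p, place p = j ∧ 0 < F p := by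
  by_contra! hc
  refine h.not_ge ?_
  rw [degAt, pair_apply]
  refine Finset.sum_nonpos fun p _ => ?_
  by_cases hp : place p = j
  · simpa [hp] using hc p hp
  · simp [hp]

lemma loopCoord_eq_zero {k : Fin g} {p : Γ.Point} (h : place p ≠ 4 * k + 3) :
    loopCoord k p = 0 := by
  rcases p with (i | i) | ⟨i | i | i, t, ht⟩ <;> simp [loopCoord, edgeCoord, place] at h ⊢
  · intro e; exact absurd (congrArg Fin.val e) h
  · intro e; exact absurd (congrArg Fin.val e) h

lemma pair_loopCoord_eq_zero {F : Γ.Divisor} (hF : 0 ≤ F) {k : Fin g}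
    (h : degAt (4 * k + 3) F = 0) : pair (loopCoord k) F = 0 := by
  rw [pair_apply]
  refine Finset.sum_eq_zero fun p hp => ?_
  by_cases hp' : place p = 4 * k + 3
  · have h1 := apply_le_degAt hF p
    have h2 : 0 ≤ F p := hF p
    rw [hp', h] at h1
    have : F p = 0 := le_antisymm h1 h2
    simp [this]
  · rw [loopCoord_eq_zero hp', mul_zero]

/-- The moment sees the retraction of the chain onto the loop, with coordinates measured along the
bottom edge from the right vertex: everything on the left retracts to the left vertex, of coordinate
minus the length of the bottom edge, and everything on the right to `0`. -/
lemma moment_single_of_place_ne {k : Fin g} {p : Γ.Point} (h : place p ≠ 4 * k + 3) (c : ℤ) :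
    moment k (Finsupp.single p c) =
      if place p < 4 * k + 4 then - Γ.len (.bottom k) * c else 0 := by
  rw [moment, pair_single, loopCoord_eq_zero h, degLT, pair_single]
  split_ifs <;> simp

lemma single_nonneg (p : Γ.Point) : (0 : Γ.Divisor) ≤ Finsupp.single p 1 :=
  Finsupp.single_nonneg.2 zero_le_one

lemma sub_single_nonneg {F : Γ.Divisor} (hF : 0 ≤ F) {p : Γ.Point} (hp : 0 < F p) :
    0 ≤ F - Finsupp.single p 1 := by
  classical
  intro q
  rw [Finsupp.coe_sub, Pi.sub_apply, Finsupp.single_apply]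
  split_ifs with h
  · subst h; simp only [Finsupp.coe_zero, Pi.zero_apply]; omega
  · simpa using hF q

lemma stdDiv_congr {a b : ℤ} {x x' : ℕ → Option ℝ} (h : ∀ k < g, x k = x' k) :
    stdDiv Γ a x b = stdDiv Γ a x' b := by
  rw [stdDiv, stdDiv]
  congr 2
  exact Finset.sum_congr rfl fun k _ => by rw [h k k.2]

end Effective

section Uniqueness

variable {g : ℕ} {ℓ m n : ℕ → ℝ} {hℓ : ∀ k, 0 < ℓ k} {hm : ∀ k, 0 < m k} {hn : ∀ k, 0 < n k}

local notation "𝒞" => chainOfLoops g ℓ m n hℓ hm hn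

lemma exists_eq_loopPt {k : Fin g} {p : MetricGraph.Point 𝒞} (hp : place p = 4 * k + 3) :
    ∃ u, (-ℓ (k + 1) < u ∧ u < m (k + 1) ∧ u ≠ 0) ∧ p = loopPt 𝒞 k u := by
  rcases p with (i | i) | ⟨i | i | i, t, ht⟩ <;> simp only [place] at hp
  · omega
  · omega
  · omega
  · have e : i = k := by ext; omega
    subst e
    have h1 := hm (i + 1)
    refine ⟨-t, ⟨?_, ?_, ?_⟩, ?_⟩
    · have : t < ℓ (i + 1) := ht.2
      linarith
    · linarith [ht.1]
    · linarith [ht.1]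
    · rw [loopPt, if_neg (by linarith [ht.1]), neg_neg, pt_inner ht]
  · have e : i = k := by ext; omega
    subst e
    have h1 := hℓ (i + 1)
    refine ⟨t, ⟨?_, ht.2, ?_⟩, ?_⟩
    · linarith [ht.1]
    · linarith [ht.1]
    · rw [loopPt, if_pos ht.1, pt_inner ht]

lemma place_loopPt_of_le (k : Fin g) {u : ℝ} (h1 : -ℓ (k + 1) < u) (h2 : u ≤ m (k + 1)) :
    place (loopPt 𝒞 k u) = if u = 0 then 4 * (k : ℕ) + 2 else
      if u = m (k + 1) then 4 * (k : ℕ) + 4 else 4 * k + 3 := by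
  split_ifs with h3 h4
  · subst h3; rw [loopPt_zero]; rfl
  · subst h4; rw [loopPt_right]; simp only [place, Fin.val_succ]; ring
  · exact place_loopPt k ⟨h1, lt_of_le_of_ne h2 h4, h3⟩

lemma moment_loopPt (j k : Fin g) {u : ℝ} (h1 : -ℓ (k + 1) < u) (h2 : u ≤ m (k + 1)) :
    moment j (Finsupp.single (loopPt 𝒞 k u) 1) =
      if k = j then u - m (j + 1) else if k < j then - m (j + 1) else 0 := by
  have hp := place_loopPt_of_le (hℓ := hℓ) (hm := hm) (hn := hn) k h1 h2
  have hlen : MetricGraph.len 𝒞 (.bottom j) = m (j + 1) := rfl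
  have hmk := hm (k + 1)
  by_cases hkj : k = j
  · subst hkj
    rw [if_pos rfl]
    by_cases hu : u ≠ 0 ∧ u ≠ m (k + 1)
    · rw [moment, pair_single, degLT, pair_single,
        loopCoord_loopPt k k ⟨h1, lt_of_le_of_ne h2 hu.2, hu.1⟩, hp, hlen]
      simp [hu.1, hu.2]
    · rw [moment_single_of_place_ne, hp, hlen]
      · by_cases h0 : u = 0
        · simp [h0]
        · have : u = m (k + 1) := by tauto
          simp [this, hmk.ne']
      · rw [hp]
        by_cases h0 : u = 0
        · simp [h0]
        · have : u = m (k + 1) := by tauto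
          simp [this, hmk.ne']
  · rw [if_neg hkj]
    have hkj' : (k : ℕ) ≠ j := fun e => hkj (Fin.ext e)
    have hb : 4 * (k : ℕ) + 2 ≤ place (loopPt 𝒞 k u) ∧ place (loopPt 𝒞 k u) ≤ 4 * k + 4 := by
      rw [hp]; split_ifs <;> omega
    rw [moment_single_of_place_ne (by omega), hlen]
    by_cases hlt : k < j
    · have : (k : ℕ) < j := hlt
      rw [if_pos (by omega), if_pos hlt]; simp
    · have : ¬ (k : ℕ) < j := hlt
      rw [if_neg (by omega), if_neg hlt]

lemma exists_eq_stdDiv {F : MetricGraph.Divisor 𝒞} (hF : 0 ≤ F)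
    (hv : ∀ k : Fin g, F (.vertex (.v k.castSucc)) = 0) (hw : ∀ k : Fin g, F (.vertex (.w k.succ)) = 0)
    (hb : ∀ k : Fin (g + 1), degAt (4 * k + 1) F = 0)
    (hl : ∀ k : Fin g, degAt (4 * k + 3) F ≤ 1) :
    ∃ x, ValidChips g ℓ m x ∧ F = stdDiv 𝒞 (F (leftEnd 𝒞)) x (F (rightEnd 𝒞)) := by
  classical
  have key : ∀ k : Fin g, ∃ o : Option ℝ, (∀ u ∈ o, -ℓ (k + 1) < u ∧ u < m (k + 1) ∧ u ≠ 0) ∧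
      ∀ p, place p = 4 * k + 3 → F p = o.elim 0 (fun u => if loopPt 𝒞 k u = p then 1 else 0) := by
    intro k
    rcases (degAt_nonneg hF (4 * k + 3)).eq_or_lt with h0 | h0
    · refine ⟨none, by simp, fun p hp => ?_⟩
      have := apply_le_degAt hF p
      rw [hp, ← h0] at this
      exact le_antisymm this (hF p)
    · obtain ⟨p, hp, hFp⟩ := exists_pos_of_degAt_pos h0
      obtain ⟨u, hu, rfl⟩ := exists_eq_loopPt hp
      refine ⟨some u, by rintro _ ⟨⟩; exact hu, fun q hq => ?_⟩
      have h1 := apply_le_degAt (sub_single_nonneg hF hFp) q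
      have h2 := sub_single_nonneg hF hFp q
      rw [map_sub, hq, degAt, pair_single, hp] at h1
      have h3 : degAt (4 * k + 3) F ≤ 1 := hl k
      rw [degAt] at h3
      simp only [Finsupp.coe_sub, Pi.sub_apply, Finsupp.coe_zero, Pi.zero_apply, if_true,
        Int.cast_id, mul_one, Finsupp.single_apply, Option.elim_some] at h1 h2 ⊢
      linarith
  choose o ho hoF using key
  refine ⟨fun k => if h : k < g then o ⟨k, h⟩ else none, ?_, ?_⟩
  · intro k hk u hu
    simp only [hk, dif_pos] at hu
    exact ho ⟨k, hk⟩ u hu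
  have hx : ValidChips g ℓ m fun k => if h : k < g then o ⟨k, h⟩ else none := by
    intro k hk u hu
    simp only [hk, dif_pos] at hu
    exact ho ⟨k, hk⟩ u hu
  ext p
  have hloop : ∀ k : Fin g, place p = 4 * k + 3 → F p =
      stdDiv 𝒞 (F (leftEnd 𝒞)) (fun k => if h : k < g then o ⟨k, h⟩ else none)
        (F (rightEnd 𝒞)) p := by
    intro k hk
    rw [stdDiv_apply, Finset.sum_eq_single k, hoF k p hk, if_neg, if_neg]
    · simp
    · rintro rfl; simp [place, rightEnd] at hk; omega
    · rintro rfl; simp [place, leftEnd] at hk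
    · intro i _ hi
      simp only [Fin.is_lt, dif_pos, Fin.eta]
      rcases hoi : o i with _ | u
      · rfl
      · simp only [Option.elim_some]
        rw [if_neg]
        rintro rfl
        rw [place_loopPt i (ho i u hoi)] at hk
        exact hi (Fin.ext (by omega))
    · simp
  rcases p with (k | k) | ⟨k | k | k, t, ht⟩
  · rcases Fin.eq_zero_or_eq_succ k with rfl | ⟨k, rfl⟩
    · exact (stdDiv_leftEnd hx).symm
    · rw [hw, stdDiv_w hx]
  · rcases Fin.eq_castSucc_or_eq_last k with ⟨k, rfl⟩ | rfl
    · rw [hv, stdDiv_v hx]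
    · exact (stdDiv_rightEnd hx).symm
  · have h1 := apply_le_degAt hF (.inner (.bridge k) t ht)
    rw [show place (Γ := 𝒞) (.inner (.bridge k) t ht) = 4 * k + 1 from rfl, hb] at h1
    rw [le_antisymm h1 (hF _), stdDiv_apply, Finset.sum_eq_zero]
    · simp [leftEnd, rightEnd]
    · intro i _
      simp only [Fin.is_lt, dif_pos, Fin.eta]
      rcases hoi : o i with _ | u
      · rfl
      · simp only [Option.elim_some]
        rw [if_neg]
        intro e
        have := place_loopPt (hℓ := hℓ) (hm := hm) (hn := hn) i (ho i u hoi)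
        rw [e] at this
        simp only [place] at this
        omega
  · exact hloop k rfl
  · exact hloop k rfl

/-- Moments are known only modulo the length of the loop; this turns a congruence into an equality
when the difference is shorter than the loop. -/
lemma eq_zero_of_mul_of_abs_lt {L c : ℝ} {z : ℤ} (h : c = z * L) (hc : |c| < L) : z = 0 := by
  have hL : 0 < L := (abs_nonneg c).trans_lt hc
  rw [h, abs_mul, abs_of_pos hL] at hc
  have h1 : |(z : ℝ)| < 1 := by
    by_contra! h2
    nlinarith
  have : |z| < 1 := by exact_mod_cast h1
  exact Int.abs_lt_one_iff.1 this

/-- A divisor with at most one chip on each loop and no chips on the bridges and at the inner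
vertices is determined by its class and its degrees at the two ends. -/
theorem stdDiv_unique {x : ℕ → Option ℝ} {a b : ℤ} (hx : ValidChips g ℓ m x)
    {F : MetricGraph.Divisor 𝒞} (h : MetricGraph.LinEquiv 𝒞 (stdDiv 𝒞 a x b) F) (hF : 0 ≤ F)
    (ha : a ≤ F (leftEnd 𝒞)) (hb : b ≤ F (rightEnd 𝒞)) : F = stdDiv 𝒞 a x b := by
  obtain ⟨hdeg, hmom⟩ := chain_linEquiv_iff.1 h
  have hlL : ∀ k : Fin g, loopLen 𝒞 k = ℓ (k + 1) + m (k + 1) := fun k => rfl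
  obtain ⟨d, hd⟩ : ∃ d : ℕ → ℤ, ∀ j, d j = degLT j F := ⟨_, fun _ => rfl⟩
  have hds : ∀ j, d (j + 1) = d j + degAt j F := fun j => by rw [hd, hd, degLT_succ]
  have hmono : ∀ {i j}, i ≤ j → d i ≤ d j := fun h => by rw [hd, hd]; exact degLT_mono hF h
  have hd1 : d 1 = F (leftEnd 𝒞) := by
    have := degAt_w (Γ := 𝒞) 0 F
    simp only [Fin.val_zero, mul_zero] at this
    rw [hd, show (1 : ℕ) = 0 + 1 from rfl, degLT_succ, this, degLT_zero, zero_add]; rfl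
  have hdl : d (4 * g + 3) = d (4 * g + 2) + F (rightEnd 𝒞) := by
    have := degAt_v (Γ := 𝒞) (Fin.last g) F
    rw [Fin.val_last] at this
    rw [hds, this]; rfl
  have hdg : d (4 * g + 3) = chipsLT a x g + b := by
    rw [← deg_stdDiv (hℓ := hℓ) (hm := hm) (hn := hn), ← hdeg, hd, degLT_last]
  have hmom' : ∀ k : Fin g, ∃ z : ℤ, pair (loopCoord k) F - m (k + 1) * (d (4 * k + 4) : ℤ) -
      ((x k).getD 0 - m (k + 1) * (chipsLT a x (k + 1) : ℤ)) = z * (ℓ (k + 1) + m (k + 1)) := by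
    intro k
    obtain ⟨z, hz⟩ := hmom k
    rw [moment_stdDiv hx, moment] at hz
    exact ⟨z, by rw [hd]; exact hz⟩
  -- A surplus of `F` persists across a loop. It could vanish only if `F` has no chip inside the
  -- loop while the standard divisor has one; equal counts afterwards would then make the coordinate
  -- `u` of that chip a multiple of the length, so `u = 0`: a chip at the left vertex.
  have step1 : ∀ k, k < g → chipsLT a x k + 1 ≤ d (4 * k + 3) →
      chipsLT a x (k + 1) + 1 ≤ d (4 * k + 4) := by
    intro k hk h1
    by_contra! h2
    have h3 := chipsLT_succ a x k
    have h4 : d (4 * k + 4) = _ := hds (4 * k + 3)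
    have h5 := degAt_nonneg hF (4 * k + 3)
    rcases hxk : x k with _ | u
    · simp [hxk] at h3; linarith
    · simp [hxk] at h3
      have h6 : degAt (4 * k + 3) F = 0 := by linarith
      obtain ⟨z, hz⟩ := hmom' ⟨k, hk⟩
      rw [pair_loopCoord_eq_zero (k := ⟨k, hk⟩) hF h6] at hz
      have h7 : d (4 * k + 4) = chipsLT a x (k + 1) := by linarith
      simp only [h7, hxk, Option.getD_some] at hz
      obtain ⟨u1, u2, u3⟩ := hx k hk u hxk
      have h8 : -u = z * (ℓ (k + 1) + m (k + 1)) := by linarith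
      have := eq_zero_of_mul_of_abs_lt h8
        (abs_lt.2 ⟨by linarith [hℓ (k + 1)], by linarith [hm (k + 1)]⟩)
      rw [this] at h8
      simp at h8
      exact u3 h8
  -- Equality cannot turn into a deficit: the chip of the standard divisor would have coordinate `m
  -- (k + 1)`, at the right vertex.
  have step2 : ∀ k, k < g → chipsLT a x k = d (4 * k + 3) →
      chipsLT a x (k + 1) ≤ d (4 * k + 4) := by
    intro k hk h1
    by_contra! h2
    have h3 := chipsLT_succ a x k
    have h4 : d (4 * k + 4) = _ := hds (4 * k + 3)
    have h5 := degAt_nonneg hF (4 * k + 3)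
    rcases hxk : x k with _ | u
    · simp [hxk] at h3; linarith
    · simp [hxk] at h3
      have h6 : degAt (4 * k + 3) F = 0 := by linarith
      obtain ⟨z, hz⟩ := hmom' ⟨k, hk⟩
      rw [pair_loopCoord_eq_zero (k := ⟨k, hk⟩) hF h6] at hz
      have h7 : d (4 * k + 4) = chipsLT a x (k + 1) - 1 := by linarith
      simp only [h7, hxk, Option.getD_some] at hz
      push_cast at hz
      obtain ⟨u1, u2, u3⟩ := hx k hk u hxk
      have h8 : m (k + 1) - u = z * (ℓ (k + 1) + m (k + 1)) := by linarith
      have := eq_zero_of_mul_of_abs_lt h8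
        (abs_lt.2 ⟨by linarith [hℓ (k + 1), hm (k + 1)], by linarith [hm (k + 1)]⟩)
      rw [this] at h8
      simp at h8
      linarith
  -- A surplus anywhere would persist to the right end and leave fewer than `b` chips of `F` there.
  have upper : ∀ k < g, d (4 * k + 3) ≤ chipsLT a x k := by
    intro k hk
    by_contra! h1
    have h2 : ∀ j, k ≤ j → j < g → chipsLT a x (j + 1) + 1 ≤ d (4 * j + 4) := by
      intro j hj
      induction j, hj using Nat.le_induction with
      | base => intro _; exact step1 k hk h1
      | succ j hj ih =>
        intro hjg
        exact step1 (j + 1) hjg ((ih (by omega)).trans (hmono (by omega)))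
    have h3 := h2 (g - 1) (by omega) (by omega)
    rw [Nat.sub_add_cancel (by omega : 1 ≤ g)] at h3
    have h4 : d (4 * (g - 1) + 4) ≤ d (4 * g + 2) := hmono (by omega)
    linarith
  have upper' : ∀ k ≤ g, d (4 * k + 2) ≤ chipsLT a x k := by
    intro k hk
    rcases hk.eq_or_lt with rfl | hk
    · linarith
    · exact (hmono (by omega)).trans (upper k hk)
  -- The case `k = 0` is exceptional because `d 0` does not count the chips at the left end.
  have lower : ∀ k ≤ g, chipsLT a x k ≤ d (4 * k) ∨ k = 0 := by
    intro k
    induction k with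
    | zero => intro _; right; rfl
    | succ k ih =>
      intro hk
      left
      have h1 : chipsLT a x k ≤ d (4 * k + 3) := by
        rcases ih (by omega) with h | rfl
        · exact h.trans (hmono (by omega))
        · rw [chipsLT_zero]; exact (ha.trans_eq hd1.symm).trans (hmono (by omega))
      exact step2 k hk (le_antisymm h1 (upper k hk))
  have lower' : ∀ k ≤ g, chipsLT a x k ≤ d (4 * k + 1) := by
    intro k hk
    rcases lower k hk with h | rfl
    · exact h.trans (hmono (by omega))
    · rw [chipsLT_zero]; exact ha.trans_eq hd1.symm
  have eq1 : ∀ k ≤ g, d (4 * k + 1) = chipsLT a x k := fun k hk =>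
    le_antisymm ((hmono (by omega)).trans (upper' k hk)) (lower' k hk)
  have eq2 : ∀ k ≤ g, d (4 * k + 2) = chipsLT a x k := fun k hk =>
    le_antisymm (upper' k hk) ((lower' k hk).trans (hmono (by omega)))
  have eq3 : ∀ k < g, d (4 * k + 3) = chipsLT a x k := fun k hk =>
    le_antisymm (upper k hk) ((lower' k hk.le).trans (hmono (by omega)))
  have eq4 : ∀ k < g, d (4 * k + 4) = chipsLT a x (k + 1) := fun k hk =>
    le_antisymm ((hmono (by omega)).trans_eq (eq1 (k + 1) hk))
      ((lower (k + 1) hk).resolve_right (by omega))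
  have eqa : F (leftEnd 𝒞) = a := by
    rw [← hd1, ← chipsLT_zero a x]; exact eq1 0 (by omega)
  have eqb : F (rightEnd 𝒞) = b := by linarith [eq2 g le_rfl]
  obtain ⟨x', hx', hFx⟩ := exists_eq_stdDiv (F := F) hF
    (fun k => by
      have h1 := degAt_v k.castSucc F
      have h2 : d (4 * k + 3) = _ := hds (4 * k + 2)
      simp only [Fin.val_castSucc] at h1
      linarith [eq2 k k.2.le, eq3 k k.2])
    (fun k => by
      have h1 := degAt_w k.succ F
      have h2 : d (4 * k + 5) = _ := hds (4 * k + 4)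
      have h3 := eq1 (k + 1) k.2
      rw [Fin.val_succ, show 4 * ((k : ℕ) + 1) = 4 * k + 4 by ring] at h1
      rw [show 4 * ((k : ℕ) + 1) + 1 = 4 * k + 5 by ring] at h3
      linarith [eq4 k k.2])
    (fun k => by
      have h2 : d (4 * k + 2) = _ := hds (4 * k + 1)
      linarith [eq1 k (by omega), eq2 k (by omega)])
    (fun k => by
      have h1 : d (4 * k + 4) = _ := hds (4 * k + 3)
      have h3 := chipsLT_succ a x k
      have h4 : (if (x k).isSome then (1 : ℤ) else 0) ≤ 1 := by split_ifs <;> norm_num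
      linarith [eq3 k k.2, eq4 k k.2])
  rw [eqa, eqb] at hFx
  rw [hFx]
  refine stdDiv_congr fun k hk => ?_
  have hc : ∀ j ≤ g, chipsLT a x' j = chipsLT a x j := by
    intro j hj
    rw [← eq1 j hj, hd, hFx, degLT_stdDiv (k := j) hx' hj (by omega) (by omega) (by omega) (by omega)]
  have hs := chipsLT_succ a x k
  have hs' := chipsLT_succ a x' k
  rw [hc k hk.le, hc (k + 1) hk, hs] at hs'
  -- Once all the counts agree, equality of moments says that the two chips on the loop agree modulo
  -- its length, hence coincide.
  obtain ⟨z, hz⟩ := hmom' ⟨k, hk⟩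
  have e4 : d (4 * k + 4) = chipsLT a x (k + 1) := eq4 k hk
  simp only [e4] at hz
  rw [hFx, pair_loopCoord_stdDiv hx' ⟨k, hk⟩] at hz
  simp only at hz
  rcases hxk : x k with _ | u <;> rcases hxk' : x' k with _ | u'
  · rfl
  · simp [hxk, hxk'] at hs'
  · simp [hxk, hxk'] at hs'
  · simp only [hxk, hxk', Option.getD_some] at hz
    obtain ⟨u1, u2, u3⟩ := hx k hk u hxk
    obtain ⟨u1', u2', u3'⟩ := hx' k hk u' hxk'
    have h8 : u' - u = z * (ℓ (k + 1) + m (k + 1)) := by linarith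
    have := eq_zero_of_mul_of_abs_lt h8 (abs_lt.2 ⟨by linarith, by linarith⟩)
    rw [this] at h8
    simp at h8
    rw [sub_eq_zero.1 h8]

/-- An effective divisor without chips at the inner vertices that is determined by its class and
its degrees at the two ends has no chips on the bridges and at most one chip on each loop. -/
theorem exists_eq_stdDiv_of_unique {F : MetricGraph.Divisor 𝒞} (hF : 0 ≤ F)
    (hv : ∀ k : Fin g, F (.vertex (.v k.castSucc)) = 0) (hw : ∀ k : Fin g, F (.vertex (.w k.succ)) = 0)
    (hu : ∀ G : MetricGraph.Divisor 𝒞, MetricGraph.LinEquiv 𝒞 F G → 0 ≤ G →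
      F (leftEnd 𝒞) ≤ G (leftEnd 𝒞) → F (rightEnd 𝒞) ≤ G (rightEnd 𝒞) → G = F) :
    ∃ x, ValidChips g ℓ m x ∧ F = stdDiv 𝒞 (F (leftEnd 𝒞)) x (F (rightEnd 𝒞)) := by
  classical
  have hsn : ∀ p q : MetricGraph.Point 𝒞, 0 ≤ (Finsupp.single p (1 : ℤ) : MetricGraph.Divisor 𝒞) q :=
    fun p q => single_nonneg p q
  refine exists_eq_stdDiv hF hv hw (fun k => ?_) (fun k => ?_)
  · by_contra h0
    obtain ⟨p, hp, hFp⟩ := exists_pos_of_degAt_pos (lt_of_le_of_ne (degAt_nonneg hF _) (Ne.symm h0))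
    have hpL : p ≠ leftEnd 𝒞 := by rintro rfl; simp [place, leftEnd] at hp
    have hpR : p ≠ rightEnd 𝒞 := by rintro rfl; simp [place, rightEnd] at hp; omega
    have hpw : p ≠ .vertex (.w k) := by rintro rfl; simp [place] at hp
    -- Bridges do not contribute to the moments, so a chip on a bridge may slide to its left end
    -- without leaving the class.
    have hG := hu (F - Finsupp.single p 1 + Finsupp.single (.vertex (.w k)) 1)
      (chain_linEquiv_iff.2 ⟨by simp [deg_eq_pair], fun j => ⟨0, by
        rw [moment_add, moment_sub, moment_single_of_place_ne (by omega),
          moment_single_of_place_ne (by simp only [place]; omega), hp]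
        have : (4 * (k : ℕ) + 1 < 4 * (j : ℕ) + 4) ↔
          place (Γ := 𝒞) (.vertex (.w k)) < 4 * (j : ℕ) + 4 := by simp only [place]; omega
        simp only [this]
        simp⟩⟩)
      (add_nonneg (sub_single_nonneg hF hFp) (single_nonneg _))
      (by
        have := hsn (.vertex (.w k)) (leftEnd 𝒞)
        simp only [Finsupp.add_apply, Finsupp.sub_apply, Finsupp.single_apply (a := p), hpL, if_false]
        linarith)
      (by
        have := hsn (.vertex (.w k)) (rightEnd 𝒞)
        simp only [Finsupp.add_apply, Finsupp.sub_apply, Finsupp.single_apply (a := p), hpR, if_false]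
        linarith)
    have := DFunLike.congr_fun hG p
    simp [hpw.symm] at this
  · by_contra! h0
    have h1 : 0 < degAt (4 * k + 3) F := by linarith
    obtain ⟨p, hp, hFp⟩ := exists_pos_of_degAt_pos h1
    have hF1 := sub_single_nonneg hF hFp
    have h2 : 0 < degAt (4 * k + 3) (F - Finsupp.single p 1) := by
      have : degAt (4 * (k : ℕ) + 3) (Finsupp.single p (1 : ℤ)) = 1 := by
        rw [degAt, pair_single, if_pos hp]; rfl
      rw [map_sub, this]; linarith
    obtain ⟨q, hq, hFq⟩ := exists_pos_of_degAt_pos h2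
    have hF2 := sub_single_nonneg hF1 hFq
    obtain ⟨u₁, hu₁, rfl⟩ := exists_eq_loopPt hp
    obtain ⟨u₂, hu₂, rfl⟩ := exists_eq_loopPt hq
    have hL : 0 < ℓ (k + 1) + m (k + 1) := add_pos (hℓ _) (hm _)
    -- Two chips on a loop may be replaced by one at the left vertex, of coordinate `0`, and one at
    -- the sum of their positions modulo the length. This raises the coefficient at the left vertex,
    -- contradicting uniqueness.
    set u₃ := toIocMod hL (-ℓ (k + 1)) (u₁ + u₂) with hu₃
    have hmem := toIocMod_mem_Ioc hL (-ℓ (k + 1)) (u₁ + u₂)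
    rw [← hu₃] at hmem
    have hz := self_sub_toIocMod hL (-ℓ (k + 1)) (u₁ + u₂)
    rw [← hu₃] at hz
    have hm3 : u₃ ≤ m (k + 1) := by linarith [hmem.2]
    have hne : ∀ w : ChainVertex g, ∀ u, place (loopPt 𝒞 k u) = 4 * k + 3 →
        loopPt 𝒞 k u ≠ .vertex w := by
      intro w u hpl e
      rw [e] at hpl
      rcases w with w | w <;> simp [place] at hpl <;> omega
    have happ : ∀ w : ChainVertex g, (F - Finsupp.single (loopPt 𝒞 k u₁) 1 -
        Finsupp.single (loopPt 𝒞 k u₂) 1 + Finsupp.single (.vertex (.v k.castSucc)) 1 +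
        Finsupp.single (loopPt 𝒞 k u₃) 1 : MetricGraph.Divisor 𝒞) (.vertex w) = F (.vertex w) +
        (Finsupp.single (.vertex (.v k.castSucc)) (1 : ℤ) : MetricGraph.Divisor 𝒞) (.vertex w) +
        (Finsupp.single (loopPt 𝒞 k u₃) (1 : ℤ) : MetricGraph.Divisor 𝒞) (.vertex w) := by
      intro w
      simp only [Finsupp.add_apply, Finsupp.sub_apply,
        Finsupp.single_apply (a := loopPt 𝒞 k u₁), Finsupp.single_apply (a := loopPt 𝒞 k u₂),
        hne w u₁ hp, hne w u₂ hq, if_false, sub_zero]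
    have hG := hu (F - Finsupp.single (loopPt 𝒞 k u₁) 1 - Finsupp.single (loopPt 𝒞 k u₂) 1 +
        Finsupp.single (.vertex (.v k.castSucc)) 1 + Finsupp.single (loopPt 𝒞 k u₃) 1)
      (chain_linEquiv_iff.2 ⟨by simp [deg_eq_pair], fun j => by
        rw [moment_add, moment_add, moment_sub, moment_sub, ← loopPt_zero,
          moment_loopPt j k hu₁.1 hu₁.2.1.le, moment_loopPt j k hu₂.1 hu₂.2.1.le,
          moment_loopPt j k hmem.1 hm3,
          moment_loopPt j k (by linarith [hℓ (k + 1)]) (hm _).le]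
        by_cases hkj : k = j
        · subst hkj
          refine ⟨-toIocDiv hL (-ℓ (k + 1)) (u₁ + u₂), ?_⟩
          rw [if_pos rfl, if_pos rfl, if_pos rfl, if_pos rfl]
          have : loopLen 𝒞 k = ℓ (k + 1) + m (k + 1) := rfl
          rw [this]
          rw [zsmul_eq_mul] at hz
          push_cast
          linarith
        · exact ⟨0, by simp [hkj]⟩⟩)
      (add_nonneg (add_nonneg hF2 (single_nonneg _)) (single_nonneg _))
      (by
        rw [leftEnd, happ]
        linarith [hsn (.vertex (.v k.castSucc)) (.vertex (.w 0)),
            hsn (loopPt 𝒞 k u₃) (.vertex (.w 0))])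
      (by rw [rightEnd, happ]; linarith [hsn (.vertex (.v k.castSucc)) (.vertex (.v (Fin.last g))),
            hsn (loopPt 𝒞 k u₃) (.vertex (.v (Fin.last g)))])
    have h5 := happ (.v k.castSucc)
    have h6 := hsn (loopPt 𝒞 k u₃) (.vertex (.v k.castSucc))
    rw [hG, Finsupp.single_eq_same] at h5
    linarith

end Uniqueness

/-! ### The rank of a class with standard representatives -/

section MomentSums

variable {g : ℕ} {Γ : MetricGraph (ChainVertex g) (ChainEdge g)}

lemma moment_zero (k : Fin g) : moment k (0 : Γ.Divisor) = 0 := by simp [moment]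

lemma moment_sum {ι : Type} (s : Finset ι) (B : ι → Γ.Divisor) (k : Fin g) :
    moment k (∑ i ∈ s, B i) = ∑ i ∈ s, moment k (B i) := by
  classical
  induction s using Finset.induction_on with
  | empty => simp [moment_zero]
  | insert i s hi ih => rw [Finset.sum_insert hi, Finset.sum_insert hi, moment_add, ih]

end MomentSums

section Rank

variable {g : ℕ} {ℓ m n : ℕ → ℝ} {hℓ : ∀ k, 0 < ℓ k} {hm : ∀ k, 0 < m k} {hn : ∀ k, 0 < n k}

local notation "𝒞" => chainOfLoops g ℓ m n hℓ hm hn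

/-- There is an effective divisor with `N` chips on the closed loop `k` of given total position, and
`δ` further chips at its right vertex. -/
lemma exists_loop_divisor (k : Fin g) (N δ : ℤ) (hN : 0 ≤ N) (hδ : 0 ≤ δ) (ξ : ℝ)
    (hξ : N = 0 → ∃ z : ℤ, ξ = z * (ℓ (k + 1) + m (k + 1))) :
    ∃ B : MetricGraph.Divisor 𝒞, 0 ≤ B ∧ deg B = N + δ ∧
      (∀ j, k < j → moment j B = - m (j + 1) * (N + δ)) ∧ (∀ j, j < k → moment j B = 0) ∧
      ∃ z : ℤ, moment k B = ξ - m (k + 1) * N + z * (ℓ (k + 1) + m (k + 1)) := by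
  have hw : ∀ j, moment j (Finsupp.single (.vertex (.w k.succ)) δ : MetricGraph.Divisor 𝒞) =
      if k < j then - m (j + 1) * δ else 0 := by
    intro j
    rw [moment_single_of_place_ne (by simp only [place, Fin.val_succ]; omega)]
    refine if_congr ?_ rfl rfl
    simp only [place, Fin.val_succ, Fin.lt_def]; omega
  have hw0 : (0 : MetricGraph.Divisor 𝒞) ≤ Finsupp.single (.vertex (.w k.succ)) δ :=
    Finsupp.single_nonneg.2 hδ
  rcases hN.eq_or_lt with h0 | h0
  · obtain ⟨z, hz⟩ := hξ h0.symm
    refine ⟨Finsupp.single (.vertex (.w k.succ)) δ, hw0, by simp [deg_eq_pair, ← h0],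
      fun j hj => by rw [hw, if_pos hj, ← h0]; simp,
      fun j hj => by rw [hw, if_neg hj.not_gt], -z, ?_⟩
    rw [hw, if_neg (lt_irrefl _), hz, ← h0]; simp
  · have hL : 0 < ℓ (k + 1) + m (k + 1) := add_pos (hℓ _) (hm _)
    set u := toIocMod hL (-ℓ (k + 1)) ξ with hu
    have hmem := toIocMod_mem_Ioc hL (-ℓ (k + 1)) ξ
    rw [← hu] at hmem
    have hz := self_sub_toIocMod hL (-ℓ (k + 1)) ξ
    rw [← hu, zsmul_eq_mul] at hz
    have hm3 : u ≤ m (k + 1) := by linarith [hmem.2]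
    have hv : ∀ j, moment j (Finsupp.single (.vertex (.v k.castSucc)) (N - 1) :
        MetricGraph.Divisor 𝒞) = if k ≤ j then - m (j + 1) * (N - 1) else 0 := by
      intro j
      rw [moment_single_of_place_ne (by simp only [place, Fin.val_castSucc]; omega)]
      push_cast
      refine if_congr ?_ rfl rfl
      simp only [place, Fin.val_castSucc, Fin.le_def]; omega
    -- The chips at the left vertex have coordinate `0`, so the last chip alone carries the total
    -- position.
    refine ⟨Finsupp.single (.vertex (.v k.castSucc)) (N - 1) + Finsupp.single (loopPt 𝒞 k u) 1 +
      Finsupp.single (.vertex (.w k.succ)) δ,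
      add_nonneg (add_nonneg (Finsupp.single_nonneg.2 (by omega)) (single_nonneg _)) hw0,
      by simp [deg_eq_pair], fun j hj => ?_, fun j hj => ?_, -toIocDiv hL (-ℓ (k + 1)) ξ, ?_⟩
    · rw [moment_add, moment_add, hw, hv, moment_loopPt j k hmem.1 hm3, if_pos hj.le,
        if_neg hj.ne, if_pos hj, if_pos hj]
      ring
    · rw [moment_add, moment_add, hw, hv, moment_loopPt j k hmem.1 hm3, if_neg hj.not_ge,
        if_neg hj.ne', if_neg hj.not_gt, if_neg hj.not_gt]
      ring
    · rw [moment_add, moment_add, hw, hv, moment_loopPt k k hmem.1 hm3, if_pos le_rfl,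
        if_pos rfl, if_neg (lt_irrefl _)]
      push_cast
      linarith

variable {r : ℕ} {x : ℕ → ℕ → Option ℝ}

/-- The numbers of chips to the left of a loop grow strictly with the degree at the left end. -/
lemma chipsLT_add_lt (hx : ∀ i ≤ r, ValidChips g ℓ m (x i)) (hℓ : ∀ k, 0 < ℓ k)
    (hm : ∀ k, 0 < m k) {μ : ℕ → ℝ}
    (hμ : ∀ i ≤ r, ∀ k < g, ∃ z : ℤ, (x i k).getD 0 - m (k + 1) * (chipsLT i (x i) (k + 1) : ℤ) -
      μ k = z * (ℓ (k + 1) + m (k + 1))) {i : ℕ} (hi : i + 1 ≤ r) :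
    ∀ k ≤ g, chipsLT i (x i) k + 1 ≤ chipsLT (i + 1 : ℕ) (x (i + 1)) k ∧
      (k < g → x (i + 1) k = none → chipsLT i (x i) k + 2 ≤ chipsLT (i + 1 : ℕ) (x (i + 1)) k) := by
  -- Suppose the counts differ by exactly one and `D_{i+1}` has no chip on the loop. Comparing
  -- moments puts the chip of `D_i` at the left vertex, or, if `D_i` has none either, makes `m (k +
  -- 1)` a multiple of the length; both are impossible.
  have aux : ∀ k < g, chipsLT i (x i) k + 1 = chipsLT (i + 1 : ℕ) (x (i + 1)) k →
      x (i + 1) k ≠ none := by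
    intro k hk he hnone
    obtain ⟨z, hz⟩ := hμ i (by omega) k hk
    obtain ⟨z', hz'⟩ := hμ (i + 1) hi k hk
    rw [chipsLT_succ, hnone, ← he] at hz'
    rw [chipsLT_succ] at hz
    have hmk := hm (k + 1)
    have hlk := hℓ (k + 1)
    rcases hxk : x i k with _ | u
    · simp [hxk] at hz hz'
      have h1 : m (k + 1) = ((z - z' : ℤ) : ℝ) * (ℓ (k + 1) + m (k + 1)) := by
        push_cast; linarith
      have := eq_zero_of_mul_of_abs_lt h1 (abs_lt.2 ⟨by linarith, by linarith⟩)
      rw [this] at h1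
      simp at h1
      linarith
    · simp [hxk] at hz hz'
      obtain ⟨u1, u2, u3⟩ := hx i (by omega) k hk u hxk
      have h1 : u = ((z - z' : ℤ) : ℝ) * (ℓ (k + 1) + m (k + 1)) := by
        push_cast; linarith
      have := eq_zero_of_mul_of_abs_lt h1 (abs_lt.2 ⟨by linarith, by linarith⟩)
      rw [this] at h1
      simp at h1
      exact u3 h1
  have main : ∀ k ≤ g, chipsLT i (x i) k + 1 ≤ chipsLT (i + 1 : ℕ) (x (i + 1)) k := by
    intro k
    induction k with
    | zero => intro _; rw [chipsLT_zero, chipsLT_zero]; push_cast; rfl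
    | succ k ih =>
      intro hk
      have h1 := ih (by omega)
      have h2 := aux k hk
      rw [chipsLT_succ, chipsLT_succ]
      rcases hxk : x (i + 1) k with _ | u
      · have : chipsLT i (x i) k + 1 ≠ chipsLT (i + 1 : ℕ) (x (i + 1)) k := fun h => h2 h hxk
        split_ifs <;> simp at * <;> omega
      · split_ifs <;> simp at * <;> omega
  refine fun k hk => ⟨main k hk, fun hk' hnone => ?_⟩
  have h1 := main k hk
  have h2 : chipsLT i (x i) k + 1 ≠ chipsLT (i + 1 : ℕ) (x (i + 1)) k :=
    fun h => aux k hk' h hnone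
  omega

lemma chipsLT_add_le (hx : ∀ i ≤ r, ValidChips g ℓ m (x i)) (hℓ : ∀ k, 0 < ℓ k)
    (hm : ∀ k, 0 < m k) {μ : ℕ → ℝ}
    (hμ : ∀ i ≤ r, ∀ k < g, ∃ z : ℤ, (x i k).getD 0 - m (k + 1) * (chipsLT i (x i) (k + 1) : ℤ) -
      μ k = z * (ℓ (k + 1) + m (k + 1))) {i j : ℕ} (hij : i ≤ j) (hj : j ≤ r) {k : ℕ} (hk : k ≤ g) :
    chipsLT i (x i) k + (j - i) ≤ chipsLT j (x j) k := by
  induction j, hij using Nat.le_induction with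
  | base => simp
  | succ j hij ih =>
    have h1 := ih (by omega)
    have h2 := (chipsLT_add_lt hx hℓ hm hμ hj k hk).1
    push_cast at *
    linarith

/-- A class with representatives `i w₀ + (at most one chip on each loop) + (r - i) v_{g+1}` for all
`0 ≤ i ≤ r` has rank at least `r`. -/
theorem rankGE_of_stdDiv {D : MetricGraph.Divisor 𝒞} (hx : ∀ i ≤ r, ValidChips g ℓ m (x i))
    (hD : ∀ i ≤ r, MetricGraph.LinEquiv 𝒞 D (stdDiv 𝒞 i (x i) (r - i))) :
    MetricGraph.RankGE 𝒞 D r := by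
  intro E hE hEdeg
  let μ : ℕ → ℝ := fun k => if h : k < g then moment ⟨k, h⟩ D else 0
  have hμk : ∀ k : Fin g, μ k = moment k D := fun k => by simp [μ]
  have hμ : ∀ i ≤ r, ∀ k < g, ∃ z : ℤ, (x i k).getD 0 -
      m (k + 1) * (chipsLT i (x i) (k + 1) : ℤ) - μ k = z * (ℓ (k + 1) + m (k + 1)) := by
    intro i hi k hk
    obtain ⟨z, hz⟩ := (chain_linEquiv_iff.1 (hD i hi)).2 ⟨k, hk⟩
    rw [moment_stdDiv (hx i hi), ← hμk] at hz
    exact ⟨z, hz⟩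
  obtain ⟨e, he⟩ : ∃ e : ℕ → ℕ, ∀ j, (e j : ℤ) = degLT j E := by
    refine ⟨fun j => (degLT j E).toNat, fun j => Int.toNat_of_nonneg ?_⟩
    rw [← degLT_zero E]; exact degLT_mono hE (Nat.zero_le j)
  have hemono : ∀ {i j}, i ≤ j → e i ≤ e j := fun {i j} h => by
    have := degLT_mono hE h
    rw [← he, ← he] at this
    exact_mod_cast this
  have heg : e (4 * g + 3) = r := by
    have := he (4 * g + 3)
    rw [degLT_last, hEdeg] at this
    exact_mod_cast this
  have her : ∀ {j}, j ≤ 4 * g + 3 → e j ≤ r := fun h => heg ▸ hemono h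
  let c : ℕ → ℕ → ℤ := fun i k => chipsLT i (x i) k
  have hcle : ∀ {i j k}, i ≤ j → j ≤ r → k ≤ g → c i k + (j - i) ≤ c j k := fun h1 h2 h3 =>
    chipsLT_add_le hx hℓ hm hμ h1 h2 h3
  -- An effective divisor equivalent to `D - E` is glued from the `D_i`: where `E` has `e` chips on
  -- the left, it imitates `D_e`. `S k` and `S' k` prescribe its degree before and after loop `k`,
  -- apart from the extra chips then placed at the right vertex. They increase because the count for
  -- `D_i`, minus `i`, is nondecreasing in `i`.
  let S : ℕ → ℤ := fun k => c (e (4 * k + 3)) k - e (4 * k + 3)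
  let S' : ℕ → ℤ := fun k => c (e (4 * k + 4)) (k + 1) - e (4 * k + 4)
  have hcs : ∀ i k, c i (k + 1) = c i k + if (x i k).isSome then 1 else 0 :=
    fun i k => chipsLT_succ _ _ _
  have hSS' : ∀ k < g, S k ≤ S' k := by
    intro k hk
    have h1 := hcle (hemono (show 4 * k + 3 ≤ 4 * k + 4 by omega)) (her (by omega)) hk.le
    have h2 := hcs (e (4 * k + 4)) k
    have h3 : (0 : ℤ) ≤ if (x (e (4 * k + 4)) k).isSome then 1 else 0 := by positivity
    simp only [S, S']
    linarith
  have hS'S : ∀ k < g, S' k ≤ S (k + 1) := by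
    intro k hk
    have h1 := hcle (hemono (show 4 * k + 4 ≤ 4 * (k + 1) + 3 by omega)) (her (by omega)) hk
    simp only [S, S']
    linarith
  have hS0 : S 0 = 0 := by simp only [S, c, chipsLT_zero]; ring
  have hSg : S g = deg D - r := by
    have h1 := (chain_linEquiv_iff.1 (hD r le_rfl)).1
    rw [deg_stdDiv] at h1
    simp only [S, c, heg]
    linarith
  -- If no chip is available for the loop, its moment must be right already. Then `D_e` has no chip
  -- there; as the count would otherwise jump by two at a missing chip, `e` is the same before and
  -- after the loop, so `E` has no chip inside it. What remains is the moment condition for `D_e`.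
  have hξ : ∀ k : Fin g, S' k - S k = 0 → ∃ z : ℤ, μ k - pair (loopCoord k) E +
      m (k + 1) * (c (e (4 * k + 4)) (k + 1) : ℤ) = z * (ℓ (k + 1) + m (k + 1)) := by
    intro k h0
    have hk := k.2
    have h2 := hcs (e (4 * k + 4)) k
    have hee : e (4 * k + 3) ≤ e (4 * k + 4) := hemono (by omega)
    have her' : e (4 * (k : ℕ) + 4) ≤ r := her (by omega)
    have h1 := hcle hee her' hk.le
    have hnone : x (e (4 * k + 4)) k = none := by
      by_contra hne
      rw [if_pos (Option.isSome_iff_ne_none.2 hne)] at h2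
      simp only [S, S'] at h0
      linarith
    have heq : e (4 * (k : ℕ) + 3) = e (4 * k + 4) := by
      by_contra hne
      obtain ⟨i, hi⟩ : ∃ i, e (4 * (k : ℕ) + 4) = i + 1 := ⟨e (4 * k + 4) - 1, by omega⟩
      rw [hi] at hnone her'
      have h3 := (chipsLT_add_lt hx hℓ hm hμ her' k hk.le).2 hk hnone
      have h4 := hcle (show e (4 * (k : ℕ) + 3) ≤ i by omega) (by omega) hk.le
      simp only [S, S', hi, c] at h0 h2 h4
      rw [hnone] at h2
      simp at h2
      push_cast at h0 h3
      linarith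
    have hdeg : degAt (4 * (k : ℕ) + 3) E = 0 := by
      have h3 := degLT_succ (4 * (k : ℕ) + 3) E
      rw [← he, ← he, heq] at h3
      linarith
    obtain ⟨z, hz⟩ := hμ _ her' k hk
    rw [hnone] at hz
    refine ⟨-z, ?_⟩
    rw [pair_loopCoord_eq_zero hE hdeg]
    simp only [c, Option.getD_none] at hz ⊢
    push_cast
    linarith
  choose B hB hBdeg hBgt hBlt hBz using fun k : Fin g => exists_loop_divisor (hℓ := hℓ) (hm := hm)
    (hn := hn) k (S' k - S k) (S (k + 1) - S' k) (sub_nonneg.2 (hSS' k k.2))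
    (sub_nonneg.2 (hS'S k k.2)) _ (hξ k)
  refine ⟨∑ k, B k, Finset.sum_nonneg fun k _ => hB k, chain_linEquiv_iff.2 ⟨?_, fun j => ?_⟩⟩
  · have h1 : deg (∑ k, B k) = ∑ k : Fin g, (S (k + 1) - S k) := by
      rw [deg_eq_pair, map_sum]
      refine Finset.sum_congr rfl fun k _ => ?_
      rw [← deg_eq_pair, hBdeg]; ring
    rw [h1, Fin.sum_univ_eq_sum_range (fun k => S (k + 1) - S k), Finset.sum_range_sub, hS0, hSg,
      deg_eq_pair (D - E), map_sub, ← deg_eq_pair, ← deg_eq_pair, hEdeg]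
    ring
  · obtain ⟨z, hz⟩ := hBz j
    -- Loops to the right of `j` contribute nothing, and those to its left only through their
    -- degrees, which telescope to `S j`.
    have h1 : moment j (∑ k, B k) = - m (j + 1) * (S j : ℤ) + moment j (B j) := by
      have h2 : ∀ k : Fin g, moment j (B k) =
          (if (k : ℕ) < j then - m (j + 1) * ((S (k + 1) : ℝ) - S k) else 0) +
          if k = j then moment j (B j) else 0 := by
        intro k
        rcases lt_trichotomy k j with h | h | h
        · have h' : (k : ℕ) < j := h
          rw [hBgt k j h, if_pos h', if_neg h.ne]; push_cast; ring
        · subst h; simp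
        · have h' : ¬ (k : ℕ) < j := h.not_gt
          rw [hBlt k j h, if_neg h', if_neg h.ne']; ring
      rw [moment_sum, Finset.sum_congr rfl fun k _ => h2 k, Finset.sum_add_distrib,
        Finset.sum_ite_eq', if_pos (Finset.mem_univ _)]
      congr 1
      rw [Fin.sum_univ_eq_sum_range
        (fun k => if k < (j : ℕ) then - m (j + 1) * ((S (k + 1) : ℝ) - S k) else 0),
        ← Finset.sum_filter]
      have e3 : (Finset.range g).filter (· < (j : ℕ)) = Finset.range j := by
        ext i; have := j.2; simp only [Finset.mem_range, Finset.mem_filter]; omega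
      rw [e3, ← Finset.mul_sum, Finset.sum_range_sub (fun k => (S k : ℝ)), hS0]
      push_cast; ring
    have hEm : moment j E = pair (loopCoord j) E - m (j + 1) * (e (4 * j + 4) : ℤ) := by
      rw [he]; rfl
    refine ⟨z, ?_⟩
    have hlen : loopLen 𝒞 j = ℓ (j + 1) + m (j + 1) := rfl
    rw [h1, hz, moment_sub, hEm, ← hμk, hlen]
    simp only [S']
    push_cast
    ring

end Rank

/-! ### Prepending, shifting and transferring chips -/

section Chips

lemma chipsLT_add (a b : ℤ) (x : ℕ → Option ℝ) (k : ℕ) :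
    chipsLT (a + b) x k = a + chipsLT b x k := by
  rw [chipsLT, chipsLT, add_assoc]

lemma chipsLT_congr {a : ℤ} {x x' : ℕ → Option ℝ} {k : ℕ}
    (h : ∀ j < k, (x j).isSome = (x' j).isSome) : chipsLT a x k = chipsLT a x' k := by
  rw [chipsLT, chipsLT]
  congr 1
  exact Finset.sum_congr rfl fun j hj => by rw [h j (Finset.mem_range.1 hj)]

lemma chipsLT_none (a : ℤ) (k : ℕ) : chipsLT a (fun _ => none) k = a := by
  simp [chipsLT]

lemma chipsLT_some (a : ℤ) (f : ℕ → ℝ) (k : ℕ) : chipsLT a (fun k => some (f k)) k = a + k := by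
  simp [chipsLT]

lemma chipsLT_mono (a : ℤ) (x : ℕ → Option ℝ) {j k : ℕ} (h : j ≤ k) :
    chipsLT a x j ≤ chipsLT a x k := by
  induction k, h using Nat.le_induction with
  | base => rfl
  | succ k _ ih =>
    rw [chipsLT_succ]
    have : (0 : ℤ) ≤ if (x k).isSome then 1 else 0 := by positivity
    linarith

lemma chipsLT_le_add (a : ℤ) (x : ℕ → Option ℝ) {j k : ℕ} (h : j ≤ k) :
    chipsLT a x k ≤ chipsLT a x j + (k - j) := by
  induction k, h using Nat.le_induction with
  | base => simp
  | succ k _ ih =>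
    rw [chipsLT_succ]
    have : (if (x k).isSome then 1 else 0) ≤ (1 : ℤ) := by split_ifs <;> simp
    push_cast
    linarith

/-- Put `s` loops with chips `h` in front. -/
def prependChips (s : ℕ) (h x : ℕ → Option ℝ) (k : ℕ) : Option ℝ :=
  if k < s then h k else x (k - s)

lemma prependChips_lt {s k : ℕ} (hk : k < s) (h x : ℕ → Option ℝ) :
    prependChips s h x k = h k := if_pos hk

lemma prependChips_add (s k : ℕ) (h x : ℕ → Option ℝ) : prependChips s h x (k + s) = x k := by
  rw [prependChips, if_neg (by omega), Nat.add_sub_cancel]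

lemma chipsLT_prependChips_le {s k : ℕ} (hk : k ≤ s) (a : ℤ) (h x : ℕ → Option ℝ) :
    chipsLT a (prependChips s h x) k = chipsLT a h k :=
  chipsLT_congr fun j hj => by rw [prependChips_lt (hj.trans_le hk)]

lemma chipsLT_prependChips_add (s k : ℕ) (a : ℤ) (h x : ℕ → Option ℝ) :
    chipsLT a (prependChips s h x) (k + s) = chipsLT (chipsLT a h s) x k := by
  induction k with
  | zero => rw [zero_add, chipsLT_prependChips_le le_rfl, chipsLT_zero]
  | succ k ih =>
    rw [show k + 1 + s = k + s + 1 by ring, chipsLT_succ, ih, prependChips_add, chipsLT_succ]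

lemma ValidChips.prependChips {g s : ℕ} {ℓ m : ℕ → ℝ} {h x : ℕ → Option ℝ}
    (hh : ValidChips s ℓ m h) (hx : ValidChips g (fun k => ℓ (k + s)) (fun k => m (k + s)) x) :
    ValidChips (g + s) ℓ m (prependChips s h x) := by
  intro k hk u hu
  by_cases hks : k < s
  · rw [prependChips_lt hks] at hu
    exact hh k hks u hu
  · obtain ⟨j, rfl⟩ : ∃ j, k = j + s := ⟨k - s, by omega⟩
    rw [prependChips_add] at hu
    have := hx j (by omega) u hu
    simpa only [show j + 1 + s = j + s + 1 by ring] using this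

open Classical in
/-- Move the chips on the loops in `S` by `ε`. -/
def shiftChips (S : ℕ → Prop) (ε : ℝ) (x : ℕ → Option ℝ) (k : ℕ) : Option ℝ :=
  if S k then (x k).map (· + ε) else x k

lemma isSome_shiftChips (S : ℕ → Prop) (ε : ℝ) (x : ℕ → Option ℝ) (k : ℕ) :
    (shiftChips S ε x k).isSome = (x k).isSome := by
  rw [shiftChips]; split_ifs <;> simp

lemma chipsLT_shiftChips (a : ℤ) (S : ℕ → Prop) (ε : ℝ) (x : ℕ → Option ℝ) (k : ℕ) :
    chipsLT a (shiftChips S ε x) k = chipsLT a x k :=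
  chipsLT_congr fun j _ => isSome_shiftChips S ε x j

open Classical in
lemma getD_shiftChips {S : ℕ → Prop} {ε : ℝ} {x : ℕ → Option ℝ} {k : ℕ}
    (h : S k → (x k).isSome) :
    (shiftChips S ε x k).getD 0 = (x k).getD 0 + if S k then ε else 0 := by
  rw [shiftChips]
  split_ifs with hS
  · obtain ⟨u, hu⟩ := Option.isSome_iff_exists.1 (h hS)
    simp [hu]
  · simp

lemma ValidChips.eventually_shiftChips {g : ℕ} {ℓ m : ℕ → ℝ} {x : ℕ → Option ℝ}
    (hx : ValidChips g ℓ m x) (S : ℕ → Prop) :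
    ∀ᶠ ε in 𝓝[>] (0 : ℝ), ValidChips g ℓ m (shiftChips S ε x) := by
  have : ∀ k ∈ Finset.range g, ∀ᶠ ε in 𝓝[>] (0 : ℝ), ∀ u ∈ shiftChips S ε x k,
      -ℓ (k + 1) < u ∧ u < m (k + 1) ∧ u ≠ 0 := by
    intro k hk
    have hxk := hx k (Finset.mem_range.1 hk)
    by_cases hS : S k
    · rcases hxk' : x k with _ | u
      · exact Filter.Eventually.of_forall fun ε => by simp [shiftChips, hS, hxk']
      · obtain ⟨h1, h2, h3⟩ := hxk u hxk'
        have e1 : ∀ᶠ ε in 𝓝[>] (0 : ℝ), ε < m (k + 1) - u :=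
          nhdsWithin_le_nhds (Iio_mem_nhds (by linarith))
        have e2 : ∀ᶠ ε in 𝓝[>] (0 : ℝ), ε < |u| :=
          nhdsWithin_le_nhds (Iio_mem_nhds (abs_pos.2 h3))
        filter_upwards [e1, e2, self_mem_nhdsWithin] with ε h4 h5 h6
        have h6 : 0 < ε := h6
        simp only [shiftChips, hS, hxk', if_true, Option.map_some, Option.mem_def,
          Option.some.injEq, forall_eq']
        refine ⟨by linarith, by linarith, fun h7 => ?_⟩
        have : u = -ε := by linarith
        rw [this, abs_neg, abs_of_pos h6] at h5
        exact lt_irrefl _ h5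
    · exact Filter.Eventually.of_forall fun ε => by simpa [shiftChips, hS] using hxk
  filter_upwards [(Filter.eventually_all_finset _).2 this] with ε hε k hk
  exact hε k (Finset.mem_range.2 hk)

/-- The chips that are left on the loops by `a` chips that go through the chain from the left to
the right, one of them being left on each loop that carries no chip. -/
def transferChips {ℓ m : ℕ → ℝ} (hℓ : ∀ k, 0 < ℓ k) (hm : ∀ k, 0 < m k) (a : ℤ)
    (x : ℕ → Option ℝ) (k : ℕ) : Option ℝ :=
  some (toIocMod (add_pos (hℓ (k + 1)) (hm (k + 1))) (-ℓ (k + 1))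
    ((x k).getD (m (k + 1)) - m (k + 1) * (chipsLT a x k - k : ℤ)))

section

variable {ℓ m : ℕ → ℝ} (hℓ : ∀ k, 0 < ℓ k) (hm : ∀ k, 0 < m k)

/-- Before loop `k` the two divisors have `chipsLT a x k` and `k` chips, so equal moments force the
new chip to sit at the old position minus `m (k + 1)` times the difference. If the old chip is
missing, the count after the loop is smaller by one, which has the effect of a chip at the right
vertex; this explains the default value `m (k + 1)` in `transferChips`. -/
lemma moment_transferChips (a : ℤ) (x : ℕ → Option ℝ) (k : ℕ) :
    ∃ z : ℤ, ((transferChips hℓ hm a x k).getD 0 -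
        m (k + 1) * (chipsLT 0 (transferChips hℓ hm a x) (k + 1) : ℤ)) -
      ((x k).getD 0 - m (k + 1) * (chipsLT a x (k + 1) : ℤ)) =
      z * (ℓ (k + 1) + m (k + 1)) := by
  set c := (x k).getD (m (k + 1)) - m (k + 1) * (chipsLT a x k - k : ℤ) with hc
  have hz := self_sub_toIocMod (add_pos (hℓ (k + 1)) (hm (k + 1))) (-ℓ (k + 1)) c
  refine ⟨- toIocDiv (add_pos (hℓ (k + 1)) (hm (k + 1))) (-ℓ (k + 1)) c, ?_⟩
  have h1 : chipsLT 0 (transferChips hℓ hm a x) (k + 1) = k + 1 := by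
    rw [show transferChips hℓ hm a x = fun k => some _ from rfl, chipsLT_some]; simp
  rw [h1, chipsLT_succ]
  simp only [transferChips, Option.getD_some]
  rw [← hc]
  rw [zsmul_eq_mul] at hz
  rcases hxk : x k with _ | u <;> simp [hxk] at hc ⊢ <;> linarith

/-- The two families of inequalities exclude the positions `0` and `m (k + 1)` modulo the length,
that is, the left and the right vertex. -/
lemma validChips_transferChips {g : ℕ} {a : ℤ} {x : ℕ → Option ℝ}
    (h : ∀ k < g, ∀ z : ℤ,
      (x k).getD (m (k + 1)) - m (k + 1) * (chipsLT a x k - k : ℤ) ≠ z * (ℓ (k + 1) + m (k + 1)) ∧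
      (x k).getD (m (k + 1)) - m (k + 1) * (chipsLT a x k - k + 1 : ℤ) ≠
        z * (ℓ (k + 1) + m (k + 1))) :
    ValidChips g ℓ m (transferChips hℓ hm a x) := by
  rintro k hk u ⟨⟩
  set c := (x k).getD (m (k + 1)) - m (k + 1) * (chipsLT a x k - k : ℤ) with hc
  have hz := self_sub_toIocMod (add_pos (hℓ (k + 1)) (hm (k + 1))) (-ℓ (k + 1)) c
  have hmem := toIocMod_mem_Ioc (add_pos (hℓ (k + 1)) (hm (k + 1))) (-ℓ (k + 1)) c
  rw [zsmul_eq_mul] at hz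
  obtain ⟨h1, h2⟩ := h k hk (toIocDiv (add_pos (hℓ (k + 1)) (hm (k + 1))) (-ℓ (k + 1)) c)
  rw [← hc] at h1
  push_cast at h2 hc
  refine ⟨hmem.1, lt_of_le_of_ne (by linarith [hmem.2]) fun h3 => h2 ?_, fun h3 => h1 ?_⟩
  · rw [h3] at hz; rw [← hz, hc]; ring
  · rw [h3] at hz; linarith

end

lemma ne_mul_of_abs_lt {L c : ℝ} (h0 : c ≠ 0) (hc : |c| < L) (z : ℤ) : c ≠ z * L := fun h => by
  rw [eq_zero_of_mul_of_abs_lt h hc] at h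
  simp at h
  exact h0 h

lemma eventually_ne_mul {L : ℝ} (hL : 0 < L) (c : ℝ) :
    ∀ᶠ ε in 𝓝[>] (0 : ℝ), ∀ z : ℤ, c + ε ≠ z * L := by
  have h0 := Int.floor_le (c / L)
  have h1 := Int.lt_floor_add_one (c / L)
  rw [le_div_iff₀ hL] at h0
  rw [div_lt_iff₀ hL] at h1
  have e1 : ∀ᶠ ε in 𝓝[>] (0 : ℝ), ε < (⌊c / L⌋ + 1) * L - c :=
    nhdsWithin_le_nhds (Iio_mem_nhds (by linarith))
  filter_upwards [e1, self_mem_nhdsWithin] with ε h2 h3 z hz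
  have h3 : 0 < ε := h3
  have h4 : (c + ε - ⌊c / L⌋ * L) = ((z - ⌊c / L⌋ : ℤ) : ℝ) * L := by
    push_cast; rw [hz]; ring
  exact ne_mul_of_abs_lt (by linarith) (abs_lt.2 ⟨by linarith, by linarith⟩) _ h4

/-- The number `-(μ * c)` lies strictly between `-L` and `0`. It is applied with `μ` the length of a
bottom edge and `L` that of its loop. -/
lemma neg_mul_ne_mul {L μ : ℝ} {N c : ℕ} (hμ : 0 < μ) (hL : N * μ < L) (h0 : 0 < c) (hc : c ≤ N)
    (z : ℤ) : -(μ * c) ≠ z * L := by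
  have h1 : (0 : ℝ) < c := by exact_mod_cast h0
  have h2 : (c : ℝ) ≤ N := by exact_mod_cast hc
  refine ne_mul_of_abs_lt (by have := mul_pos hμ h1; linarith) ?_ z
  rw [abs_neg, abs_of_pos (mul_pos hμ h1)]
  nlinarith

/-- After a small movement of the chips on the loops without missing chips, the chips of
`transferChips` are in the interior of the edges. -/
lemma eventually_validChips_transferChips {g r s N : ℕ} {ℓ m : ℕ → ℝ} (hℓ : ∀ k, 0 < ℓ k)
    (hm : ∀ k, 0 < m k) (hN : s + 1 + r + g ≤ N)
    (hlen : ∀ k < g, N * m (k + 1) < ℓ (k + 1) + m (k + 1)) {x : ℕ → ℕ → Option ℝ}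
    (hx : ∀ i ≤ r, ValidChips g ℓ m (x i)) {μ : ℕ → ℝ}
    (hμ : ∀ i ≤ r, ∀ k < g, ∃ z : ℤ, (x i k).getD 0 - m (k + 1) * (chipsLT i (x i) (k + 1) : ℤ) -
      μ k = z * (ℓ (k + 1) + m (k + 1)))
    (htot : chipsLT 0 (x 0) g = g - s) :
    ∀ᶠ ε in 𝓝[>] (0 : ℝ), ValidChips g ℓ m (transferChips hℓ hm (s + 1)
      (shiftChips (fun k => ∀ i ≤ r, (x i k).isSome) ε (x 0))) := by
  set S : ℕ → Prop := fun k => ∀ i ≤ r, (x i k).isSome with hS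
  have key : ∀ k ∈ Finset.range g, ∀ᶠ ε in 𝓝[>] (0 : ℝ), ∀ z : ℤ,
      (shiftChips S ε (x 0) k).getD (m (k + 1)) -
        m (k + 1) * (chipsLT (s + 1) (x 0) k - k : ℤ) ≠ z * (ℓ (k + 1) + m (k + 1)) ∧
      (shiftChips S ε (x 0) k).getD (m (k + 1)) -
        m (k + 1) * (chipsLT (s + 1) (x 0) k - k + 1 : ℤ) ≠ z * (ℓ (k + 1) + m (k + 1)) := by
    intro k hk
    have hk := Finset.mem_range.1 hk
    have hL : 0 < ℓ (k + 1) + m (k + 1) := add_pos (hℓ _) (hm _)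
    have hc1 := chipsLT_le_add (s + 1) (x 0) hk.le
    have hc2 := chipsLT_le_add (s + 1) (x 0) (Nat.zero_le k)
    have hc3 := chipsLT_le_add (s + 1) (x 0) (show k + 1 ≤ g from hk)
    have hc4 := chipsLT_succ (s + 1) (x 0) k
    have htot' : chipsLT (s + 1) (x 0) g = s + 1 + (g - s) := by
      have := chipsLT_add (s + 1) 0 (x 0) g
      rwa [add_zero, htot] at this
    rw [htot'] at hc1 hc3
    rw [chipsLT_zero] at hc2
    push_cast at hc1 hc2 hc3
    -- `A` is the number of chips in transit when they reach the loop. It starts at `s + 1`, drops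
    -- by one at each loop without a chip, and ends at `1` since `s` loops lack a chip.
    obtain ⟨A, hA⟩ : ∃ A : ℕ, (A : ℤ) = chipsLT (s + 1) (x 0) k - k :=
      ⟨_, Int.toNat_of_nonneg (by linarith)⟩
    rw [← hA]
    have hA1 : 1 ≤ A := by zify; linarith
    have hA2 : A ≤ s + 1 := by zify; linarith
    rcases hx0 : x 0 k with _ | u
    · refine Filter.Eventually.of_forall fun ε z => ?_
      have hsh : shiftChips S ε (x 0) k = none := by rw [shiftChips]; split_ifs <;> simp [hx0]
      -- One chip is left behind on this loop and at least one still goes on, so the new position,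
      -- `-(A - 1) * m (k + 1)`, is not congruent to `0`.
      have hA3 : 2 ≤ A := by
        rw [hx0] at hc4
        simp at hc4
        zify; linarith
      obtain ⟨A', rfl⟩ : ∃ A', A = A' + 1 := ⟨A - 1, by omega⟩
      rw [hsh, Option.getD_none]
      constructor
      · have := neg_mul_ne_mul (hm (k + 1)) (hlen k hk) (c := A') (by omega) (by omega) z
        intro h; apply this; rw [← h]; push_cast; ring
      · have := neg_mul_ne_mul (hm (k + 1)) (hlen k hk) (c := A' + 1) (by omega) (by omega) z
        intro h; apply this; rw [← h]; push_cast; ring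
    · by_cases hSk : S k
      · have e1 := eventually_ne_mul hL (u - m (k + 1) * A)
        have e2 := eventually_ne_mul hL (u - m (k + 1) * (A + 1))
        filter_upwards [e1, e2] with ε h1 h2 z
        have hsh : shiftChips S ε (x 0) k = some (u + ε) := by rw [shiftChips, if_pos hSk, hx0]; rfl
        rw [hsh, Option.getD_some]
        constructor
        · intro h; apply h1 z; rw [← h]; push_cast; ring
        · intro h; apply h2 z; rw [← h]; push_cast; ring
      · refine Filter.Eventually.of_forall fun ε z => ?_
        have hsh : shiftChips S ε (x 0) k = some u := by rw [shiftChips, if_neg hSk, hx0]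
        rw [hsh, Option.getD_some]
        -- This loop is not shifted, but some `D_i` has no chip on it, so the moment of the class is
        -- an integral multiple of `m (k + 1)` modulo the length. Then `u` is congruent to `-b * m
        -- (k + 1)` and the new chip to `-(A + b) * m (k + 1)`. With `A ≤ s + 1` and `b + 1 ≤ r +
        -- g`, the coefficients stay at most `s + 1 + r + g`, whence the bound on `N`.
        obtain ⟨i, hi, hxi⟩ : ∃ i ≤ r, x i k = none := by
          by_contra! hne
          exact hSk fun i hi => Option.isSome_iff_ne_none.2 (hne i hi)
        have hi0 : i ≠ 0 := by rintro rfl; rw [hx0] at hxi; exact Option.some_ne_none _ hxi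
        obtain ⟨i, rfl⟩ := Nat.exists_eq_succ_of_ne_zero hi0
        have h3 := (chipsLT_add_lt hx hℓ hm hμ hi k hk.le).2 hk hxi
        have h4 := chipsLT_add_le hx hℓ hm hμ (Nat.zero_le i) (by omega) hk.le
        have h5 := chipsLT_le_add (i.succ : ℕ) (x i.succ) (Nat.zero_le k)
        have h6 := chipsLT_mono (0 : ℕ) (x 0) (Nat.zero_le k)
        rw [chipsLT_zero] at h5 h6
        push_cast at h3 h4 h5 h6
        obtain ⟨b, hb⟩ : ∃ b : ℕ, (b : ℤ) =
            chipsLT (i.succ : ℕ) (x i.succ) k - chipsLT (0 : ℕ) (x 0) k - 1 :=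
          ⟨_, Int.toNat_of_nonneg (by push_cast; linarith)⟩
        have hb2 : b + 1 ≤ r + g := by
          zify
          push_cast at hb
          have : (i : ℤ) + 1 ≤ r := by exact_mod_cast hi
          have : (k : ℤ) + 1 ≤ g := by exact_mod_cast hk
          linarith
        obtain ⟨z₀, hz₀⟩ := hμ 0 (Nat.zero_le r) k hk
        obtain ⟨z₁, hz₁⟩ := hμ _ hi k hk
        rw [chipsLT_succ, hx0] at hz₀
        rw [chipsLT_succ, hxi] at hz₁
        have hb' : (b : ℝ) = (chipsLT (i.succ : ℕ) (x i.succ) k : ℤ) -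
          (chipsLT (0 : ℕ) (x 0) k : ℤ) - 1 := by exact_mod_cast hb
        simp only [Option.getD_some, Option.isSome_some, if_true, Option.getD_none,
          Option.isSome_none, Bool.false_eq_true, if_false, add_zero] at hz₀ hz₁
        push_cast at hz₀ hz₁ hb'
        have hu : u = -(m (k + 1) * b) + (z₀ - z₁) * (ℓ (k + 1) + m (k + 1)) := by
          rw [hb']; linarith
        constructor
        · have := neg_mul_ne_mul (hm (k + 1)) (hlen k hk) (c := A + b) (by omega) (by omega)
            (z - (z₀ - z₁))
          intro h; apply this; push_cast at h ⊢; linarith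
        · have := neg_mul_ne_mul (hm (k + 1)) (hlen k hk) (c := A + b + 1) (by omega) (by omega)
            (z - (z₀ - z₁))
          intro h; apply this; push_cast at h ⊢; linarith
  filter_upwards [(Filter.eventually_all_finset _).2 key] with ε hε
  refine validChips_transferChips hℓ hm fun k hk z => ?_
  rw [chipsLT_shiftChips]
  exact hε k (Finset.mem_range.2 hk) z

end Chips

lemma MetricGraph.LinEquiv.add_right {V E : Type} [Fintype E] {Γ : MetricGraph V E}
    {D F D' : Γ.Divisor} (h : Γ.LinEquiv (D - F) D') : Γ.LinEquiv D (D' + F) := by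
  obtain ⟨f, hf, hD⟩ := h
  refine ⟨f, hf, fun p => ?_⟩
  have := hD p
  rw [Finsupp.sub_apply] at this
  rw [Finsupp.add_apply]
  push_cast at this ⊢
  linarith

/-! ### Vertex avoiding classes in terms of standard divisors -/

section VertexAvoiding

variable {g : ℕ} {ℓ m n : ℕ → ℝ} {hℓ : ∀ k, 0 < ℓ k} {hm : ∀ k, 0 < m k} {hn : ∀ k, 0 < n k}

local notation "𝒞" => chainOfLoops g ℓ m n hℓ hm hn

lemma stdDiv_linEquiv {a a' b b' : ℤ} {x x' : ℕ → Option ℝ} (hx : ValidChips g ℓ m x)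
    (hx' : ValidChips g ℓ m x') (hdeg : chipsLT a' x' g + b' = chipsLT a x g + b)
    (h : ∀ k < g, ∃ z : ℤ, ((x' k).getD 0 - m (k + 1) * (chipsLT a' x' (k + 1) : ℤ)) -
      ((x k).getD 0 - m (k + 1) * (chipsLT a x (k + 1) : ℤ)) = z * (ℓ (k + 1) + m (k + 1))) :
    MetricGraph.LinEquiv 𝒞 (stdDiv 𝒞 a x b) (stdDiv 𝒞 a' x' b') := by
  refine chain_linEquiv_iff.2 ⟨by rw [deg_stdDiv, deg_stdDiv, hdeg], fun k => ?_⟩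
  rw [moment_stdDiv hx, moment_stdDiv hx']
  exact h k k.2

variable {r : ℕ} {x : ℕ → ℕ → Option ℝ}

theorem vertexAvoiding_of_stdDiv {D : MetricGraph.Divisor 𝒞} (hx : ∀ i ≤ r, ValidChips g ℓ m (x i))
    (hD : ∀ i ≤ r, MetricGraph.LinEquiv 𝒞 D (stdDiv 𝒞 i (x i) (r - i))) :
    VertexAvoiding 𝒞 D r := by
  intro i hi
  refine ⟨stdDiv 𝒞 i (x i) (r - i), ⟨hD i hi, stdDiv_nonneg (by positivity) (by omega),
    stdDiv_leftEnd (hx i hi), stdDiv_rightEnd (hx i hi),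
    fun k => ⟨stdDiv_v (hx i hi) k, stdDiv_w (hx i hi) k⟩⟩, ?_⟩
  intro F hF hF0 h1 h2
  exact stdDiv_unique (hx i hi) ((hD i hi).symm.trans hF) hF0 h1 h2

/-- If the rank exceeded `r`, some effective divisor of the class would have `r + 1` chips at the
right end; by uniqueness it would be `D_0`, which has exactly `r` there. -/
theorem hasRank_of_stdDiv {D : MetricGraph.Divisor 𝒞} (hx : ∀ i ≤ r, ValidChips g ℓ m (x i))
    (hD : ∀ i ≤ r, MetricGraph.LinEquiv 𝒞 D (stdDiv 𝒞 i (x i) (r - i))) :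
    MetricGraph.HasRank 𝒞 D r := by
  refine ⟨rankGE_of_stdDiv hx hD, fun h => ?_⟩
  have hFn : (0 : MetricGraph.Divisor 𝒞) ≤ Finsupp.single (rightEnd 𝒞) ((r : ℤ) + 1) :=
    Finsupp.single_nonneg.2 (by positivity)
  obtain ⟨D', hD', hlin⟩ := h (Finsupp.single (rightEnd 𝒞) (r + 1)) hFn (by simp [deg_eq_pair])
  have hpos : (r : ℤ) + 1 ≤ (D' + Finsupp.single (rightEnd 𝒞) ((r : ℤ) + 1)) (rightEnd 𝒞) := by
    rw [Finsupp.add_apply, Finsupp.single_eq_same]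
    have : 0 ≤ D' (rightEnd 𝒞) := hD' _
    linarith
  have key := stdDiv_unique (hx 0 (Nat.zero_le r)) ((hD 0 (Nat.zero_le r)).symm.trans hlin.add_right)
    (add_nonneg hD' hFn) ((add_nonneg hD' hFn) _)
    (le_trans (by push_cast; linarith) hpos)
  rw [key, stdDiv_rightEnd (hx 0 (Nat.zero_le r))] at hpos
  push_cast at hpos
  linarith

/-- The uniqueness built into vertex avoidance forbids chips on bridges and second chips on loops,
since such chips could be moved. -/
theorem VertexAvoiding.exists_stdDiv {D : MetricGraph.Divisor 𝒞} (h : VertexAvoiding 𝒞 D r) :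
    ∃ x : ℕ → ℕ → Option ℝ, (∀ i ≤ r, ValidChips g ℓ m (x i)) ∧
      ∀ i ≤ r, MetricGraph.LinEquiv 𝒞 D (stdDiv 𝒞 i (x i) (r - i)) := by
  have : ∀ i, ∃ y : ℕ → Option ℝ, i ≤ r → ValidChips g ℓ m y ∧
      MetricGraph.LinEquiv 𝒞 D (stdDiv 𝒞 i y (r - i)) := by
    intro i
    by_cases hi : i ≤ r
    · obtain ⟨D', ⟨h1, h2, h3, h4, h5⟩, h6⟩ := h i hi
      obtain ⟨y, hy, hDy⟩ := exists_eq_stdDiv_of_unique h2 (fun k => (h5 k).1) (fun k => (h5 k).2)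
        (fun G hG hG0 hl hr => h6 G (h1.trans hG) hG0 (h3 ▸ hl) (h4 ▸ hr))
      rw [h3, h4] at hDy
      exact ⟨y, fun _ => ⟨hy, hDy ▸ h1⟩⟩
    · exact ⟨fun _ => none, fun h => absurd h hi⟩
  choose x hx using this
  exact ⟨x, fun i hi => (hx i hi).1, fun i hi => (hx i hi).2⟩

/-- A distinguished function is only required to reach some effective divisor with the right end
degrees; uniqueness identifies that divisor. -/
lemma IsDistinguished.carries_stdDiv {D : MetricGraph.Divisor 𝒞} (hx : ∀ i ≤ r, ValidChips g ℓ m (x i))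
    (hD : ∀ i ≤ r, MetricGraph.LinEquiv 𝒞 D (stdDiv 𝒞 i (x i) (r - i)))
    {ψ : Fin (r + 1) → MetricGraph.Point 𝒞 → ℝ} (hψ : IsDistinguished 𝒞 D r ψ) (i : Fin (r + 1)) :
    MetricGraph.Carries 𝒞 (ψ i) D (stdDiv 𝒞 (i : ℕ) (x i) (r - (i : ℕ))) := by
  have hi : (i : ℕ) ≤ r := by omega
  obtain ⟨D', h1, h2, h3, h4⟩ := hψ i
  exact stdDiv_unique (hx i hi) ((hD i hi).symm.trans ⟨_, h4⟩) h1 h2.ge h3.ge ▸ h4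

end VertexAvoiding

/-! ### Explicit functions between standard divisors -/

section Formula

/-- The initial slope on the bottom edge of a loop of a function that moves the chip `o` to `o'`,
where `c` is the increase of the number of chips on the left. -/
def loopSlope (l k : ℝ) (o o' : Option ℝ) (c : ℤ) : ℝ :=
  ((bottomHinge o' k - bottomHinge o k) - (topHinge o' l - topHinge o l) - c * l) / (l + k)

variable {g : ℕ} {ℓ m n : ℕ → ℝ} {hℓ : ∀ k, 0 < ℓ k} {hm : ∀ k, 0 < m k} {hn : ∀ k, 0 < n k}

local notation "𝒞" => chainOfLoops g ℓ m n hℓ hm hn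

/-- The functions that carry a standard divisor to another one are determined by the positions of
the chips. -/
theorem carries_stdDiv_formula {a a' b b' : ℤ} {x x' : ℕ → Option ℝ} (hx : ValidChips g ℓ m x)
    (hx' : ValidChips g ℓ m x') {f : MetricGraph.Point 𝒞 → ℝ}
    (hf : MetricGraph.Carries 𝒞 f (stdDiv 𝒞 a x b) (stdDiv 𝒞 a' x' b')) :
    (∀ k : Fin (g + 1), ∀ t, 0 ≤ t → t ≤ n k → f (MetricGraph.pt 𝒞 (.bridge k) t) =
      f (.vertex (.w k)) + (chipsLT a x k - chipsLT a' x' k : ℤ) * t) ∧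
    (∀ k : Fin g, ∀ t, 0 ≤ t → t ≤ m (k + 1) → f (MetricGraph.pt 𝒞 (.bottom k) t) =
      f (.vertex (.v k.castSucc)) + loopSlope (ℓ (k + 1)) (m (k + 1)) (x k) (x' k)
        (chipsLT a' x' k - chipsLT a x k) * t - (bottomHinge (x' k) t - bottomHinge (x k) t)) ∧
    (∀ k : Fin g, ∀ t, 0 ≤ t → t ≤ ℓ (k + 1) → f (MetricGraph.pt 𝒞 (.top k) t) =
      f (.vertex (.v k.castSucc)) + ((chipsLT a x k - chipsLT a' x' k : ℤ) -
        loopSlope (ℓ (k + 1)) (m (k + 1)) (x k) (x' k)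
        (chipsLT a' x' k - chipsLT a x k)) * t - (topHinge (x' k) t - topHinge (x k) t)) := by
  obtain ⟨σ, h1, h2, h3, -⟩ := chain_carries_iff.1 hf
  have hdl : ∀ k ≤ g, ∀ j, 4 * k ≤ j → j ≤ 4 * k + 3 → 1 ≤ j → j ≤ 4 * g + 2 →
      - degLT j (stdDiv 𝒞 a' x' b' - stdDiv 𝒞 a x b) = chipsLT a x k - chipsLT a' x' k := by
    intro k hk j h4 h5 h6 h7
    rw [map_sub, degLT_stdDiv hx hk h4 h5 h6 h7, degLT_stdDiv hx' hk h4 h5 h6 h7]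
    ring
  -- The two edges must give the same value at the right vertex, and the sum of their initial slopes
  -- is known; this determines both slopes. The result involves only the chips on this loop and the
  -- difference of the counts, so it can be compared between different chains.
  have hσb : ∀ k : Fin g, (σ (.bottom k) : ℝ) = loopSlope (ℓ (k + 1)) (m (k + 1)) (x k) (x' k)
      (chipsLT a' x' k - chipsLT a x k) := by
    intro k
    have ht := h1 (.top k) (ℓ (k + 1)) (hℓ _).le le_rfl
    have hb := h1 (.bottom k) (m (k + 1)) (hm _).le le_rfl
    have e1 : MetricGraph.pt 𝒞 (.top k) (ℓ (k + 1)) = .vertex (.w k.succ) :=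
      pt_len (Γ := 𝒞) (.top k)
    have e2 : MetricGraph.pt 𝒞 (.bottom k) (m (k + 1)) = .vertex (.w k.succ) :=
      pt_len (Γ := 𝒞) (.bottom k)
    have e3 : MetricGraph.src 𝒞 (.top k) = .v k.castSucc := rfl
    have e4 : MetricGraph.src 𝒞 (.bottom k) = .v k.castSucc := rfl
    rw [e1, e3, map_sub, pair_hinge_top hx, pair_hinge_top hx'] at ht
    rw [e2, e4, map_sub, pair_hinge_bottom hx, pair_hinge_bottom hx'] at hb
    have hs := h3 k
    rw [hdl k k.2.le _ (by omega) (by omega) (by omega) (by omega)] at hs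
    have hs' : (σ (.top k) : ℝ) = (chipsLT a x k : ℤ) - (chipsLT a' x' k : ℤ) - σ (.bottom k) := by
      have : σ (.top k) = chipsLT a x k - chipsLT a' x' k - σ (.bottom k) := by linarith
      rw [this]; push_cast; ring
    rw [hs'] at ht
    have hL : 0 < ℓ (k + 1) + m (k + 1) := add_pos (hℓ _) (hm _)
    rw [loopSlope, eq_div_iff hL.ne']
    push_cast
    linarith
  refine ⟨fun k t h0 ht => ?_, fun k t h0 ht => ?_, fun k t h0 ht => ?_⟩
  · rw [h1 (.bridge k) t h0 ht, map_sub, pair_hinge_bridge hx, pair_hinge_bridge hx', h2,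
      hdl k (by omega) _ (by omega) (by omega) (by omega) (by omega)]
    simp [chainOfLoops]
  · rw [h1 (.bottom k) t h0 ht, map_sub, pair_hinge_bottom hx, pair_hinge_bottom hx', hσb]
    rfl
  · have hs := h3 k
    rw [hdl k k.2.le _ (by omega) (by omega) (by omega) (by omega)] at hs
    have hs' : (σ (.top k) : ℝ) = (chipsLT a x k - chipsLT a' x' k : ℤ) - σ (.bottom k) := by
      rw [← hs]; push_cast; ring
    rw [h1 (.top k) t h0 ht, map_sub, pair_hinge_top hx, pair_hinge_top hx', hs', hσb]
    rfl

lemma exists_eq_pt (p : MetricGraph.Point 𝒞) :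
    ∃ e t, 0 ≤ t ∧ t ≤ MetricGraph.len 𝒞 e ∧ p = MetricGraph.pt 𝒞 e t := by
  rcases p with (k | k) | ⟨e, t, h⟩
  · exact ⟨.bridge k, 0, le_rfl, (MetricGraph.len_pos 𝒞 _).le, (pt_zero (Γ := 𝒞) (.bridge k)).symm⟩
  · exact ⟨.bridge k, _, (MetricGraph.len_pos 𝒞 _).le, le_rfl, (pt_len (Γ := 𝒞) (.bridge k)).symm⟩
  · exact ⟨e, t, h.1.le, h.2.le, (pt_inner h).symm⟩

/-- Piecewise linear functions are bounded. -/
lemma MetricGraph.Carries.bounded {f : MetricGraph.Point 𝒞 → ℝ} {D D' : MetricGraph.Divisor 𝒞}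
    (hf : MetricGraph.Carries 𝒞 f D D') : ∃ M, ∀ p, |f p| ≤ M := by
  obtain ⟨σ, h1, -⟩ := chain_carries_iff.1 hf
  have : ∀ e : ChainEdge g, ∃ M, ∀ t ∈ Set.Icc 0 (MetricGraph.len 𝒞 e),
      |f (.vertex (MetricGraph.src 𝒞 e)) + σ e * t - pair (hinge e t) (D' - D)| ≤ M := by
    intro e
    have hc : Continuous fun t => f (.vertex (MetricGraph.src 𝒞 e)) + σ e * t -
        pair (hinge e t) (D' - D) :=
      (by fun_prop : Continuous fun t : ℝ => f (.vertex (MetricGraph.src 𝒞 e)) + σ e * t).sub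
        (continuous_pair_hinge e (D' - D))
    exact isCompact_Icc.exists_bound_of_continuousOn hc.continuousOn
  choose M hM using this
  refine ⟨∑ e, |M e|, fun p => ?_⟩
  obtain ⟨e, t, h0, ht, rfl⟩ := exists_eq_pt p
  rw [h1 e t h0 ht]
  exact ((hM e t ⟨h0, ht⟩).trans (le_abs_self _)).trans
    (Finset.single_le_sum (f := fun e => |M e|) (fun _ _ => abs_nonneg _) (Finset.mem_univ e))

end Formula

/-! ### Restriction of functions from the extended chain to the old one -/

section Extension

variable {g s : ℕ} {ℓ m n ℓ' m' n' : ℕ → ℝ} {hℓ : ∀ k, 0 < ℓ k} {hm : ∀ k, 0 < m k}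
  {hn : ∀ k, 0 < n k} {hℓ' : ∀ k, 0 < ℓ' k} {hm' : ∀ k, 0 < m' k} {hn' : ∀ k, 0 < n' k} {N : ℝ}

local notation "𝒞" => chainOfLoops g ℓ m n hℓ hm hn

local notation "𝒞'" => chainOfLoops (g + s) ℓ' m' n' hℓ' hm' hn'

/-- The embedding of a chain of `g` loops into the chain obtained by putting `s` further loops in
front, and extending the first bridge by `N`. -/
def chainEmbedding (N : ℝ) : MetricGraph.Point 𝒞 → MetricGraph.Point 𝒞'
  | .vertex (.w k) => if k = 0 then MetricGraph.pt _ (.bridge ⟨s, by omega⟩) N else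
      .vertex (.w ⟨k + s, by omega⟩)
  | .vertex (.v k) => .vertex (.v ⟨k + s, by omega⟩)
  | .inner (.bridge k) t _ => if k = 0 then MetricGraph.pt _ (.bridge ⟨s, by omega⟩) (N + t) else
      MetricGraph.pt _ (.bridge ⟨k + s, by omega⟩) t
  | .inner (.top k) t _ => MetricGraph.pt _ (.top ⟨k + s, by omega⟩) t
  | .inner (.bottom k) t _ => MetricGraph.pt _ (.bottom ⟨k + s, by omega⟩) t

local notation "𝒿" => (chainEmbedding N : MetricGraph.Point 𝒞 → MetricGraph.Point 𝒞')

/-- A function on the extended chain restricts, up to a constant, to the function on the chain that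
moves the chips in the same way. -/
theorem chainEmbedding_spec (hN : 0 ≤ N) (hns : n' s = N + n 0)
    (hnk : ∀ k, 1 ≤ k → n' (k + s) = n k) (hℓs : ∀ k, ℓ' (k + s) = ℓ k)
    (hms : ∀ k, m' (k + s) = m k) {a₁ b₁ a₂ b₂ c₁ d₁ c₂ d₂ : ℤ} {x₁ x₂ X₁ X₂ : ℕ → Option ℝ}
    (hx₁ : ValidChips g ℓ m x₁) (hx₂ : ValidChips g ℓ m x₂)
    (hX₁ : ValidChips (g + s) ℓ' m' X₁) (hX₂ : ValidChips (g + s) ℓ' m' X₂)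
    (h₁ : ∀ k < g, X₁ (k + s) = x₁ k) (h₂ : ∀ k < g, X₂ (k + s) = x₂ k)
    (hc : chipsLT c₁ X₁ s - chipsLT c₂ X₂ s = a₁ - a₂) {f : MetricGraph.Point 𝒞 → ℝ}
    (hf : MetricGraph.Carries 𝒞 f (stdDiv 𝒞 a₁ x₁ b₁) (stdDiv 𝒞 a₂ x₂ b₂))
    {F : MetricGraph.Point 𝒞' → ℝ}
    (hF : MetricGraph.Carries 𝒞' F (stdDiv 𝒞' c₁ X₁ d₁) (stdDiv 𝒞' c₂ X₂ d₂)) :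
    ∃ c, ∀ p, F (chainEmbedding N p) = f p + c := by
  obtain ⟨fb, fl, fu⟩ := carries_stdDiv_formula hx₁ hx₂ hf
  obtain ⟨Fb, Fl, Fu⟩ := carries_stdDiv_formula hX₁ hX₂ hF
  -- All slopes depend only on the chips and on the differences of counts. The latter agree at the
  -- entrance by `hc`, and then on every old loop as the chips coincide; the increments of `f` and
  -- `F` therefore match edge by edge.
  have hcc : ∀ k ≤ g, chipsLT c₁ X₁ (k + s) - chipsLT c₂ X₂ (k + s) =
      chipsLT a₁ x₁ k - chipsLT a₂ x₂ k := by
    intro k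
    induction k with
    | zero => intro _; rw [zero_add, chipsLT_zero, chipsLT_zero, hc]
    | succ k ih =>
      intro hk
      have := ih (by omega)
      rw [show k + 1 + s = k + s + 1 by ring, chipsLT_succ, chipsLT_succ, chipsLT_succ,
        chipsLT_succ, h₁ k hk, h₂ k hk]
      linarith
  have hcc' : ∀ k ≤ g, chipsLT c₂ X₂ (k + s) - chipsLT c₁ X₁ (k + s) =
      chipsLT a₂ x₂ k - chipsLT a₁ x₁ k := fun k hk => by linarith [hcc k hk]
  have hks : ∀ k, k + 1 + s = k + s + 1 := fun k => by ring
  have hb0 : ∀ t, 0 ≤ t → t ≤ n 0 → F (MetricGraph.pt 𝒞' (.bridge ⟨s, by omega⟩) (N + t)) =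
      F (𝒿 (.vertex (.w 0))) + (chipsLT a₁ x₁ 0 - chipsLT a₂ x₂ 0 : ℤ) * t := by
    intro t h0 ht
    have e1 := Fb ⟨s, by omega⟩ (N + t) (by linarith) (by rw [hns]; linarith)
    have e2 := Fb ⟨s, by omega⟩ N hN (by rw [hns]; linarith [hn 0])
    have e3 : 𝒿 (.vertex (.w 0)) = MetricGraph.pt 𝒞' (.bridge ⟨s, by omega⟩) N := by
      simp [chainEmbedding]
    have e4 := hcc 0 (Nat.zero_le g)
    rw [zero_add] at e4
    rw [e3, e1, e2, ← e4]
    simp only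
    ring
  have hbk : ∀ (k : Fin (g + 1)), k ≠ 0 → ∀ t, 0 ≤ t → t ≤ n k →
      F (MetricGraph.pt 𝒞' (.bridge ⟨k + s, by omega⟩) t) =
      F (𝒿 (.vertex (.w k))) + (chipsLT a₁ x₁ k - chipsLT a₂ x₂ k : ℤ) * t := by
    intro k hk t h0 ht
    have hk1 : 1 ≤ (k : ℕ) := Nat.one_le_iff_ne_zero.2 fun h => hk (Fin.ext h)
    have e1 := Fb ⟨k + s, by omega⟩ t h0 (by rw [hnk k hk1]; exact ht)
    have e3 : 𝒿 (.vertex (.w k)) = .vertex (.w ⟨k + s, by omega⟩) := by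
      simp [chainEmbedding, hk]
    rw [e3, e1, hcc k (by omega)]
  have hlo : ∀ (k : Fin g) t, 0 ≤ t → t ≤ m (k + 1) →
      F (MetricGraph.pt 𝒞' (.bottom ⟨k + s, by omega⟩) t) - F (𝒿 (.vertex (.v k.castSucc))) =
      f (MetricGraph.pt 𝒞 (.bottom k) t) - f (.vertex (.v k.castSucc)) := by
    intro k t h0 ht
    have e1 := Fl ⟨k + s, by omega⟩ t h0 (by rwa [← hms, hks] at ht)
    have e2 := fl k t h0 ht
    have e3 : 𝒿 (.vertex (.v k.castSucc)) =
      .vertex (.v (Fin.castSucc (⟨k + s, by omega⟩ : Fin (g + s)))) := rfl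
    simp only [h₁ k k.2, h₂ k k.2, hcc' k k.2.le, ← hks, hms, hℓs] at e1
    rw [e3, e1, e2]
    ring
  have hup : ∀ (k : Fin g) t, 0 ≤ t → t ≤ ℓ (k + 1) →
      F (MetricGraph.pt 𝒞' (.top ⟨k + s, by omega⟩) t) - F (𝒿 (.vertex (.v k.castSucc))) =
      f (MetricGraph.pt 𝒞 (.top k) t) - f (.vertex (.v k.castSucc)) := by
    intro k t h0 ht
    have e1 := Fu ⟨k + s, by omega⟩ t h0 (by rwa [← hℓs, hks] at ht)
    have e2 := fu k t h0 ht
    have e3 : 𝒿 (.vertex (.v k.castSucc)) =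
      .vertex (.v (Fin.castSucc (⟨k + s, by omega⟩ : Fin (g + s)))) := rfl
    simp only [h₁ k k.2, h₂ k k.2, hcc' k k.2.le, hcc k k.2.le, ← hks, hms, hℓs] at e1
    rw [e3, e1, e2]
    ring
  have hv_of_w : ∀ k : Fin (g + 1), F (𝒿 (.vertex (.v k))) - f (.vertex (.v k)) =
      F (𝒿 (.vertex (.w k))) - f (.vertex (.w k)) := by
    intro k
    have e1 : MetricGraph.pt 𝒞 (.bridge k) (n k) = .vertex (.v k) := pt_len (Γ := 𝒞) (.bridge k)
    have e2 : MetricGraph.pt 𝒞' (.bridge ⟨k + s, by omega⟩) (n' (k + s)) = 𝒿 (.vertex (.v k)) :=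
      pt_len (Γ := 𝒞') (.bridge ⟨k + s, by omega⟩)
    have e3 := fb k (n k) (hn k).le le_rfl
    by_cases hk : k = 0
    · subst hk
      have e4 := hb0 (n 0) (hn 0).le le_rfl
      rw [← hns] at e4
      simp only [Fin.val_zero, zero_add] at e1 e2 e3
      rw [e2] at e4
      rw [e1] at e3
      linarith
    · have hk1 : 1 ≤ (k : ℕ) := Nat.one_le_iff_ne_zero.2 fun h => hk (Fin.ext h)
      have e4 := hbk k hk (n k) (hn k).le le_rfl
      rw [← hnk k hk1, e2, hnk k hk1] at e4
      rw [e1] at e3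
      linarith
  have hw : ∀ k : Fin (g + 1), F (𝒿 (.vertex (.w k))) - f (.vertex (.w k)) =
      F (𝒿 (.vertex (.w 0))) - f (.vertex (.w 0)) := by
    intro k
    induction k using Fin.induction with
    | zero => rfl
    | succ k ih =>
      have e1 : MetricGraph.pt 𝒞 (.bottom k) (m (k + 1)) = .vertex (.w k.succ) :=
        pt_len (Γ := 𝒞) (.bottom k)
      have e2 : MetricGraph.pt 𝒞' (.bottom ⟨k + s, by omega⟩) (m (k + 1)) = 𝒿 (.vertex (.w k.succ)) := by
        have := pt_len (Γ := 𝒞') (.bottom ⟨k + s, by omega⟩)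
        have e3 : 𝒿 (.vertex (.w k.succ)) =
            .vertex (.w (Fin.succ (⟨k + s, by omega⟩ : Fin (g + s)))) := by
          simp only [chainEmbedding, Fin.succ_ne_zero, if_false, Fin.val_succ]
          congr 2
          ext; simp; omega
        rw [e3, ← hms, hks]; exact this
      have e4 := hlo k _ (hm _).le le_rfl
      rw [e1, e2] at e4
      linarith [hv_of_w k.castSucc]
  refine ⟨F (𝒿 (.vertex (.w 0))) - f (.vertex (.w 0)), fun p => ?_⟩
  rcases p with (k | k) | ⟨k | k | k, t, ht⟩
  · linarith [hw k]
  · linarith [hw k, hv_of_w k]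
  · have e1 := fb k t ht.1.le ht.2.le
    rw [pt_inner (Γ := 𝒞) ht] at e1
    by_cases hk : k = 0
    · subst hk
      have e2 := hb0 t ht.1.le ht.2.le
      have e3 : 𝒿 (.inner (.bridge 0) t ht) = MetricGraph.pt 𝒞' (.bridge ⟨s, by omega⟩) (N + t) := by
        simp [chainEmbedding]
      rw [e3, e1, e2]
      simp only [Fin.val_zero]
      ring
    · have e2 := hbk k hk t ht.1.le ht.2.le
      have e3 : 𝒿 (.inner (.bridge k) t ht) = MetricGraph.pt 𝒞' (.bridge ⟨k + s, by omega⟩) t := by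
        simp [chainEmbedding, hk]
      rw [e3, e1, e2]
      linarith [hw k]
  · have e2 := hup k t ht.1.le ht.2.le
    rw [pt_inner (Γ := 𝒞) ht] at e2
    have e3 : 𝒿 (.inner (.top k) t ht) = MetricGraph.pt 𝒞' (.top ⟨k + s, by omega⟩) t := rfl
    rw [e3]
    linarith [hw k.castSucc, hv_of_w k.castSucc]
  · have e2 := hlo k t ht.1.le ht.2.le
    rw [pt_inner (Γ := 𝒞) ht] at e2
    have e3 : 𝒿 (.inner (.bottom k) t ht) = MetricGraph.pt 𝒞' (.bottom ⟨k + s, by omega⟩) t := rfl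
    rw [e3]
    linarith [hw k.castSucc, hv_of_w k.castSucc]

end Extension

/-! ### Tropical independence: perturbation and long paths -/

section Tropical

variable {ι X : Type}

/-- Constants are absorbed into `b`, and a summand `e` common to all the functions does not affect
comparisons at a point. -/
lemma TropicallyDependent.comp_of_eq_add {S : Finset ι} {f g : ι → X → ℝ} {c : ι → ℝ}
    {e : X → ℝ} (h : TropicallyDependent S f) (hfg : ∀ i ∈ S, ∀ x, g i x = f i x + c i + e x) :
    TropicallyDependent S g := by
  obtain ⟨b, hb⟩ := h
  refine ⟨fun i => b i - c i, fun x => ?_⟩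
  obtain ⟨i, hi, j, hj, hij, h1, h2⟩ := hb x
  refine ⟨i, hi, j, hj, hij, ?_, fun k hk => ?_⟩
  · rw [hfg i hi, hfg j hj]; linarith
  · rw [hfg i hi, hfg k hk]; linarith [h2 k hk]

/-- Approximate tropical dependence passes to the limit. -/
lemma tropicallyDependent_of_forall_pos {S : Finset ι} {f : ι → X → ℝ} {M : ℝ}
    (hM0 : 0 ≤ M)
    (hM : ∀ i ∈ S, ∀ x, |f i x| ≤ M) (hS : S.Nonempty)
    (h : ∀ δ > 0, ∃ b : ι → ℝ, ∀ x : X, ∃ i ∈ S, ∃ j ∈ S, i ≠ j ∧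
      ∀ k ∈ S, f i x + b i ≤ f k x + b k + δ ∧ f j x + b j ≤ f k x + b k + δ) :
    TropicallyDependent S f := by
  -- Normalize the least constant to `0`. A function whose constant exceeds `2 * M + 1` cannot come
  -- within `δ ≤ 1` of the minimum, so the constants may be cut off there; this places them in a
  -- compact box.
  have htrunc : ∀ δ > 0, δ ≤ 1 → ∃ b ∈ Set.univ.pi fun _ : ι => Set.Icc 0 (2 * M + 1),
      ∀ x : X, ∃ i ∈ S, ∃ j ∈ S, i ≠ j ∧
      ∀ k ∈ S, f i x + b i ≤ f k x + b k + δ ∧ f j x + b j ≤ f k x + b k + δ := by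
    intro δ hδ hδ1
    obtain ⟨b, hb⟩ := h δ hδ
    obtain ⟨i₀, hi₀, hmin⟩ := S.exists_min_image b hS
    refine ⟨fun i => max (min (b i - b i₀) (2 * M + 1)) 0, ?_, fun x => ?_⟩
    · intro i _
      exact ⟨le_max_right _ _, max_le (min_le_right _ _) (by linarith)⟩
    · obtain ⟨i, hi, j, hj, hij, hk⟩ := hb x
      have key : ∀ i ∈ S, f i x + b i ≤ f i₀ x + b i₀ + δ →
          max (min (b i - b i₀) (2 * M + 1)) 0 = b i - b i₀ := by
        intro i hi h1
        have h2 := abs_le.1 (hM i hi x)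
        have h3 := abs_le.1 (hM i₀ hi₀ x)
        rw [min_eq_left (by linarith), max_eq_left (by linarith [hmin i hi])]
      have hi' := key i hi (hk i₀ hi₀).1
      have hj' := key j hj (hk i₀ hi₀).2
      refine ⟨i, hi, j, hj, hij, fun k hkS => ?_⟩
      beta_reduce
      rw [hi', hj']
      have h4 := hk k hkS
      have h5 := hk i₀ hi₀
      have h2 := abs_le.1 (hM k hkS x)
      have h3 := abs_le.1 (hM i₀ hi₀ x)
      rcases le_total (b k - b i₀) (2 * M + 1) with h6 | h6
      · rw [min_eq_left h6, max_eq_left (by linarith [hmin k hkS])]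
        constructor <;> linarith
      · rw [min_eq_right h6]
        have := le_max_left (2 * M + 1) 0
        constructor <;> linarith
  have hδ : ∀ n : ℕ, (0 : ℝ) < 1 / (n + 1) := fun n => Nat.one_div_pos_of_nat
  have hδ1 : ∀ n : ℕ, (1 : ℝ) / (n + 1) ≤ 1 := fun n => by
    rw [div_le_one (by positivity)]; linarith [(Nat.cast_nonneg n : (0 : ℝ) ≤ n)]
  choose b hbox hb using fun n : ℕ => htrunc _ (hδ n) (hδ1 n)
  let U : Ultrafilter ℕ := Filter.hyperfilter ℕ
  obtain ⟨b', -, hlim⟩ := (isCompact_univ_pi fun _ : ι => isCompact_Icc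
    (a := (0 : ℝ)) (b := 2 * M + 1)).ultrafilter_le_nhds (U.map b)
    (Filter.le_principal_iff.2 
      (show ∀ᶠ n in (U : Filter ℕ), b n ∈ _ from Filter.Eventually.of_forall hbox))
  have hlim' : ∀ i, Filter.Tendsto (fun n => b n i) U (𝓝 (b' i)) :=
    fun i => (tendsto_pi_nhds.1 (show Filter.Tendsto b U (𝓝 b') from hlim)) i
  have hδlim : Filter.Tendsto (fun n : ℕ => (1 : ℝ) / (n + 1)) U (𝓝 0) :=
    tendsto_one_div_add_atTop_nhds_zero_nat.mono_left Nat.hyperfilter_le_atTop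
  refine ⟨b', fun x => ?_⟩
  -- At each point the approximately minimal pair may vary with `n`, but among the finitely many
  -- pairs one works for `U`-almost all `n`.
  obtain ⟨i, hi, j, hj, hij, hev⟩ : ∃ i ∈ S, ∃ j ∈ S, i ≠ j ∧ ∀ᶠ n in (U : Filter ℕ), ∀ k ∈ S,
      f i x + b n i ≤ f k x + b n k + 1 / (n + 1) ∧
      f j x + b n j ≤ f k x + b n k + 1 / (n + 1) := by
    by_contra hne
    have h1 : ∀ i ∈ S, ∀ j ∈ S, ∀ᶠ n in (U : Filter ℕ), i ≠ j → ¬ ∀ k ∈ S,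
        f i x + b n i ≤ f k x + b n k + 1 / (n + 1) ∧
        f j x + b n j ≤ f k x + b n k + 1 / (n + 1) := by
      intro i hi j hj
      by_cases hij : i = j
      · exact Filter.Eventually.of_forall fun n h => absurd hij h
      · filter_upwards [Ultrafilter.eventually_not.2 fun hev =>
          hne ⟨i, hi, j, hj, hij, hev⟩] with n hn _ using hn
    have h2 := (Filter.eventually_all_finset S).2 fun i hi =>
      (Filter.eventually_all_finset S).2 (h1 i hi)
    obtain ⟨n, hn⟩ := h2.exists
    obtain ⟨i, hi, j, hj, hij, hk⟩ := hb n x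
    exact hn i hi j hj hij hk
  have hle : ∀ i' ∈ S, (∀ᶠ n in (U : Filter ℕ), ∀ k ∈ S,
      f i' x + b n i' ≤ f k x + b n k + 1 / (n + 1)) → ∀ k ∈ S, f i' x + b' i' ≤ f k x + b' k := by
    intro i' hi' hi'ev k hk
    have h1 := (hlim' i').const_add (f i' x)
    have h2 := ((hlim' k).const_add (f k x)).add hδlim
    rw [add_zero] at h2
    exact le_of_tendsto_of_tendsto h1 h2 (hi'ev.mono fun n hn => hn k hk)
  have hI := hle i hi (hev.mono fun n hn k hk => (hn k hk).1)
  have hJ := hle j hj (hev.mono fun n hn k hk => (hn k hk).2)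
  exact ⟨i, hi, j, hj, hij, le_antisymm (hI j hj) (hJ i hi), hI⟩

/-- Tropical independence of bounded functions is stable under small changes of the functions. -/
theorem TropicallyIndependent.exists_pos {S : Finset ι} {f : ι → X → ℝ} {M : ℝ}
    (hM : ∀ i ∈ S, ∀ x, |f i x| ≤ M) (h : TropicallyIndependent S f) :
    ∃ δ > 0, ∀ f' : ι → X → ℝ, (∀ i ∈ S, ∃ c, ∀ x, |f' i x - f i x - c| ≤ δ) →
      TropicallyIndependent S f' := by
  by_contra! hne
  have hX : Nonempty X := by
    by_contra hX
    rw [not_nonempty_iff] at hX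
    exact h ⟨0, fun x => hX.elim x⟩
  have hS : S.Nonempty := by
    obtain ⟨f', -, hf'⟩ := hne 1 one_pos
    obtain ⟨b, hb⟩ := not_not.1 hf'
    obtain ⟨i, hi, -⟩ := hb hX.some
    exact ⟨i, hi⟩
  refine h (tropicallyDependent_of_forall_pos
    ((abs_nonneg _).trans (hM _ hS.choose_spec hX.some)) hM hS fun δ hδ => ?_)
  obtain ⟨f', hff', hf'⟩ := hne (δ / 2) (by positivity)
  obtain ⟨b, hb⟩ := not_not.1 hf'
  have : ∀ i, ∃ c, i ∈ S → ∀ x, |f' i x - f i x - c| ≤ δ / 2 := fun i => by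
    by_cases hi : i ∈ S
    · obtain ⟨c, hc⟩ := hff' i hi
      exact ⟨c, fun _ => hc⟩
    · exact ⟨0, fun h => absurd h hi⟩
  choose c hc using this
  refine ⟨fun i => b i + c i, fun x => ?_⟩
  obtain ⟨i, hi, j, hj, hij, h1, h2⟩ := hb x
  refine ⟨i, hi, j, hj, hij, fun k hk => ?_⟩
  have hi' := abs_le.1 (hc i hi x)
  have hj' := abs_le.1 (hc j hj x)
  have hk' := abs_le.1 (hc k hk x)
  have := h2 k hk
  constructor <;> linarith

/-- A family of functions is tropically independent if part of it is so on a subspace `j(X)`, and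
the others have distinct larger slopes on a long path ending on the subspace. -/
theorem tropicallyIndependent_of_path {X' : Type} [DecidableEq ι] {A B : Finset ι}
    {F : ι → X' → ℝ} {j : X → X'} {γ : ℝ → X'} {p₀ : X} {σ : ι → ℤ} {M N : ℝ}
    (hN : 2 * M < N) (hγ : γ N = j p₀)
    (hσ : ∀ I ∈ A ∪ B, ∀ t, 0 ≤ t → t ≤ N → F I (γ t) = F I (γ 0) + σ I * t)
    (hA : ∀ I ∈ A, σ I ≤ 0) (hB : ∀ I ∈ B, 1 ≤ σ I)
    (hinj : ∀ I ∈ B, ∀ J ∈ B, σ I = σ J → I = J)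
    (hM : ∀ I ∈ A ∪ B, ∀ p, |F I (j p) - F I (j p₀)| ≤ M)
    (hind : TropicallyIndependent A fun I p => F I (j p)) :
    TropicallyIndependent (A ∪ B) F := by
  rintro ⟨b, hb⟩
  have hM0 : 0 ≤ M ∨ A ∪ B = ∅ := by
    rcases (A ∪ B).eq_empty_or_nonempty with h | ⟨I, hI⟩
    · exact Or.inr h
    · exact Or.inl ((abs_nonneg _).trans (hM I hI p₀))
  replace hM0 : 0 ≤ M := by
    refine hM0.resolve_right fun h => ?_
    obtain ⟨i, hi, -⟩ := hb (j p₀)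
    rw [h] at hi
    exact absurd hi (Finset.notMem_empty i)
  -- No member of `B` attains the minimum on the subspace, so every tie for the minimum there is
  -- between members of `A`, and `b` would make `A` dependent.
  have key : ∀ J ∈ B, ∀ p, ∃ K ∈ A ∪ B, F K (j p) + b K < F J (j p) + b J := by
    intro J hJ p
    by_contra! hmin
    have hJ' := Finset.mem_union_right A hJ
    have hend : ∀ I ∈ A ∪ B, F I (j p₀) = F I (γ 0) + σ I * N := fun I hI => by
      rw [← hγ, hσ I hI N (by linarith) le_rfl]
    -- If `J` is minimal at `j p`, it exceeds any `K ∈ A` by at most `2 * M` at the end of the path.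
    -- Going back by `N - t > 2 * M`, `J` falls by at least `N - t` while `K` does not fall.
    have hsmall : ∀ t ∈ Set.Ico 0 (N - 2 * M), ∀ K ∈ A,
        F J (γ t) + b J < F K (γ t) + b K := by
      intro t ht K hK
      have hK' := Finset.mem_union_left B hK
      rw [hσ J hJ' t ht.1 (by linarith [ht.2]), hσ K hK' t ht.1 (by linarith [ht.2])]
      have h1 := abs_le.1 (hM J hJ' p)
      have h2 := abs_le.1 (hM K hK' p)
      have h3 := hmin K hK'
      have h4 := hend J hJ'
      have h5 := hend K hK'
      have h6 : (σ K : ℝ) ≤ 0 := by exact_mod_cast hA K hK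
      have h7 : (1 : ℝ) ≤ σ J := by exact_mod_cast hB J hJ
      have h8 : 0 ≤ N - t := by linarith [ht.2]
      nlinarith [mul_nonneg h8 (sub_nonneg.2 h7), mul_nonneg h8 (neg_nonneg.2 h6), ht.2]
    -- On this interval the minimum is attained only in `B`, and two affine functions of different
    -- slopes meet at most once. Finitely many meeting points cannot cover an interval.
    have hcov : Set.Ico 0 (N - 2 * M) ⊆ ⋃ q ∈ ((B ×ˢ B).filter fun q => q.1 ≠ q.2 : Finset (ι × ι)),
        {(F q.2 (γ 0) + b q.2 - (F q.1 (γ 0) + b q.1)) / (σ q.1 - σ q.2)} := by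
      intro t ht
      obtain ⟨I, hI, K, hK, hIK, h1, h2⟩ := hb (γ t)
      have hmem : ∀ I ∈ A ∪ B, F I (γ t) + b I ≤ F J (γ t) + b J → I ∈ B := by
        intro I hI hle
        rcases Finset.mem_union.1 hI with h | h
        · exact absurd hle (not_le.2 (hsmall t ht I h))
        · exact h
      have hIB := hmem I hI (h2 J hJ')
      have hKB := hmem K hK (h1 ▸ h2 J hJ')
      simp only [Finset.mem_filter, Finset.mem_product, Set.mem_iUnion, Set.mem_singleton_iff]
      refine ⟨(I, K), ⟨⟨hIB, hKB⟩, hIK⟩, ?_⟩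
      have hne : (σ I : ℝ) - σ K ≠ 0 := by
        intro h0
        exact hIK (hinj I hIB K hKB (by exact_mod_cast sub_eq_zero.1 h0))
      rw [eq_div_iff hne]
      rw [hσ I hI t ht.1 (by linarith [ht.2]), hσ K hK t ht.1 (by linarith [ht.2])] at h1
      linarith
    refine (Set.Ico_infinite (show (0 : ℝ) < N - 2 * M by linarith)) (Set.Finite.subset ?_ hcov)
    exact Set.Finite.biUnion (Finset.finite_toSet _) fun _ _ => Set.finite_singleton _
  refine hind ⟨b, fun p => ?_⟩
  obtain ⟨I, hI, K, hK, hIK, h1, h2⟩ := hb (j p)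
  have hmem : ∀ I ∈ A ∪ B, (∀ K ∈ A ∪ B, F I (j p) + b I ≤ F K (j p) + b K) → I ∈ A := by
    intro I hI hle
    rcases Finset.mem_union.1 hI with h | h
    · exact h
    · obtain ⟨K, hK, hlt⟩ := key I h p
      exact absurd (hle K hK) (not_le.2 hlt)
  exact ⟨I, hmem I hI h2, K, hmem K hK (h1 ▸ h2), hIK, h1,
    fun k hk => h2 k (Finset.mem_union_left B hk)⟩

end Tropical

/-! ### Sums over multisets and their slopes on the long bridge -/

section Multisets

lemma multisetSum_eq_of_forall {r m : ℕ} {X X' : Type} {ψ : Fin (r + 1) → X → ℝ}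
    {ψ' : Fin (r + 1) → X' → ℝ} {x : X} {y : X'} {σ : Fin (r + 1) → ℝ} {t : ℝ}
    (h : ∀ i, ψ i x = ψ' i y + σ i * t) (I : Sym (Fin (r + 1)) m) :
    multisetSum ψ I x = multisetSum ψ' I y + ((I : Multiset (Fin (r + 1))).map σ).sum * t := by
  rw [multisetSum, multisetSum, ← Multiset.sum_map_mul_right, ← Multiset.sum_map_add]
  exact congrArg _ (Multiset.map_congr rfl fun i _ => h i)

lemma multisetSum_sub_le {r m : ℕ} {X : Type} {ψ ψ' : Fin (r + 1) → X → ℝ} {c : Fin (r + 1) → ℝ}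
    {δ : ℝ} {x y : X} (h : ∀ i, |ψ' i y - ψ i x - c i| ≤ δ) (I : Sym (Fin (r + 1)) m) :
    |multisetSum ψ' I y - multisetSum ψ I x - ((I : Multiset (Fin (r + 1))).map c).sum| ≤
      m * δ := by
  rw [multisetSum, multisetSum, ← Multiset.sum_map_sub, ← Multiset.sum_map_sub]
  have h1 := Multiset.abs_sum_le_sum_abs (s := (I : Multiset (Fin (r + 1))).map
    fun i => ψ' i y - ψ i x - c i)
  refine h1.trans ?_
  rw [Multiset.map_map]
  have h2 := Multiset.sum_le_card_nsmul ((I : Multiset (Fin (r + 1))).map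
    (abs ∘ fun i => ψ' i y - ψ i x - c i)) δ (by
      intro z hz
      obtain ⟨i, -, rfl⟩ := Multiset.mem_map.1 hz
      exact h i)
  rwa [Multiset.card_map, Sym.card_coe, nsmul_eq_mul] at h2

lemma multisetSum_map_succ {r m : ℕ} {X : Type} (ψ : Fin (r + 1 + 1) → X → ℝ)
    (I : Sym (Fin (r + 1)) m) (x : X) :
    multisetSum ψ (I.map Fin.succ) x = multisetSum (fun i => ψ i.succ) I x := by
  simp [multisetSum, Multiset.map_map]

/-- The slopes of the functions `ψ_i` on the bridge between the new loops and the others. -/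
def frontSlope (s : ℕ) {r : ℕ} (i : Fin (r + 1)) : ℤ := if i = 0 then s + 1 else 1 - i

lemma sum_frontSlope_map_succ_nonpos (s : ℕ) {r m : ℕ} (I : Sym (Fin (r + 1)) m) :
    (((I.map Fin.succ : Sym (Fin (r + 1 + 1)) m) : Multiset (Fin (r + 1 + 1))).map
      (frontSlope s)).sum ≤ 0 := by
  refine (Multiset.sum_le_card_nsmul _ 0 fun z hz => ?_).trans (by simp)
  obtain ⟨i, hi, rfl⟩ := Multiset.mem_map.1 hz
  rw [Sym.coe_map] at hi
  obtain ⟨i, -, rfl⟩ := Multiset.mem_map.1 hi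
  rw [frontSlope, if_neg (Fin.succ_ne_zero i), Fin.val_succ]
  push_cast
  linarith [(Int.natCast_nonneg (i : ℕ))]

/-- There are many multisets containing `0` for which the sums of the slopes are positive and
distinct. -/
lemma exists_sum_frontSlope_eq {s r m : ℕ} (hsr : s ≤ r) {k : ℕ}
    (hk : k = m * (s + 1) ∧ 1 ≤ m ∨ 1 ≤ k ∧ k ≤ (m - 1) * (s + 1)) :
    ∃ I : Sym (Fin (r + 1 + 1)) m, 0 ∈ I ∧
      ((I : Multiset (Fin (r + 1 + 1))).map (frontSlope s)).sum = k := by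
  rcases hk with ⟨rfl, hm⟩ | ⟨h1, h2⟩
  · refine ⟨Sym.replicate m 0, by simp [Sym.mem_replicate]; omega, ?_⟩
    rw [Sym.coe_replicate]
    simp [frontSlope]
  · obtain ⟨m, rfl⟩ : ∃ m', m = m' + 1 := by
      refine ⟨m - 1, (Nat.sub_add_cancel (Nat.one_le_iff_ne_zero.2 ?_)).symm⟩
      rintro rfl
      simp at h2
      omega
    rw [Nat.add_sub_cancel] at h2
    -- The slope is written as `k = a * (s + 1) - e` with `0 ≤ e ≤ s`: round `k` up to a multiple of
    -- `s + 1`.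
    obtain ⟨a, e, ha0, ha, he, hae⟩ : ∃ a e, 1 ≤ a ∧ a ≤ m ∧ e ≤ s ∧ k + e = a * (s + 1) := by
      obtain ⟨q, t, hq, hr⟩ : ∃ q t, (s + 1) * q + t = k - 1 ∧ t < s + 1 :=
        ⟨_, _, Nat.div_add_mod _ _, Nat.mod_lt _ (Nat.succ_pos s)⟩
      refine ⟨q + 1, s - t, by omega, ?_, by omega, ?_⟩
      · by_contra! hlt
        have : (s + 1) * m ≤ (s + 1) * q := Nat.mul_le_mul_left _ (by omega)
        have : m * (s + 1) = (s + 1) * m := Nat.mul_comm _ _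
        omega
      · have : (q + 1) * (s + 1) = (s + 1) * q + (s + 1) := by ring
        omega
    -- The index `0` has slope `s + 1`, the index `1` has slope `0`, and `e + 1` has slope `-e`. The
    -- last index is available because `e ≤ s ≤ r`.
    refine ⟨⟨Multiset.replicate a 0 + Multiset.replicate (m - a) 1 + {⟨e + 1, by omega⟩}, ?_⟩,
      ?_, ?_⟩
    · simp; omega
    · refine Sym.mem_mk _ _ _ |>.2 ?_
      simp [Multiset.mem_replicate]; omega
    · rw [Sym.coe_mk]
      have h3 : frontSlope s (⟨e + 1, by omega⟩ : Fin (r + 1 + 1)) = -e := by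
        rw [frontSlope, if_neg (by simp [Fin.ext_iff])]; push_cast; ring
      have h4 : frontSlope s (1 : Fin (r + 1 + 1)) = 0 := by
        rw [frontSlope, if_neg (by simp)]; simp
      have h5 : frontSlope s (0 : Fin (r + 1 + 1)) = s + 1 := if_pos rfl
      simp only [Multiset.map_add, Multiset.map_replicate, Multiset.map_singleton,
        Multiset.sum_add, Multiset.sum_replicate, Multiset.sum_singleton, h3, h4, h5]
      zify at hae
      simp only [nsmul_eq_mul, smul_zero, add_zero]
      linarith

/-- A set of multisets containing `0` with positive distinct sums of slopes. -/
lemma exists_finset_frontSlope {s r m : ℕ} (hsr : s ≤ r) (hm : 1 ≤ m) :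
    ∃ B : Finset (Sym (Fin (r + 1 + 1)) m), B.card = (m - 1) * (s + 1) + 1 ∧ (∀ I ∈ B, 0 ∈ I) ∧
      (∀ I ∈ B, 1 ≤ ((I : Multiset (Fin (r + 1 + 1))).map (frontSlope s)).sum) ∧
      ∀ I ∈ B, ∀ J ∈ B, ((I : Multiset (Fin (r + 1 + 1))).map (frontSlope s)).sum =
        ((J : Multiset (Fin (r + 1 + 1))).map (frontSlope s)).sum → I = J := by
  classical
  -- All the possible positive slopes: only the multiset of `m` zeros exceeds `(m - 1) * (s + 1)`.
  let T : Finset ℕ := insert (m * (s + 1)) (Finset.Icc 1 ((m - 1) * (s + 1)))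
  have hms : m * (s + 1) = (m - 1) * (s + 1) + (s + 1) := by
    obtain ⟨m, rfl⟩ : ∃ m', m = m' + 1 := ⟨m - 1, by omega⟩
    rw [Nat.add_sub_cancel]; ring
  have hT : ∀ k ∈ T, k = m * (s + 1) ∧ 1 ≤ m ∨ 1 ≤ k ∧ k ≤ (m - 1) * (s + 1) := by
    intro k hk
    rcases Finset.mem_insert.1 hk with h | h
    · exact Or.inl ⟨h, hm⟩
    · exact Or.inr (Finset.mem_Icc.1 h)
  have hT1 : ∀ k ∈ T, 1 ≤ k := fun k hk => by
    rcases hT k hk with ⟨h, -⟩ | h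
    · rw [h, hms]; omega
    · exact h.1
  choose! φ h0 hφ using fun k (hk : k ∈ T) => exists_sum_frontSlope_eq (r := r) hsr (hT k hk)
  refine ⟨T.image φ, ?_, ?_, ?_, ?_⟩
  · rw [Finset.card_image_of_injOn, Finset.card_insert_of_notMem, Nat.card_Icc]
    · omega
    · rw [Finset.mem_Icc, hms]; omega
    · intro k hk k' hk' h
      have e1 := hφ k hk
      rw [h, hφ k' hk'] at e1
      exact_mod_cast e1.symm
  · simpa using fun k hk => h0 k hk
  · rintro I hI
    obtain ⟨k, hk, rfl⟩ := Finset.mem_image.1 hI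
    rw [hφ k hk]
    exact_mod_cast hT1 k hk
  · rintro I hI J hJ h
    obtain ⟨k, hk, rfl⟩ := Finset.mem_image.1 hI
    obtain ⟨k', hk', rfl⟩ := Finset.mem_image.1 hJ
    rw [hφ k hk, hφ k' hk'] at h
    rw [Nat.cast_injective h]

end Multisets

/-! ### Moving chips by a small amount -/

section Shift

/-- The combination of hinges that enters `loopSlope` is `-u` plus a constant that depends only on
the edge. Moving the initial and the final chip of a loop by the same `ε`, without changing edges,
therefore leaves the slope unchanged. -/
lemma bottomHinge_sub_topHinge {l k u : ℝ} (h : -l < u ∧ u < k ∧ u ≠ 0) :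
    bottomHinge (some u) k - topHinge (some u) l = -u + if 0 < u then k else -l := by
  simp only [bottomHinge, topHinge, Option.elim_some]
  split_ifs with h0
  · rw [max_eq_left (by linarith)]; ring
  · rw [max_eq_left (by linarith)]; ring

lemma abs_bottomHinge_add_sub_le {u ε : ℝ} (hε : 0 ≤ ε) (h : 0 < u + ε ↔ 0 < u) (t : ℝ) :
    |bottomHinge (some (u + ε)) t - bottomHinge (some u) t| ≤ ε := by
  simp only [bottomHinge, Option.elim_some, h]
  split_ifs
  · refine (abs_max_sub_max_le_abs _ _ _).trans (le_of_eq ?_)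
    rw [show t - (u + ε) - (t - u) = -ε by ring, abs_neg, abs_of_nonneg hε]
  · simpa using hε

lemma abs_topHinge_add_sub_le {u ε : ℝ} (hε : 0 ≤ ε) (h : 0 < u + ε ↔ 0 < u) (t : ℝ) :
    |topHinge (some (u + ε)) t - topHinge (some u) t| ≤ ε := by
  simp only [topHinge, Option.elim_some, h]
  split_ifs
  · simpa using hε
  · refine (abs_max_sub_max_le_abs _ _ _).trans (le_of_eq ?_)
    rw [show t + (u + ε) - (t + u) = ε by ring, abs_of_nonneg hε]

variable {g : ℕ} {ℓ m n : ℕ → ℝ} {hℓ : ∀ k, 0 < ℓ k} {hm : ∀ k, 0 < m k} {hn : ∀ k, 0 < n k}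

local notation "𝒞" => chainOfLoops g ℓ m n hℓ hm hn

lemma ValidChips.eventually_add_pos_iff {x : ℕ → Option ℝ} (hx : ValidChips g ℓ m x) :
    ∀ᶠ ε in 𝓝[>] (0 : ℝ), ∀ k < g, ∀ u ∈ x k, 0 < u + ε ↔ 0 < u := by
  have : ∀ k ∈ Finset.range g, ∀ᶠ ε in 𝓝[>] (0 : ℝ), ∀ u ∈ x k, 0 < u + ε ↔ 0 < u := by
    intro k hk
    rcases hxk : x k with _ | u
    · exact Filter.Eventually.of_forall fun ε => by simp
    · have h3 := (hx k (Finset.mem_range.1 hk) u hxk).2.2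
      have e2 : ∀ᶠ ε in 𝓝[>] (0 : ℝ), ε < |u| :=
        nhdsWithin_le_nhds (Iio_mem_nhds (abs_pos.2 h3))
      filter_upwards [e2, self_mem_nhdsWithin] with ε h5 h6
      have h6 : 0 < ε := h6
      rintro _ ⟨⟩
      refine ⟨fun h => ?_, fun h => by linarith⟩
      by_contra! hle
      rw [abs_of_nonpos hle] at h5
      linarith
  filter_upwards [(Filter.eventually_all_finset _).2 this] with ε hε k hk
  exact hε k (Finset.mem_range.2 hk)

variable {S : ℕ → Prop} {ε : ℝ} {a a' b b' : ℤ} {x x' : ℕ → Option ℝ}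

/-- Both divisors have a chip on each shifted loop, so both moments there grow by `ε` and their
difference is unchanged. -/
theorem MetricGraph.LinEquiv.shift (hS : ∀ k < g, S k → (x k).isSome ∧ (x' k).isSome)
    (hx : ValidChips g ℓ m x) (hx' : ValidChips g ℓ m x')
    (hxε : ValidChips g ℓ m (shiftChips S ε x)) (hxε' : ValidChips g ℓ m (shiftChips S ε x'))
    (h : MetricGraph.LinEquiv 𝒞 (stdDiv 𝒞 a x b) (stdDiv 𝒞 a' x' b')) :
    MetricGraph.LinEquiv 𝒞 (stdDiv 𝒞 a (shiftChips S ε x) b)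
      (stdDiv 𝒞 a' (shiftChips S ε x') b') := by
  obtain ⟨hdeg, hmom⟩ := chain_linEquiv_iff.1 h
  refine stdDiv_linEquiv hxε hxε' ?_ fun k hk => ?_
  · rw [deg_stdDiv, deg_stdDiv] at hdeg
    rwa [chipsLT_shiftChips, chipsLT_shiftChips]
  · obtain ⟨z, hz⟩ := hmom ⟨k, hk⟩
    rw [moment_stdDiv hx, moment_stdDiv hx'] at hz
    refine ⟨z, ?_⟩
    rw [getD_shiftChips fun h => (hS k hk h).1, getD_shiftChips fun h => (hS k hk h).2,
      chipsLT_shiftChips, chipsLT_shiftChips]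
    simp only [loopLen, chainOfLoops] at hz
    linarith

/-- A function changes little when the chips on some loops are moved a little. -/
theorem exists_abs_sub_sub_le_of_shiftChips (hε : 0 ≤ ε)
    (hS : ∀ k < g, S k → (x k).isSome ∧ (x' k).isSome)
    (hx : ValidChips g ℓ m x) (hx' : ValidChips g ℓ m x')
    (hxε : ValidChips g ℓ m (shiftChips S ε x)) (hxε' : ValidChips g ℓ m (shiftChips S ε x'))
    (hs : ∀ k < g, ∀ u ∈ x k, 0 < u + ε ↔ 0 < u) (hs' : ∀ k < g, ∀ u ∈ x' k, 0 < u + ε ↔ 0 < u)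
    {f f' : MetricGraph.Point 𝒞 → ℝ}
    (hf : MetricGraph.Carries 𝒞 f (stdDiv 𝒞 a x b) (stdDiv 𝒞 a' x' b'))
    (hf' : MetricGraph.Carries 𝒞 f' (stdDiv 𝒞 a (shiftChips S ε x) b)
      (stdDiv 𝒞 a' (shiftChips S ε x') b')) :
    ∃ c, ∀ p, |f' p - f p - c| ≤ 2 * (g + 1) * ε := by
  obtain ⟨f1, f2, f3⟩ := carries_stdDiv_formula hx hx' hf
  obtain ⟨f1', f2', f3'⟩ := carries_stdDiv_formula hxε hxε' hf'
  simp only [chipsLT_shiftChips] at f1' f2' f3'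
  have hslope : ∀ k : Fin g, ∀ c, loopSlope (ℓ (k + 1)) (m (k + 1)) (shiftChips S ε x k)
      (shiftChips S ε x' k) c = loopSlope (ℓ (k + 1)) (m (k + 1)) (x k) (x' k) c := by
    intro k c
    by_cases hSk : S k
    · obtain ⟨u, hu⟩ := Option.isSome_iff_exists.1 (hS k k.2 hSk).1
      obtain ⟨u', hu'⟩ := Option.isSome_iff_exists.1 (hS k k.2 hSk).2
      have e1 : shiftChips S ε x k = some (u + ε) := by rw [shiftChips, if_pos hSk, hu]; rfl
      have e2 : shiftChips S ε x' k = some (u' + ε) := by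
        rw [shiftChips, if_pos hSk, hu']; rfl
      have h1 := bottomHinge_sub_topHinge (hx k k.2 u hu)
      have h2 := bottomHinge_sub_topHinge (hx' k k.2 u' hu')
      have h3 := bottomHinge_sub_topHinge (hxε k k.2 _ e1)
      have h4 := bottomHinge_sub_topHinge (hxε' k k.2 _ e2)
      rw [if_congr (hs k k.2 u hu) rfl rfl] at h3
      rw [if_congr (hs' k k.2 u' hu') rfl rfl] at h4
      rw [loopSlope, loopSlope, e1, e2, hu, hu']
      congr 1
      linarith
    · rw [shiftChips, shiftChips, if_neg hSk, if_neg hSk]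
  have hhinge : ∀ (y : ℕ → Option ℝ), (∀ k < g, ∀ u ∈ y k, 0 < u + ε ↔ 0 < u) → ∀ k < g, ∀ t,
      |bottomHinge (shiftChips S ε y k) t - bottomHinge (y k) t| ≤ ε ∧
      |topHinge (shiftChips S ε y k) t - topHinge (y k) t| ≤ ε := by
    intro y hy k hk t
    rw [shiftChips]
    split_ifs
    · rcases hyk : y k with _ | u
      · simpa [bottomHinge, topHinge] using hε
      · exact ⟨abs_bottomHinge_add_sub_le hε (hy k hk u hyk) t,
          abs_topHinge_add_sub_le hε (hy k hk u hyk) t⟩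
    · simpa using hε
  have hbr : ∀ (k : Fin (g + 1)) t, 0 ≤ t → t ≤ n k →
      f' (MetricGraph.pt 𝒞 (.bridge k) t) - f (MetricGraph.pt 𝒞 (.bridge k) t) =
      f' (.vertex (.w k)) - f (.vertex (.w k)) := by
    intro k t h0 ht
    rw [f1 k t h0 ht, f1' k t h0 ht]
    ring
  have hv : ∀ k : Fin (g + 1), f' (.vertex (.v k)) - f (.vertex (.v k)) =
      f' (.vertex (.w k)) - f (.vertex (.w k)) := by
    intro k
    have e : MetricGraph.pt 𝒞 (.bridge k) (n k) = .vertex (.v k) := pt_len (Γ := 𝒞) (.bridge k)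
    have := hbr k (n k) (hn k).le le_rfl
    rwa [e] at this
  have hlo : ∀ (k : Fin g) t, 0 ≤ t → t ≤ m (k + 1) →
      |f' (MetricGraph.pt 𝒞 (.bottom k) t) - f (MetricGraph.pt 𝒞 (.bottom k) t) -
      (f' (.vertex (.w k.castSucc)) - f (.vertex (.w k.castSucc)))| ≤ 2 * ε := by
    intro k t h0 ht
    rw [f2 k t h0 ht, f2' k t h0 ht, ← hv, hslope]
    have h1 := abs_le.1 (hhinge x hs k k.2 t).1
    have h2 := abs_le.1 (hhinge x' hs' k k.2 t).1
    rw [abs_le]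
    constructor <;> linarith
  have hup : ∀ (k : Fin g) t, 0 ≤ t → t ≤ ℓ (k + 1) →
      |f' (MetricGraph.pt 𝒞 (.top k) t) - f (MetricGraph.pt 𝒞 (.top k) t) -
      (f' (.vertex (.w k.castSucc)) - f (.vertex (.w k.castSucc)))| ≤ 2 * ε := by
    intro k t h0 ht
    rw [f3 k t h0 ht, f3' k t h0 ht, ← hv, hslope]
    have h1 := abs_le.1 (hhinge x hs k k.2 t).2
    have h2 := abs_le.1 (hhinge x' hs' k k.2 t).2
    rw [abs_le]
    constructor <;> linarith
  -- Differences are constant along bridges, and each loop adds an error of at most `2 * ε`: the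
  -- slopes agree and two hinges move by at most `ε` each.
  have hw : ∀ k : Fin (g + 1), |f' (.vertex (.w k)) - f (.vertex (.w k)) -
      (f' (.vertex (.w 0)) - f (.vertex (.w 0)))| ≤ 2 * k * ε := by
    intro k
    induction k using Fin.induction with
    | zero => simp
    | succ k ih =>
      have e : MetricGraph.pt 𝒞 (.bottom k) (m (k + 1)) = .vertex (.w k.succ) :=
        pt_len (Γ := 𝒞) (.bottom k)
      have h1 := abs_le.1 (hlo k _ (hm _).le le_rfl)
      have h2 := abs_le.1 ih
      rw [e] at h1
      rw [Fin.val_castSucc] at h2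
      rw [Fin.val_succ, abs_le]
      push_cast
      constructor <;> linarith
  have hkg : ∀ k : ℕ, k ≤ g → 2 * (k : ℝ) * ε ≤ 2 * g * ε := fun k hk => by
    have : (k : ℝ) ≤ g := by exact_mod_cast hk
    gcongr
  refine ⟨f' (.vertex (.w 0)) - f (.vertex (.w 0)), fun p => ?_⟩
  obtain ⟨e, t, h0, ht, rfl⟩ := exists_eq_pt p
  rcases e with k | k | k
  · have h1 := abs_le.1 (hw k)
    have h2 := hkg k (by omega)
    rw [hbr k t h0 ht, abs_le]
    constructor <;> linarith
  · have h1 := abs_le.1 (hw k.castSucc)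
    have h2 := hkg k (by omega)
    have h3 := abs_le.1 (hup k t h0 ht)
    rw [Fin.val_castSucc] at h1
    rw [abs_le]
    constructor <;> linarith
  · have h1 := abs_le.1 (hw k.castSucc)
    have h2 := hkg k (by omega)
    have h3 := abs_le.1 (hlo k t h0 ht)
    rw [Fin.val_castSucc] at h1
    rw [abs_le]
    constructor <;> linarith

end Shift

/-! ### Making room for `s + 1` chips to pass through the old chain -/

section Deformation

variable {g : ℕ} {ℓ m n : ℕ → ℝ} {hℓ : ∀ k, 0 < ℓ k} {hm : ∀ k, 0 < m k} {hn : ∀ k, 0 < n k}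

local notation "𝒞" => chainOfLoops g ℓ m n hℓ hm hn

lemma MetricGraph.LinEquiv.chipsLT_add_eq {a a' b b' : ℤ} {x x' : ℕ → Option ℝ}
    (h : MetricGraph.LinEquiv 𝒞 (stdDiv 𝒞 a x b) (stdDiv 𝒞 a' x' b')) :
    chipsLT a' x' g + b' = chipsLT a x g + b := by
  have := (chain_linEquiv_iff.1 h).1
  rwa [deg_stdDiv, deg_stdDiv] at this

lemma MetricGraph.LinEquiv.exists_moment {a a' b b' : ℤ} {x x' : ℕ → Option ℝ}
    (hx : ValidChips g ℓ m x) (hx' : ValidChips g ℓ m x')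
    (h : MetricGraph.LinEquiv 𝒞 (stdDiv 𝒞 a x b) (stdDiv 𝒞 a' x' b')) :
    ∀ k < g, ∃ z : ℤ, ((x' k).getD 0 - m (k + 1) * (chipsLT a' x' (k + 1) : ℤ)) -
      ((x k).getD 0 - m (k + 1) * (chipsLT a x (k + 1) : ℤ)) = z * (ℓ (k + 1) + m (k + 1)) := by
  intro k hk
  obtain ⟨z, hz⟩ := (chain_linEquiv_iff.1 h).2 ⟨k, hk⟩
  rw [moment_stdDiv hx, moment_stdDiv hx'] at hz
  exact ⟨z, hz⟩

/-- The divisors on a chain of loops can be moved a little so that `s + 1` further chips can pass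
through the chain, and the functions remain tropically independent. -/
theorem MaximalRankOn.exists_extendable_chips {r s q N : ℕ} (hN : s + 1 + r + g ≤ N)
    (hlen : ∀ k < g, N * m (k + 1) < ℓ (k + 1) + m (k + 1))
    (h : MaximalRankOn 𝒞 (g + r - s) r q) :
    ∃ Y : ℕ → ℕ → Option ℝ, (∀ j ≤ r + 1, ValidChips g ℓ m (Y j)) ∧
      (∀ j ≤ r + 1, MetricGraph.LinEquiv 𝒞 (stdDiv 𝒞 (if j = 0 then s + 1 else 0) (Y 1) r)
        (stdDiv 𝒞 (j - 1 : ℕ) (Y j) (r + 1 - j))) ∧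
      chipsLT 0 (Y 1) g = g - s ∧
      ∃ A : Finset (Sym (Fin (r + 1)) q),
        (A.card : ℤ) = min ((r + q).choose q : ℤ) ((q : ℤ) * (g + r - s) - g + 1) ∧
        ∀ f : Fin (r + 1) → MetricGraph.Point 𝒞 → ℝ,
          (∀ i : Fin (r + 1), MetricGraph.Carries 𝒞 (f i) (stdDiv 𝒞 0 (Y 1) r)
            (stdDiv 𝒞 (i : ℕ) (Y (i + 1)) (r - (i : ℕ)))) →
          TropicallyIndependent A (multisetSum f) := by
  obtain ⟨D, hdeg, -, hva, ψ, hψ, A, hcard, hA⟩ := h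
  obtain ⟨x, hx, hD⟩ := hva.exists_stdDiv
  have hψx := hψ.carries_stdDiv hx hD
  have h0r := Nat.zero_le r
  have hDx : ∀ i ≤ r, MetricGraph.LinEquiv 𝒞 (stdDiv 𝒞 0 (x 0) r) (stdDiv 𝒞 i (x i) (r - i)) := by
    intro i hi
    have := (hD 0 h0r).symm.trans (hD i hi)
    simpa using this
  have htot : chipsLT 0 (x 0) g = g - s := by
    have h1 := (chain_linEquiv_iff.1 (hD 0 h0r)).1
    rw [deg_stdDiv, hdeg] at h1
    push_cast at h1
    linarith
  -- Only loops on which every `D_i` has a chip can be shifted without breaking the equivalences by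
  -- a change of moments.
  set S : ℕ → Prop := fun k => ∀ i ≤ r, (x i k).isSome with hSdef
  -- Subtracting `ψ 0` makes the functions start at the standard divisor `D_0`. Each sum over `q`
  -- indices changes by the same function `q * ψ 0`, so independence is preserved.
  let f₀ : Fin (r + 1) → MetricGraph.Point 𝒞 → ℝ :=
    fun i p => ψ i p + -ψ 0 p
  have hf₀ : ∀ i : Fin (r + 1), MetricGraph.Carries 𝒞 (f₀ i) (stdDiv 𝒞 0 (x 0) r)
      (stdDiv 𝒞 (i : ℕ) (x i) (r - (i : ℕ))) := by
    intro i
    have h1 := hψx 0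
    simp only [Fin.val_zero, Nat.cast_zero, sub_zero] at h1
    exact (hψx i).add h1.neg (by abel)
  have hA₀ : TropicallyIndependent A (multisetSum f₀) := by
    intro hdep
    refine hA (hdep.comp_of_eq_add (c := 0) (e := fun p => q * ψ 0 p) fun I _ p => ?_)
    have := multisetSum_eq_of_forall (ψ := ψ) (ψ' := f₀) (x := p) (y := p) (σ := fun _ => 1)
      (t := ψ 0 p) (fun i => by simp [f₀]) I
    rw [this]
    simp
  obtain ⟨M, hM⟩ : ∃ M, ∀ i p, |f₀ i p| ≤ M := by
    choose M hM using fun i => (hf₀ i).bounded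
    exact ⟨∑ i, |M i|, fun i p => ((hM i p).trans (le_abs_self _)).trans
      (Finset.single_le_sum (f := fun i => |M i|) (fun _ _ => abs_nonneg _) (Finset.mem_univ i))⟩
  have hMq : ∀ I ∈ A, ∀ p, |multisetSum f₀ I p| ≤ q * M := by
    intro I _ p
    have := multisetSum_sub_le (ψ := fun _ _ => 0) (ψ' := f₀) (c := 0) (x := p) (y := p)
      (fun i => by simpa using hM i p) I
    simpa [multisetSum] using this
  obtain ⟨δ, hδ, hind⟩ := hA₀.exists_pos hMq
  have hμ : ∀ i ≤ r, ∀ k < g, ∃ z : ℤ, (x i k).getD 0 -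
      m (k + 1) * (chipsLT i (x i) (k + 1) : ℤ) -
      ((x 0 k).getD 0 - m (k + 1) * (chipsLT 0 (x 0) (k + 1) : ℤ)) =
      z * (ℓ (k + 1) + m (k + 1)) :=
    fun i hi => (hDx i hi).exists_moment (hx 0 h0r) (hx i hi)
  have ev1 := eventually_validChips_transferChips hℓ hm hN hlen hx hμ htot
  have ev2 : ∀ᶠ ε in 𝓝[>] (0 : ℝ), ∀ i ∈ Finset.range (r + 1),
      ValidChips g ℓ m (shiftChips S ε (x i)) ∧ ∀ k < g, ∀ u ∈ x i k, 0 < u + ε ↔ 0 < u :=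
    (Filter.eventually_all_finset _).2 fun i hi =>
      have hi : i ≤ r := Nat.lt_succ_iff.1 (Finset.mem_range.1 hi)
      ((hx i hi).eventually_shiftChips S).and (hx i hi).eventually_add_pos_iff
  have ev3 : ∀ᶠ ε in 𝓝[>] (0 : ℝ), q * (2 * (g + 1) * ε) < δ := by
    have : Filter.Tendsto (fun ε : ℝ => q * (2 * (g + 1) * ε)) (𝓝 0) (𝓝 (q * (2 * (g + 1) * 0))) :=
      (by fun_prop : Continuous fun ε : ℝ => q * (2 * (g + 1) * ε)).tendsto 0
    rw [mul_zero, mul_zero] at this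
    exact nhdsWithin_le_nhds (this.eventually (gt_mem_nhds hδ))
  obtain ⟨ε, hy, hshift, hεδ, hε⟩ := (ev1.and (ev2.and (ev3.and self_mem_nhdsWithin))).exists
  have hε : 0 < ε := hε
  have hxε : ∀ i ≤ r, ValidChips g ℓ m (shiftChips S ε (x i)) :=
    fun i hi => (hshift i (Finset.mem_range.2 (by omega))).1
  have hsgn : ∀ i ≤ r, ∀ k < g, ∀ u ∈ x i k, 0 < u + ε ↔ 0 < u :=
    fun i hi => (hshift i (Finset.mem_range.2 (by omega))).2
  have hSS : ∀ i ≤ r, ∀ k < g, S k → (x 0 k).isSome ∧ (x i k).isSome :=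
    fun i hi k _ hk => ⟨hk 0 h0r, hk i hi⟩
  -- The indices are those of the extended chain: `Y (i + 1)` is the shifted old `D_i`, and `Y 0` is
  -- what the passage of `s + 1` chips leaves on the loops.
  let Y : ℕ → ℕ → Option ℝ := fun j =>
    if j = 0 then transferChips hℓ hm (s + 1) (shiftChips S ε (x 0)) else shiftChips S ε (x (j - 1))
  have hY0 : Y 0 = transferChips hℓ hm (s + 1) (shiftChips S ε (x 0)) := if_pos rfl
  have hY : ∀ i, Y (i + 1) = shiftChips S ε (x i) := fun i => by simp [Y]
  have hY1 : Y 1 = shiftChips S ε (x 0) := hY 0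
  have htot' : chipsLT 0 (Y 1) g = g - s := by rw [hY1, chipsLT_shiftChips, htot]
  refine ⟨Y, ?_, ?_, htot', A, hcard, fun f hf => ?_⟩
  · rintro (_ | i) hi
    · rw [hY0]; exact hy
    · rw [hY]; exact hxε i (by omega)
  · rintro (_ | i) hi
    · rw [if_pos rfl, hY1, hY0]
      refine stdDiv_linEquiv (hxε 0 h0r) hy ?_ fun k _ => ?_
      · rw [hY1] at htot'
        have h1 := chipsLT_add (s + 1) 0 (shiftChips S ε (x 0)) g
        have h2 : chipsLT ((0 - 1 : ℕ) : ℤ) (transferChips hℓ hm (s + 1) (shiftChips S ε (x 0))) g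
            = ((0 - 1 : ℕ) : ℤ) + g := chipsLT_some _ _ _
        rw [add_zero, htot'] at h1
        rw [h1, h2]
        push_cast
        ring
      · exact moment_transferChips hℓ hm (s + 1) (shiftChips S ε (x 0)) k
    · rw [if_neg (Nat.succ_ne_zero i), hY1, hY, Nat.add_sub_cancel]
      have := (hDx i (by omega)).shift (hSS i (by omega)) (hx 0 h0r) (hx i (by omega))
        (hxε 0 h0r) (hxε i (by omega))
      convert this using 2
      push_cast
      ring
  · refine hind _ fun I _ => ?_
    have hclose : ∀ i : Fin (r + 1), ∃ c, ∀ p, |f i p - f₀ i p - c| ≤ 2 * (g + 1) * ε := by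
      intro i
      have hi : (i : ℕ) ≤ r := by omega
      have hfi := hf i
      rw [hY1, hY] at hfi
      exact exists_abs_sub_sub_le_of_shiftChips hε.le (hSS i hi) (hx 0 h0r) (hx i hi) (hxε 0 h0r)
        (hxε i hi) (hsgn 0 h0r) (hsgn i hi) (hf₀ i) hfi
    choose c hc using hclose
    exact ⟨_, fun p => (multisetSum_sub_le (fun i => hc i p) I).trans hεδ.le⟩

end Deformation

/-! ### Chips on the new loops -/

section FrontChips

/-- The chips on the loops in front of the chain. -/
def frontChips (ℓ m : ℕ → ℝ) (j k : ℕ) : Option ℝ :=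
  if j = 0 then none else some ((k + 1 + j) * m (k + 1) - (ℓ (k + 1) + m (k + 1)))

variable {s : ℕ} {ℓ m : ℕ → ℝ}

lemma chipsLT_frontChips (c : ℤ) (j k : ℕ) :
    chipsLT c (frontChips ℓ m j) k = if j = 0 then c else c + k := by
  by_cases hj : j = 0
  · rw [if_pos hj, show frontChips ℓ m j = fun _ => none from funext fun k => if_pos hj,
      chipsLT_none]
  · rw [if_neg hj, show frontChips ℓ m j = fun k => some _ from funext fun k => if_neg hj,
      chipsLT_some]

/-- For `j ≥ 1` the multiple `(k + 1 + j) * m (k + 1)` lies strictly between `m (k + 1)` and the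
length of the loop, so subtracting the length gives an interior point of the top edge. -/
lemma validChips_frontChips {N j : ℕ} (hm : ∀ k, 0 < m k) (hj : s + j ≤ N)
    (hlen : ∀ k < s, N * m (k + 1) < ℓ (k + 1) + m (k + 1)) :
    ValidChips s ℓ m (frontChips ℓ m j) := by
  intro k hk u hu
  rw [frontChips] at hu
  split_ifs at hu with hj0
  · simp at hu
  obtain rfl : (k + 1 + j) * m (k + 1) - (ℓ (k + 1) + m (k + 1)) = u := by simpa using hu
  have h1 : ((k : ℝ) + 1 + j) ≤ N := by exact_mod_cast (by omega : k + 1 + j ≤ N)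
  have h2 : ((k : ℝ) + 1 + j) * m (k + 1) ≤ N * m (k + 1) :=
    mul_le_mul_of_nonneg_right h1 (hm _).le
  have h3 := hlen k hk
  have h4 : (1 : ℝ) ≤ j := by exact_mod_cast Nat.one_le_iff_ne_zero.2 hj0
  have h5 : 0 < ((k : ℝ) + j) * m (k + 1) := mul_pos (by positivity) (hm _)
  exact ⟨by linarith, by linarith [hm (k + 1)], by linarith⟩

/-- All the moments vanish modulo the length: for `j ≥ 1` there are `j + k + 1` chips up to loop
`k`, and the position of the chip is chosen to compensate them; for `j = 0` there are no chips at
all. -/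
lemma frontChips_moment (j k : ℕ) :
    ∃ z : ℤ, ((frontChips ℓ m j k).getD 0 -
      m (k + 1) * (chipsLT j (frontChips ℓ m j) (k + 1) : ℤ)) -
      ((frontChips ℓ m 1 k).getD 0 -
      m (k + 1) * (chipsLT (1 : ℕ) (frontChips ℓ m 1) (k + 1) : ℤ)) =
      z * (ℓ (k + 1) + m (k + 1)) := by
  by_cases hj : j = 0
  · subst hj
    refine ⟨1, ?_⟩
    rw [chipsLT_frontChips, chipsLT_frontChips, frontChips, frontChips]
    simp
    ring
  · refine ⟨0, ?_⟩
    rw [chipsLT_frontChips, chipsLT_frontChips, frontChips, frontChips]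
    simp [hj]
    ring

end FrontChips

/-! ### The maximal rank property on the extended chain -/

section Extension

variable {g s : ℕ} {ℓ m n ℓ' m' n' : ℕ → ℝ} {hℓ : ∀ k, 0 < ℓ k} {hm : ∀ k, 0 < m k}
  {hn : ∀ k, 0 < n k} {hℓ' : ∀ k, 0 < ℓ' k} {hm' : ∀ k, 0 < m' k} {hn' : ∀ k, 0 < n' k} {N : ℝ}

local notation "𝒞" => chainOfLoops g ℓ m n hℓ hm hn

local notation "𝒞'" => chainOfLoops (g + s) ℓ' m' n' hℓ' hm' hn'

/-- On the old loops both counts change by the same constant, by `hc`, and this constant cancels in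
the difference of moments. -/
theorem MetricGraph.LinEquiv.prepend (hℓs : ∀ k, ℓ' (k + s) = ℓ k)
    (hms : ∀ k, m' (k + s) = m k) {a₁ b₁ a₂ b₂ c₁ c₂ : ℤ} {x₁ x₂ h₁ h₂ : ℕ → Option ℝ}
    (hx₁ : ValidChips g ℓ m x₁) (hx₂ : ValidChips g ℓ m x₂)
    (hX₁ : ValidChips (g + s) ℓ' m' (prependChips s h₁ x₁))
    (hX₂ : ValidChips (g + s) ℓ' m' (prependChips s h₂ x₂))
    (hc : chipsLT c₁ h₁ s - chipsLT c₂ h₂ s = a₁ - a₂)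
    (hmom : ∀ k < s, ∃ z : ℤ, ((h₂ k).getD 0 - m' (k + 1) * (chipsLT c₂ h₂ (k + 1) : ℤ)) -
      ((h₁ k).getD 0 - m' (k + 1) * (chipsLT c₁ h₁ (k + 1) : ℤ)) = z * (ℓ' (k + 1) + m' (k + 1)))
    (h : MetricGraph.LinEquiv 𝒞 (stdDiv 𝒞 a₁ x₁ b₁) (stdDiv 𝒞 a₂ x₂ b₂)) :
    MetricGraph.LinEquiv 𝒞' (stdDiv 𝒞' c₁ (prependChips s h₁ x₁) b₁)
      (stdDiv 𝒞' c₂ (prependChips s h₂ x₂) b₂) := by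
  have e₁ : ∀ k, chipsLT c₁ (prependChips s h₁ x₁) (k + s) =
      chipsLT c₁ h₁ s - a₁ + chipsLT a₁ x₁ k := fun k => by
    rw [chipsLT_prependChips_add, ← chipsLT_add]; congr 1; ring
  have e₂ : ∀ k, chipsLT c₂ (prependChips s h₂ x₂) (k + s) =
      chipsLT c₂ h₂ s - a₂ + chipsLT a₂ x₂ k := fun k => by
    rw [chipsLT_prependChips_add, ← chipsLT_add]; congr 1; ring
  refine stdDiv_linEquiv hX₁ hX₂ ?_ fun k hk => ?_
  · rw [e₁, e₂]
    linarith [h.chipsLT_add_eq]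
  · by_cases hks : k < s
    · rw [chipsLT_prependChips_le hks, chipsLT_prependChips_le hks, prependChips_lt hks,
        prependChips_lt hks]
      exact hmom k hks
    · obtain ⟨k, rfl⟩ : ∃ j, k = j + s := ⟨k - s, by omega⟩
      obtain ⟨z, hz⟩ := h.exists_moment hx₁ hx₂ k (by omega)
      refine ⟨z, ?_⟩
      rw [prependChips_add, prependChips_add, show k + s + 1 = k + 1 + s by ring, e₁, e₂, hms, hℓs,
        ← hz]
      have hc' : (chipsLT c₁ h₁ s : ℝ) - (chipsLT c₂ h₂ s : ℤ) = a₁ - a₂ := by exact_mod_cast hc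
      push_cast
      linear_combination (m (k + 1)) * hc'

lemma tropicallyIndependent_image {ι κ X : Type} [DecidableEq κ] {e : ι → κ}
    {S : Finset ι} {f : κ → X → ℝ}
    (h : TropicallyIndependent S fun i => f (e i)) : TropicallyIndependent (S.image e) f := by
  rintro ⟨b, hb⟩
  refine h ⟨fun i => b (e i), fun x => ?_⟩
  obtain ⟨i, hi, j, hj, hij, h1, h2⟩ := hb x
  obtain ⟨i, hi', rfl⟩ := Finset.mem_image.1 hi
  obtain ⟨j, hj', rfl⟩ := Finset.mem_image.1 hj
  exact ⟨i, hi', j, hj', fun h => hij (congrArg e h), h1,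
    fun k hk => h2 _ (Finset.mem_image_of_mem e hk)⟩

/-- The maximal rank property on the extended chain, if the bridge between the new loops and the
others is long enough. -/
theorem maximalRankOn_of_extendable_chips {r q N₀ : ℕ} (hsr : s ≤ r) (hq : 1 ≤ q)
    (hN₀ : s + 1 + r ≤ N₀) (hlen : ∀ k < s, N₀ * m' (k + 1) < ℓ' (k + 1) + m' (k + 1))
    (hℓs : ∀ k, ℓ' (k + s) = ℓ k) (hms : ∀ k, m' (k + s) = m k)
    {Y : ℕ → ℕ → Option ℝ} (hY : ∀ j ≤ r + 1, ValidChips g ℓ m (Y j))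
    {H : ℕ → MetricGraph.Point 𝒞 → ℝ}
    (hH : ∀ j ≤ r + 1, MetricGraph.Carries 𝒞 (H j)
      (stdDiv 𝒞 (if j = 0 then s + 1 else 0) (Y 1) r) (stdDiv 𝒞 (j - 1 : ℕ) (Y j) (r + 1 - j)))
    (htot : chipsLT 0 (Y 1) g = g - s) {A : Finset (Sym (Fin (r + 1)) q)}
    (hcard : (A.card : ℤ) = q * (g + r - s) - g + 1)
    (hA : TropicallyIndependent A (multisetSum fun i : Fin (r + 1) => H (i + 1))) {M : ℝ}
    (hM : ∀ j ≤ r + 1, ∀ p, |H j p| ≤ M) (hN0 : 0 ≤ N) (hN : 2 * (q * (2 * M)) < N)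
    (hns : n' s = N + n 0) (hnk : ∀ k, 1 ≤ k → n' (k + s) = n k) :
    MaximalRankOn 𝒞' (g + r + 1) (r + 1) q := by
  let X : ℕ → ℕ → Option ℝ := fun j => prependChips s (frontChips ℓ' m' j) (Y j)
  have hX : ∀ j ≤ r + 1, ValidChips (g + s) ℓ' m' (X j) := by
    intro j hj
    refine (validChips_frontChips hm' (by omega : s + j ≤ N₀) hlen).prependChips ?_
    simpa only [hℓs, hms] using hY j hj
  have hcs : ∀ j : ℕ, chipsLT j (X j) s = if j = 0 then 0 else (j : ℤ) + s := by
    intro j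
    rw [chipsLT_prependChips_le le_rfl, chipsLT_frontChips]
    split_ifs with h <;> simp [h]
  -- These are the slopes on the long bridge: `s + 1` for `j = 0` and `1 - j` otherwise. The
  -- truncated `j - 1` is `0` for `j = 0`, in agreement with the transferred divisor having no chip
  -- at the left end.
  have hcs' : ∀ j : ℕ, chipsLT (1 : ℕ) (X 1) s - chipsLT j (X j) s =
      (if j = 0 then (s : ℤ) + 1 else 0) - (j - 1 : ℕ) := by
    intro j
    rw [hcs, hcs]
    rcases j with _ | j
    · simp; ring
    · simp
  have hlinX : ∀ j ≤ r + 1, MetricGraph.LinEquiv 𝒞' (stdDiv 𝒞' (1 : ℕ) (X 1) r)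
      (stdDiv 𝒞' j (X j) ((r + 1 : ℕ) - j)) := by
    intro j hj
    have hc := hcs' j
    rw [chipsLT_prependChips_le le_rfl, chipsLT_prependChips_le le_rfl] at hc
    have := MetricGraph.LinEquiv.prepend (hn' := hn') (hℓ' := hℓ') (hm' := hm') hℓs hms
      (hY 1 (by omega)) (hY j hj) (hX 1 (by omega)) (hX j hj) hc
      (fun k _ => frontChips_moment j k) ⟨H j, hH j hj⟩
    convert this using 2
    push_cast
    rfl
  choose! Φ hΦ using hlinX
  let ψ : Fin (r + 1 + 1) → MetricGraph.Point 𝒞' → ℝ := fun i => Φ i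
  have hψ : ∀ i : Fin (r + 1 + 1), MetricGraph.Carries 𝒞' (ψ i) (stdDiv 𝒞' (1 : ℕ) (X 1) r)
      (stdDiv 𝒞' (i : ℕ) (X i) ((r + 1 : ℕ) - (i : ℕ))) := fun i => hΦ i (by omega)
  have hrestr : ∀ i : Fin (r + 1 + 1), ∃ c, ∀ p : MetricGraph.Point 𝒞,
      ψ i (chainEmbedding N p) = H i p + c := by
    intro i
    have hi : (i : ℕ) ≤ r + 1 := by omega
    exact chainEmbedding_spec hN0 hns hnk hℓs hms (hY 1 (by omega)) (hY i hi) (hX 1 (by omega))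
      (hX i hi) (fun k _ => prependChips_add _ _ _ _) (fun k _ => prependChips_add _ _ _ _)
      (hcs' i) (hH i hi) (hψ i)
  choose c hc using hrestr
  obtain ⟨B, hBcard, hB0, hB1, hBinj⟩ := exists_finset_frontSlope (r := r) hsr hq
  -- The old multisets do not contain `0` after raising the indices, whereas all those of `B` do.
  have hdisj : Disjoint (A.image (Sym.map Fin.succ)) B := by
    rw [Finset.disjoint_left]
    intro I hI hIB
    obtain ⟨J, -, rfl⟩ := Finset.mem_image.1 hI
    obtain ⟨i, -, hi⟩ := Sym.mem_map.1 (hB0 _ hIB)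
    exact Fin.succ_ne_zero i hi
  refine ⟨stdDiv 𝒞' (1 : ℕ) (X 1) r, ?_, hasRank_of_stdDiv hX fun j hj => ⟨_, hΦ j hj⟩,
    vertexAvoiding_of_stdDiv hX fun j hj => ⟨_, hΦ j hj⟩, ψ, fun i => ?_,
    A.image (Sym.map Fin.succ) ∪ B, ?_, ?_⟩
  · have h1 : chipsLT (1 + s) (Y 1) g = 1 + s + (g - s) := by
      rw [← htot, ← chipsLT_add, add_zero]
    rw [deg_stdDiv, chipsLT_prependChips_add, chipsLT_frontChips, if_neg one_ne_zero,
      Nat.cast_one, h1]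
    ring
  · have hi : (i : ℕ) ≤ r + 1 := by omega
    exact ⟨_, stdDiv_nonneg (by positivity) (by omega), stdDiv_leftEnd (hX i hi),
      stdDiv_rightEnd (hX i hi), hψ i⟩
  -- With `d` growing by `s + 1` and the genus by `s`, the target grows by `q * (s + 1) - s`, the
  -- cardinality of `B`. As this many distinct multisets exist, the extended parameters are again in
  -- the surjective range.
  · have h1 : ((A.image (Sym.map Fin.succ) ∪ B).card : ℤ) =
        q * (g + r + 1) - ((g + s : ℕ) : ℤ) + 1 := by
      obtain ⟨q, rfl⟩ : ∃ q', q = q' + 1 := ⟨q - 1, by omega⟩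
      rw [Finset.card_union_of_disjoint hdisj, hBcard,
        Finset.card_image_of_injective _ (Sym.map_injective (Fin.succ_injective _) _),
        Nat.cast_add, hcard, Nat.add_sub_cancel]
      push_cast
      ring
    have h2 : (A.image (Sym.map Fin.succ) ∪ B).card ≤ (r + 1 + q).choose q := by
      refine (Finset.card_le_univ _).trans (le_of_eq ?_)
      rw [Sym.card_sym_eq_choose, Fintype.card_fin]
      congr 1
      omega
    rw [h1, min_eq_right]
    rw [← h1]
    exact_mod_cast h2
  · have hslope : ∀ i : Fin (r + 1 + 1), ∀ t, 0 ≤ t → t ≤ n' s →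
        ψ i (MetricGraph.pt 𝒞' (.bridge ⟨s, by omega⟩) t) =
        ψ i (MetricGraph.pt 𝒞' (.bridge ⟨s, by omega⟩) 0) + (frontSlope s i : ℤ) * t := by
      intro i t h0 ht
      have hi : (i : ℕ) ≤ r + 1 := by omega
      have h1 := (carries_stdDiv_formula (hX 1 (by omega)) (hX i hi) (hψ i)).1 ⟨s, by omega⟩
      rw [h1 t h0 ht, h1 0 le_rfl (hn' s).le, mul_zero, add_zero, hcs' i]
      congr 3
      rw [frontSlope]
      by_cases hi0 : i = 0
      · simp [hi0]
      · have : (i : ℕ) ≠ 0 := fun h => hi0 (Fin.ext h)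
        rw [if_neg hi0, if_neg this, Nat.cast_sub (by omega)]
        push_cast
        ring
    refine tropicallyIndependent_of_path
      (j := (chainEmbedding N : MetricGraph.Point 𝒞 → MetricGraph.Point 𝒞'))
      (γ := fun t => MetricGraph.pt 𝒞' (.bridge ⟨s, by omega⟩) t) (p₀ := .vertex (.w 0))
      (σ := fun I => ((I : Multiset (Fin (r + 1 + 1))).map (frontSlope s)).sum) hN
      (by simp [chainEmbedding]) (fun I _ t h0 ht => ?_) (fun I hI => ?_) hB1 hBinj
      (fun I _ p => ?_) (tropicallyIndependent_image ?_)
    · have := multisetSum_eq_of_forall (ψ := ψ) (ψ' := ψ) (σ := fun i => (frontSlope s i : ℝ))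
        (fun i => hslope i t h0 (by rw [hns]; linarith [hn 0])) I
      rw [this]
      congr 2
      exact (Multiset.map_map (Int.castRingHom ℝ) (frontSlope s) _ ▸
        map_multiset_sum (Int.castRingHom ℝ) _).symm
    · obtain ⟨J, -, rfl⟩ := Finset.mem_image.1 hI
      exact sum_frontSlope_map_succ_nonpos s J
    · have := multisetSum_sub_le (ψ := ψ) (ψ' := ψ) (c := 0) (δ := 2 * M)
        (x := (chainEmbedding N (.vertex (.w 0) : MetricGraph.Point 𝒞) : MetricGraph.Point 𝒞'))
        (y := chainEmbedding N p) (fun i => ?_) I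
      · simpa using this
      · have h1 := abs_le.1 (hM i (by omega) p)
        have h2 := abs_le.1 (hM i (by omega) (.vertex (.w 0)))
        rw [hc, hc, abs_le, Pi.zero_apply]
        constructor <;> linarith
    · refine fun hdep => hA (hdep.comp_of_eq_add (e := 0)
        (c := fun I => -((I : Multiset (Fin (r + 1))).map fun i => c i.succ).sum) fun I _ p => ?_)
      have := multisetSum_eq_of_forall (ψ := fun i : Fin (r + 1) => ψ i.succ)
        (ψ' := fun i : Fin (r + 1) => H (i + 1)) (σ := fun i => c i.succ) (t := 1)
        (x := (chainEmbedding N p : MetricGraph.Point 𝒞')) (y := p)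
        (fun i => by rw [hc, mul_one, Fin.val_succ]) I
      rw [multisetSum_map_succ, this, Pi.zero_apply]
      ring

end Extension

/-! ### Existence of a sufficient bridge length -/

section Existence

variable {g s : ℕ} {ℓ m n ℓ' m' : ℕ → ℝ} {hℓ : ∀ k, 0 < ℓ k} {hm : ∀ k, 0 < m k}
  {hn : ∀ k, 0 < n k} {hℓ' : ∀ k, 0 < ℓ' k} {hm' : ∀ k, 0 < m' k}

/-- The maximal rank property passes to the chain with `s` further loops in front if the bridge
between them and the rest is long enough. -/
theorem MaximalRankOn.exists_extension {r q N₀ : ℕ} (hsr : s ≤ r) (hq : 1 ≤ q)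
    (hN₀ : s + 1 + r + g ≤ N₀)
    (hlen : ∀ k < g + s, N₀ * m' (k + 1) < ℓ' (k + 1) + m' (k + 1))
    (hℓs : ∀ k, ℓ' (k + s) = ℓ k) (hms : ∀ k, m' (k + s) = m k)
    (hsurj : (q : ℤ) * (g + r - s) - g + 1 ≤ ((r + q).choose q : ℤ))
    (h : MaximalRankOn (chainOfLoops g ℓ m n hℓ hm hn) (g + r - s) r q) :
    ∃ L : ℝ, ∀ N > L, ∀ (n' : ℕ → ℝ) (hn' : ∀ k, 0 < n' k), n' s = N + n 0 →
      (∀ k, 1 ≤ k → n' (k + s) = n k) →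
      MaximalRankOn (chainOfLoops (g + s) ℓ' m' n' hℓ' hm' hn') (g + r + 1) (r + 1) q := by
  have hlen' : ∀ k < g, N₀ * m (k + 1) < ℓ (k + 1) + m (k + 1) := fun k hk => by
    rw [← hms, ← hℓs, show k + 1 + s = k + s + 1 by ring]
    exact hlen _ (by omega)
  obtain ⟨Y, hY, hlin, htot, A, hcard, hA⟩ := h.exists_extendable_chips hN₀ hlen'
  choose! H hH using hlin
  obtain ⟨M, hM⟩ : ∃ M, ∀ j ≤ r + 1, ∀ p, |H j p| ≤ M := by
    choose! M hM using fun j (hj : j ≤ r + 1) => (hH j hj).bounded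
    refine ⟨∑ j ∈ Finset.range (r + 2), |M j|, fun j hj p => ?_⟩
    exact ((hM j hj p).trans (le_abs_self _)).trans
      (Finset.single_le_sum (f := fun i => |M i|) (fun _ _ => abs_nonneg _)
        (Finset.mem_range.2 (by omega)))
  -- Each of the `q` summands varies by at most `2 * M` on the old chain, and the path must be
  -- longer than twice the total variation.
  refine ⟨max (2 * (q * (2 * M))) 0, fun N hN n' hn' hns hnk => ?_⟩
  refine maximalRankOn_of_extendable_chips hsr hq (by omega : s + 1 + r ≤ N₀)
    (fun k hk => hlen k (by omega)) hℓs hms hY hH htot (hcard.trans (min_eq_right hsurj))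
    (hA _ fun i => ?_) hM ((le_max_right _ _).trans hN.le) ((le_max_left _ _).trans_lt hN) hns hnk
  have := hH (i + 1) (by omega)
  rw [if_neg (Nat.succ_ne_zero _), Nat.add_sub_cancel] at this
  convert this using 2
  push_cast
  ring

end Existence

/-! ### Admissibility of the edge lengths -/

section Lengths

/-- The last `g` loops of an admissible sequence of `g + s` loops are admissible. -/
lemma AdmissibleLoops.add_right {g s : ℕ} {ℓ m : ℕ → ℝ} (hm : ∀ k, 0 < m k)
    (h : AdmissibleLoops (g + s) ℓ m) :
    AdmissibleLoops g (fun k => ℓ (k + s)) (fun k => m (k + s)) := by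
  obtain ⟨h1, h2⟩ := h
  refine ⟨fun k hk => ?_, fun c hc hsum => ?_⟩
  · rw [Finset.mem_Icc] at hk
    have := h1 (k + s) (Finset.mem_Icc.2 ⟨by omega, by omega⟩)
    push_cast at this
    have h3 : 0 ≤ 4 * (s : ℝ) * m (k + s) := by have := hm (k + s); positivity
    linarith
  · have h3 := h2 (fun k => if s < k then c (k - s) else 0) (fun k hk => ?_) ?_
    · intro k hk
      rw [Finset.mem_Icc] at hk
      have := h3 (k + s) (Finset.mem_Icc.2 ⟨by omega, by omega⟩)
      rwa [if_pos (by omega), Nat.add_sub_cancel] at this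
    · rw [Finset.mem_Icc] at hk
      split_ifs with hks
      · have := hc (k - s) (Finset.mem_Icc.2 ⟨by omega, by omega⟩)
        push_cast
        linarith
      · rw [abs_zero]; positivity
    · rw [← hsum]
      symm
      refine Finset.sum_of_injOn (· + s) (fun a _ b _ hab => by simpa using hab) ?_ ?_ ?_
      · intro k hk
        simp only [Finset.coe_Icc, Set.mem_Icc] at hk ⊢
        omega
      · intro k hk hk'
        rw [if_neg, Int.cast_zero, zero_mul]
        intro hks
        refine hk' ⟨k - s, ?_, Nat.sub_add_cancel hks.le⟩
        rw [Finset.mem_Icc] at hk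
        simp only [Finset.coe_Icc, Set.mem_Icc]
        omega
      · intro k hk
        rw [Finset.mem_Icc] at hk
        rw [if_pos (by omega), Nat.add_sub_cancel]

/-- The lengths of the bridges of the extended chain. -/
def extendBridges (s : ℕ) (P Q N : ℝ) (n : ℕ → ℝ) (k : ℕ) : ℝ :=
  if k = 0 then Q else if k < s then P else if k = s then N + n 0 else n (k - s)

lemma extendBridges_zero (s : ℕ) (P Q N : ℝ) (n : ℕ → ℝ) : extendBridges s P Q N n 0 = Q :=
  if_pos rfl

lemma extendBridges_of_lt {s k : ℕ} (hk : k ≠ 0) (hks : k < s) (P Q N : ℝ) (n : ℕ → ℝ) :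
    extendBridges s P Q N n k = P := by
  rw [extendBridges, if_neg hk, if_pos hks]

lemma extendBridges_self {s : ℕ} (hs : s ≠ 0) (P Q N : ℝ) (n : ℕ → ℝ) :
    extendBridges s P Q N n s = N + n 0 := by
  rw [extendBridges, if_neg hs, if_neg (lt_irrefl s), if_pos rfl]

lemma extendBridges_add {k : ℕ} (hk : 1 ≤ k) (s : ℕ) (P Q N : ℝ) (n : ℕ → ℝ) :
    extendBridges s P Q N n (k + s) = n k := by
  rw [extendBridges, if_neg (by omega), if_neg (by omega), if_neg (by omega), Nat.add_sub_cancel]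

/-- The bridges of the extended chain are admissible if the new ones are long enough. -/
lemma admissibleBridges_extendBridges {g r s : ℕ} {ℓ n : ℕ → ℝ} {C P Q N : ℝ} (hs : s ≠ 0)
    (hn : ∀ k, 0 < n k)
    (h : AdmissibleBridges g r s (fun k => ℓ (k + s)) n C) (hP : ∀ k ∈ Finset.Icc 1 s, C * ℓ k < P)
    (hN0 : 0 ≤ N) (hPQ : P ≤ Q) (hQN : Q ≤ N)
    (hQ : C * (∑ i ∈ Finset.Icc 1 s, ℓ i + (s - 1 : ℕ) * P) < Q) :
    AdmissibleBridges (g + s) (r + 1) s ℓ (extendBridges s P Q N n) C := by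
  have hNs : N < extendBridges s P Q N n s := by
    rw [extendBridges_self hs]; linarith [hn 0]
  have hfront : ∀ k ≤ s, P ≤ extendBridges s P Q N n k := by
    intro k hk
    rcases Nat.eq_zero_or_pos k with rfl | hk0
    · rwa [extendBridges_zero]
    · rcases hk.lt_or_eq with hks | rfl
      · rw [extendBridges_of_lt hk0.ne' hks]
      · linarith
  obtain ⟨h1, h2⟩ := h
  have hback : ∀ k, n k ≤ extendBridges s P Q N n (k + s) := by
    intro k
    rcases Nat.eq_zero_or_pos k with rfl | hk0
    · rw [zero_add, extendBridges_self hs]; linarith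
    · rw [extendBridges_add hk0]
  refine ⟨fun k hk => ?_, fun α hα => ?_⟩
  · rw [Finset.mem_Icc] at hk
    by_cases hks : k ≤ s
    · exact (hP k (Finset.mem_Icc.2 ⟨hk.1, hks⟩)).trans_le
        (le_min (hfront _ (by omega)) (hfront _ hks))
    · obtain ⟨j, rfl⟩ : ∃ j, k = j + s := ⟨k - s, by omega⟩
      have := h1 j (Finset.mem_Icc.2 ⟨by omega, by omega⟩)
      refine this.trans_le (min_le_min ?_ (hback j))
      rw [show j + s - 1 = j - 1 + s by omega]
      exact hback _
  -- The block `0` consists of the new loops and the block `α + 1` is the old block `α`; the bridges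
  -- next to it have not become shorter.
  · rcases α with _ | α
    · have hsum : ∑ i ∈ Finset.Ico 1 s, extendBridges s P Q N n i = (s - 1 : ℕ) * P := by
        rw [Finset.sum_congr rfl fun i hi => extendBridges_of_lt
          (by have := Finset.mem_Ico.1 hi; omega) (Finset.mem_Ico.1 hi).2 P Q N n]
        simp
      simp only [zero_mul, zero_add, one_mul]
      rw [hsum, extendBridges_zero]
      exact hQ.trans_le (le_min le_rfl (by linarith))
    · have e1 : (α + 1) * s + 1 = α * s + 1 + s := by ring
      have e2 : (α + 1 + 1) * s = (α + 1) * s + s := by ring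
      have e3 : (α + 1) * s = α * s + s := by ring
      have hsum₁ : ∑ i ∈ Finset.Icc ((α + 1) * s + 1) ((α + 1 + 1) * s), ℓ i =
          ∑ i ∈ Finset.Icc (α * s + 1) ((α + 1) * s), ℓ (i + s) := by
        rw [e1, e2, ← Finset.map_add_right_Icc, Finset.sum_map]
        rfl
      have hsum₂ : ∑ i ∈ Finset.Ico ((α + 1) * s + 1) ((α + 1 + 1) * s),
          extendBridges s P Q N n i = ∑ i ∈ Finset.Ico (α * s + 1) ((α + 1) * s), n i := by
        rw [e1, e2, ← Finset.map_add_right_Ico, Finset.sum_map]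
        refine Finset.sum_congr rfl fun i hi => ?_
        have := (Finset.mem_Ico.1 hi).1
        exact extendBridges_add (by omega) _ _ _ _ _
      rw [hsum₁, hsum₂]
      refine (h2 α (by omega)).trans_le (min_le_min ?_ ?_)
      · rw [e3]; exact hback _
      · rw [e2]; exact hback _

end Lengths

end

/-! ### The induction step -/

theorem theorem1p2 (r s ρ m : ℕ) (hs : 1 ≤ s) (hm : 1 ≤ m) (hsr : s ≤ r)
    (hsurj : SurjectiveRange r s ρ m) (h : TropicalMRC r s ρ m) :
    TropicalMRC (r + 1) s ρ m := by
  intro ℓ μ hℓ hμ hadm C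
  have hg : mrcGenus (r + 1) s ρ = mrcGenus r s ρ + s := by rw [mrcGenus, mrcGenus]; ring
  have hd : mrcDegree (r + 1) s ρ = mrcGenus r s ρ + r + 1 := by
    rw [mrcDegree, hg]; push_cast; ring
  have hrg : r + 1 ≤ mrcGenus r s ρ :=
    (Nat.le_mul_of_pos_right _ hs).trans (Nat.le_add_right _ _)
  rw [hg] at hadm
  rw [hg, hd]
  obtain ⟨n, hn, hbr, hmax⟩ := h (fun k => ℓ (k + s)) (fun k => μ (k + s)) (fun _ => hℓ _)
    (fun _ => hμ _) (hadm.add_right hμ) C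
  rw [SurjectiveRange] at hsurj
  rw [mrcDegree] at hmax hsurj
  set g := mrcGenus r s ρ
  -- The value `4 * (g + s)` of `N₀` is the constant in the condition on the loop lengths for the
  -- new genus `g + s`; it is large enough since `s ≤ r` and `r + 1 ≤ g`.
  obtain ⟨L, hL⟩ := hmax.exists_extension (hℓ' := hℓ) (hm' := hμ) (N₀ := 4 * (g + s)) hsr hm
    (by omega) (fun k hk => by
      have := hadm.1 (k + 1) (Finset.mem_Icc.2 ⟨by omega, by omega⟩)
      push_cast at this ⊢
      linarith [hμ (k + 1)]) (fun _ => rfl) (fun _ => rfl) hsurj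
  -- The new bridges are chosen in increasing order: `P` dominates the new loops, `Q` the whole new
  -- block including its inner bridges `P`, and `N` both `Q` and the bound `L` for tropical
  -- independence. The bound `L` depends on the old chain and the lengths of the loops, not on these
  -- choices.
  obtain ⟨P, hP0, hP⟩ : ∃ P : ℝ, 0 < P ∧ ∀ k ∈ Finset.Icc 1 s, C * ℓ k < P := by
    refine ⟨∑ k ∈ Finset.Icc 1 s, |C * ℓ k| + 1, by positivity, fun k hk => ?_⟩
    have := Finset.single_le_sum (f := fun k => |C * ℓ k|) (fun _ _ => abs_nonneg _) hk
    linarith [le_abs_self (C * ℓ k)]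
  set Q := max P (C * (∑ i ∈ Finset.Icc 1 s, ℓ i + (s - 1 : ℕ) * P) + 1)
  have hQ0 : 0 < Q := hP0.trans_le (le_max_left _ _)
  set N := max Q (L + 1)
  have hN0 : 0 < N := hQ0.trans_le (le_max_left _ _)
  have hs0 : s ≠ 0 := by omega
  have hpos : ∀ k, 0 < extendBridges s P Q N n k := by
    intro k
    rw [extendBridges]
    split_ifs
    · exact hQ0
    · exact hP0
    · exact add_pos hN0 (hn 0)
    · exact hn _
  refine ⟨extendBridges s P Q N n, hpos, admissibleBridges_extendBridges hs0 hn hbr hP hN0.le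
    (le_max_left _ _) (le_max_left _ _) ((lt_add_one _).trans_le (le_max_right _ _)), ?_⟩
  exact hL N ((lt_add_one _).trans_le (le_max_right _ _)) _ hpos (extendBridges_self hs0 _ _ _ _)
    fun k hk => extendBridges_add hk _ _ _ _ _
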